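/- **Setting.** Let $d\in\{1,2,3\}$ and let $\Omega\subset\mathbb R^d$ be either a rectangle $\prod_{n=1}^d(0,L_n)$ with Dirichlet, Neumann or periodic boundary conditions (in the periodic case $\Omega$ stands for the torus), or, if $d=2$, a triangle with Dirichlet or Neumann boundary conditions. Let $H=L^2(\Omega)$, and let $V=W^{1,2}_0(\Omega)$ (Dirichlet), $V=W^{1,2}(\Omega)$ (Neumann) or $V=W^{1,2}(\mathbb T^d)$ (periodic). Let $A:V\to V'$, $\langle Aw,z\rangle=(\nabla w,\nabla z)_{L^2}+(w,z)_{L^2}$, $A_0=A-\mathbf 1$, $\mathrm D(A)=\{w\in V: Aw\in H\}$, $\|w\|_V^2=\langle Aw,w\rangle$ and $\|w\|_{\mathrm D(A)}=\|Aw\|_H$. **Actuators.** Let $\omega=\prod_{n}(-l_n,l_n)$ have $d+2$ pairwise disjoint translates $c_{1j}+\omega$ ($1\le j\le d+1$) and $c_2+\omega$ in $\Omega$, the points $c_{1j}$ lying in no common affine hyperplane. For $M\ge1$ divide $\Omega$ into rescaled copies of itself: $M^d$ translates of $M^{-1}\Omega$ for a rectangle, and the $4^{M-1}$ triangles obtained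 by $M-1$ midpoint refinements for a triangle. Let $\chi$ run over the affine bijections of these copies onto $\Omega$ that are compositions of a homothety, a translation and (for the inverted subtriangles) the rotation by $\pi$. Put $\varphi(z)=1_\omega(z)\prod_n\sin\bigl(\pi\tfrac{z_n+l_n}{2l_n}\bigr)$ and $$\mathcal U_M=\mathrm{span}\{1_\omega(\chi(\cdot)-c_{1j})\},\quad \widetilde{\mathcal U}_M=\mathrm{span}\{\varphi^2(\chi(\cdot)-c_{1j})\},\quad \mathcal V_M=\mathrm{span}\{1_\omega(\chi(\cdot)-c_2)\},\quad \widetilde{\mathcal V}_M=\mathrm{span}\{\varphi(\chi(\cdot)-c_2)\}.$$ Writing $P_F^{G}$ for the projection onto $F$ along $G$ (extended by duality to $\mathrm D(A)'$, respectively $V'$, where needed), let $$\mathbf F_1=-\lambda_1P_{\mathcal U_M}^{\widetilde{\mathcal U}_M^\perp}A^2P_{\widetilde{\mathcal U}_M}^{\mathcal U_M^\perp},\qquad \mathbf F_2=-\lambda_2P_{\mathcal V_M}^{\widetilde{\mathcal V}_M^\perp}AP_{\widetilde{\mathcal V}_M}^{\mathcal V_M^\perp}.$$ **System.** Let $f,g:\mathbb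 R\to\mathbb R$, let $y_{1\mathtt r}(t)\in H$ be the order parameter of the target, and set $N_h(t,w)=h(y_{1\mathtt r}(t)+w)-h(y_{1\mathtt r}(t))$ for $h\in\{f,g\}$. With $\nu_0,\nu_1\in\mathbb R$ and $\nu_2>0$, consider on $[0,\infty)$ $$\dot z_1=-\nu_2A_0^2z_1-\nu_1\nu_0A_0z_1+\nu_1A_0z_2-A_0N_f(t,z_1)-N_g(t,z_1)+\mathbf F_1z_1,\qquad \dot z_2=-A_0z_2+\nu_0A_0z_1+\mathbf F_2z_2 .\tag{1}$$ This is the oblique-projection feedback system for $z=(y_1,y_2+\nu_0y_1)$, where $y=(y_1,y_2)$ is the difference between the controlled state and the target. A solution is a $z=(z_1,z_2)\in C([0,\infty),H\times H)\cap L^2_{\rm loc}([0,\infty),\mathrm D(A)\times V)$ with $\dot z\in L^2_{\rm loc}([0,\infty),\mathrm D(A)'\times V')$ satisfying (1) in $\mathrm D(A)'\times V'$. **Assumption.** Let $n\ge1$ and let $\zeta^f_i,\eta^f_i,\zeta^g_i,\eta^g_i\ge0$ ($1\le i\le n$) satisfy $\eta_i^f<2$, $\eta_i^g<2$, $\zeta_i^f+\eta_i^f\ge2$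 and $\zeta_i^g+\eta_i^g\ge2$. For almost all $t>0$ and all $w\in\mathrm D(A)$, $N_f(t,w)\in H$, $N_g(t,w)y$ is integrable over $\Omega$ for every $y\in\mathrm D(A)$, and $$-\langle A_0N_f(t,w),w\rangle_{\mathrm D(A)',\mathrm D(A)}\le C_f\sum_{i=1}^n\|w\|_H^{\zeta_i^f}\|w\|_{\mathrm D(A)}^{\eta_i^f},\qquad -\langle N_g(t,w),w\rangle_{\mathrm D(A)',\mathrm D(A)}\le C_g\sum_{i=1}^n\|w\|_H^{\zeta_i^g}\|w\|_{\mathrm D(A)}^{\eta_i^g},$$ with constants $C_f,C_g\ge0$. **Theorem.** Fix $\Omega$, the boundary conditions, the actuator geometry $(l,c_{1j},c_2)$, $n$ and the exponents. There are functions $$\overline M=\overline M(\mu,C_f,C_g,|\nu_0|,|\nu_1|,\nu_2^{-1},R)\in\mathbb N_+,\qquad \overline\lambda_1=\overline\lambda_1(\mu,C_f,C_g,|\nu_0|,|\nu_1|,\nu_2,\nu_2^{-1},R)\ge0,\qquad \overline\lambda_2=\overline\lambda_2(\mu)\ge0,$$ nondecreasing in each of their nonnegative arguments, such that the following holds for all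 $\mu>0$, $R>0$, $C_f,C_g\ge0$, $\nu_0,\nu_1\in\mathbb R$, $\nu_2>0$ and all $f,g,y_{1\mathtt r}$ satisfying the Assumption. If $M\ge\overline M$, $\lambda_1\ge\overline\lambda_1$ and $\lambda_2\ge\overline\lambda_2$, then every solution $z$ of (1) with $\|z(0)\|_{H\times H}\le R$ satisfies, for all $t\ge s\ge0$, $$\|z(t)\|_{H\times H}^2\le e^{-2\mu(t-s)}\|z(s)\|_{H\times H}^2,$$ $$\|z(t)\|_{H\times H}^2+\tfrac{\nu_2}2\|z_1\|_{L^2((s,t),\mathrm D(A))}^2+\tfrac12\|z_2\|_{L^2((s,t),V)}^2+2\mu\|z\|_{L^2((s,t),H\times H)}^2\le\|z(s)\|_{H\times H}^2,$$ and, for all $s\ge0$, these norms are finite over $(s,\infty)$ and $$\tfrac{\nu_2}2\|z_1\|_{L^2((s,\infty),\mathrm D(A))}^2+\tfrac12\|z_2\|_{L^2((s,\infty),V)}^2+2\mu\|z\|_{L^2((s,\infty),H\times H)}^2\le\|z(s)\|_{H\times H}^2 .$$ -/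

import Mathlib

open MeasureTheory Set
open scoped ContDiff RealInnerProductSpace

noncomputable section

namespace CahnHilliard

/-- Euclidean space `ℝ^d`. -/
abbrev E (d : ℕ) : Type := EuclideanSpace ℝ (Fin d)

/-! ### Spatial domains and boundary conditions -/

/-- The spatial domains: the rectangular domain `∏ (0, L n)`, or the open triangle with
vertices `v 0, v 1, v 2` (the latter is used only for `d = 2`). -/
inductive Shape (d : ℕ) : Type
  | rectangle (L : Fin d → ℝ)
  | triangle (v : Fin 3 → E d)

/-- Dirichlet, Neumann or periodic boundary conditions. -/
inductive BC : Type
  | dirichlet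
  | neumann
  | periodic

variable {d : ℕ}

/-- The open set `Ω`. For periodic boundary conditions it is the fundamental cell of the torus. -/
def Shape.carrier : Shape d → Set (E d)
  | .rectangle L => {x | ∀ n, x n ∈ Ioo 0 (L n)}
  | .triangle v => interior (convexHull ℝ (range v))

/-- The side lengths of a rectangle (periodicity is considered for rectangles only). -/
def Shape.period : Shape d → Fin d → ℝ
  | .rectangle L => L
  | .triangle _ => 0

/-- Non-degenerate rectangles with any of the three boundary conditions; non-degenerate planar
triangles with Dirichlet or Neumann boundary conditions. -/
def Shape.Admissible (bc : BC) : Shape d → Prop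
  | .rectangle L => ∀ n, 0 < L n
  | .triangle v => d = 2 ∧ AffineIndependent ℝ v ∧ bc ≠ BC.periodic

/-! ### Function spaces -/

/-- The pivot space `H = L²(Ω)`. -/
abbrev H (S : Shape d) : Type := Lp ℝ 2 (volume.restrict S.carrier)

/-- The element of `L²(Ω)` given by a square integrable function. -/
def toH (S : Shape d) (u : E d → ℝ) : H S :=
  open Classical in
  if h : MemLp u 2 (volume.restrict S.carrier) then h.toLp u else 0

/-- The partial derivative `∂φ/∂xᵢ`. -/
def partialD (φ : E d → ℝ) (i : Fin d) (x : E d) : ℝ :=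
  fderiv ℝ φ x (EuclideanSpace.single i 1)

/-- Smooth functions with compact support contained in `Ω`. -/
def compactTest (S : Shape d) : Set (E d → ℝ) :=
  {φ | ContDiff ℝ ∞ φ ∧ HasCompactSupport φ ∧ tsupport φ ⊆ S.carrier}

/-- Smooth functions on the torus, as periodic functions on `ℝ^d`. -/
def periodicTest (S : Shape d) : Set (E d → ℝ) :=
  {φ | ContDiff ℝ ∞ φ ∧ ∀ (n : Fin d) (x : E d),
    φ (x + EuclideanSpace.single n (S.period n)) = φ x}

/-- `g` is the weak gradient of `u` on `Ω`, with respect to a class of test functions. -/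
def HasWeakGrad (S : Shape d) (test : Set (E d → ℝ)) (u : H S) (g : Fin d → H S) : Prop :=
  ∀ φ ∈ test, ∀ i, ∫ x in S.carrier, u x * partialD φ i x = -∫ x in S.carrier, g i x * φ x

/-- `u` belongs to `V`, with gradient `g`.
Dirichlet: `V = W₀^{1,2}(Ω)`, the closure of the compactly supported smooth functions in
`W^{1,2}(Ω)`. Neumann: `V = W^{1,2}(Ω)`. Periodic: `V = W^{1,2}(𝕋)`, with the weak derivatives
on the torus. -/
def IsGrad (S : Shape d) : BC → H S → (Fin d → H S) → Prop
  | .dirichlet, u, g => ∀ ε > 0, ∃ φ ∈ compactTest S,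
      ∫ x in S.carrier, (u x - φ x) ^ 2 < ε ∧
        ∀ i, ∫ x in S.carrier, (g i x - partialD φ i x) ^ 2 < ε
  | .neumann, u, g => HasWeakGrad S (compactTest S) u g
  | .periodic, u, g => HasWeakGrad S (periodicTest S) u g

/-- The space `V`. -/
def V (S : Shape d) (bc : BC) : Set (H S) := {u | ∃ g, IsGrad S bc u g}

/-- The (weak) gradient of an element of `V`. -/
def grad (S : Shape d) (bc : BC) (u : H S) : Fin d → H S :=
  open Classical in
  if h : ∃ g, IsGrad S bc u g then h.choose else 0

/-- `((w, z))_{V₀} = (∇w, ∇z)_{L²} = ⟨A₀ w, z⟩_{V', V}`. -/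
def formV0 (S : Shape d) (bc : BC) (w z : H S) : ℝ := ∑ i, ⟪grad S bc w i, grad S bc z i⟫

/-- `(w, z)_V = ⟨A w, z⟩_{V', V} = (∇w, ∇z) + (w, z)`. -/
def formV (S : Shape d) (bc : BC) (w z : H S) : ℝ := formV0 S bc w z + ⟪w, z⟫

/-- The norm of `V`. -/
def normV (S : Shape d) (bc : BC) (w : H S) : ℝ := √(formV S bc w w)

/-- `w ∈ V` and `A w = h ∈ H`, where `A : V → V'` is the shifted Laplacian. -/
def IsShiftedLap (S : Shape d) (bc : BC) (w h : H S) : Prop :=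
  w ∈ V S bc ∧ ∀ z ∈ V S bc, formV S bc w z = ⟪h, z⟫

/-- The domain `D(A) = {w ∈ V | A w ∈ H}`. -/
def DA (S : Shape d) (bc : BC) : Set (H S) := {w | ∃ h, IsShiftedLap S bc w h}

/-- The shifted Laplacian `A : D(A) → H`. -/
def opA (S : Shape d) (bc : BC) (w : H S) : H S :=
  open Classical in
  if h : ∃ y, IsShiftedLap S bc w y then h.choose else 0

/-- The (nonshifted) Laplacian `A₀ = A - 1 : D(A) → H`. -/
def opA0 (S : Shape d) (bc : BC) (w : H S) : H S := opA S bc w - w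

/-- The norm of `D(A)`. -/
def normDA (S : Shape d) (bc : BC) (w : H S) : ℝ := ‖opA S bc w‖

/-! ### Actuators and auxiliary functions -/

/-- The reference box `ω = ∏ (-lₙ, lₙ)`. -/
def refBox (l : Fin d → ℝ) : Set (E d) := {z | ∀ n, z n ∈ Ioo (-(l n)) (l n)}

/-- Geometry of the actuators for `M = 1`: the half side lengths of `ω`, the centers of the
`d + 1` translations `ω₁ⱼ` and the center of the remaining translation `ω₂₁`. -/
structure ActuatorData (d : ℕ) where
  l : Fin d → ℝ
  c₁ : Fin (d + 1) → E d
  c₂ : E d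

/-- The `d + 2` translations of `ω` are pairwise disjoint subsets of `Ω`, and the centers of the
first `d + 1` of them are contained in no affine hyperplane. -/
structure ActuatorData.Admissible (a : ActuatorData d) (S : Shape d) : Prop where
  l_pos : ∀ n, 0 < a.l n
  subset₁ : ∀ j, (fun z => a.c₁ j + z) '' refBox a.l ⊆ S.carrier
  subset₂ : (fun z => a.c₂ + z) '' refBox a.l ⊆ S.carrier
  disjoint₁ : ∀ i j, i ≠ j → Disjoint ((fun z => a.c₁ i + z) '' refBox a.l)
    ((fun z => a.c₁ j + z) '' refBox a.l)
  disjoint₂ : ∀ j, Disjoint ((fun z => a.c₁ j + z) '' refBox a.l)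
    ((fun z => a.c₂ + z) '' refBox a.l)
  affine : AffineIndependent ℝ a.c₁

/-- Midpoint refinement of a triangle, iterated `m` times: the set of the `4 ^ m` affine maps
which send one of the subtriangles onto the triangle. The three corner subtriangles are blown up
from their corner; the middle one is blown up and rotated by the angle `π`. -/
def triangleCharts (v : Fin 3 → E d) : ℕ → Set (E d → E d)
  | 0 => {id}
  | m + 1 => {χ | ∃ χ' ∈ triangleCharts v m,
      (∃ i, χ = fun x => χ' ((2 : ℝ) • x - v i)) ∨
        χ = fun x => χ' (v 0 + v 1 + v 2 - (2 : ℝ) • x)}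

/-- The maps sending the rescaled copies of `Ω`, which make up the partition of `Ω` at level `M`,
onto `Ω`: for a rectangle there are `M ^ d` copies, rescaled by `1 / M`; for a triangle there are
`4 ^ (M - 1)` copies, rescaled by `1 / 2 ^ (M - 1)`. -/
def Shape.charts (M : ℕ) : Shape d → Set (E d → E d)
  | .rectangle L => {χ | ∃ k : Fin d → Fin M,
      χ = fun x => WithLp.toLp 2 fun n => (M : ℝ) * x n - ((k n : ℕ) : ℝ) * L n}
  | .triangle v => triangleCharts v (M - 1)

/-- `φ(z) = 1_ω(z) ∏ sin (π (zₙ + lₙ) / (2 lₙ))`. -/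
def bump (l : Fin d → ℝ) : E d → ℝ :=
  (refBox l).indicator fun z => ∏ n, Real.sin (Real.pi * ((z n + l n) / (2 * l n)))

/-- The span of the actuators acting on the order parameter equation. -/
def actU (S : Shape d) (a : ActuatorData d) (M : ℕ) : Submodule ℝ (H S) :=
  Submodule.span ℝ {Φ | ∃ χ ∈ S.charts M, ∃ j,
    Φ = toH S fun x => (refBox a.l).indicator (fun _ => (1 : ℝ)) (χ x - a.c₁ j)}

/-- The span of the actuators acting on the heat equation. -/
def actV (S : Shape d) (a : ActuatorData d) (M : ℕ) : Submodule ℝ (H S) :=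
  Submodule.span ℝ {Ψ | ∃ χ ∈ S.charts M,
    Ψ = toH S fun x => (refBox a.l).indicator (fun _ => (1 : ℝ)) (χ x - a.c₂)}

/-- The span of the auxiliary functions `φ²(…)` for the order parameter equation. -/
def auxU (S : Shape d) (a : ActuatorData d) (M : ℕ) : Submodule ℝ (H S) :=
  Submodule.span ℝ {Φ | ∃ χ ∈ S.charts M, ∃ j,
    Φ = toH S fun x => bump a.l (χ x - a.c₁ j) ^ 2}

/-- The span of the auxiliary functions `φ(…)` for the heat equation. -/
def auxV (S : Shape d) (a : ActuatorData d) (M : ℕ) : Submodule ℝ (H S) :=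
  Submodule.span ℝ {Ψ | ∃ χ ∈ S.charts M, Ψ = toH S fun x => bump a.l (χ x - a.c₂)}

/-! ### The feedback operators -/

/-- The oblique projection `P_F^{G^⊥}` onto `F` along the annihilator of `G`, applied to a
functional `ξ`: the element `u ∈ F` such that `ξ - u` vanishes on `G`. An element `w` of `H` is
identified with the functional `(w, ·)_H`. -/
def obliqueProj (S : Shape d) (F G : Submodule ℝ (H S)) (ξ : H S → ℝ) : H S :=
  open Classical in
  if h : ∃ u ∈ F, ∀ y ∈ G, ⟪u, y⟫ = ξ y then h.choose else 0

/-- `𝐅₁ w = -λ₁ P_U^{Ũ^⊥} A² P_Ũ^{U^⊥} w`, where `A² : D(A) → D(A)'` is given by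
`⟨A² p, y⟩ = (A p, A y)_H`. -/
def feedback₁ (S : Shape d) (bc : BC) (a : ActuatorData d) (M : ℕ) (lam : ℝ) (w : H S) : H S :=
  (-lam) • obliqueProj S (actU S a M) (auxU S a M) fun y =>
    ⟪opA S bc (obliqueProj S (auxU S a M) (actU S a M) fun x => ⟪w, x⟫), opA S bc y⟫

/-- `𝐅₂ w = -λ₂ P_V^{Ṽ^⊥} A P_Ṽ^{V^⊥} w`, with `A : V → V'`. -/
def feedback₂ (S : Shape d) (bc : BC) (a : ActuatorData d) (M : ℕ) (lam : ℝ) (w : H S) : H S :=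
  (-lam) • obliqueProj S (actV S a M) (auxV S a M) fun y =>
    formV S bc (obliqueProj S (auxV S a M) (actV S a M) fun x => ⟪w, x⟫) y

/-! ### Nonlinearities -/

/-- `N_h(t, w) = h(y_r(t) + w) - h(y_r(t))`, as a function on `Ω`; here `h` is `f` or `g` and
`yr` is the order parameter component of the target. -/
def nonlin (S : Shape d) (h : ℝ → ℝ) (yr : ℝ → H S) (t : ℝ) (w : H S) (x : E d) : ℝ :=
  h (yr t x + w x) - h (yr t x)

/-- `⟨A₀ N_f(t, w), y⟩_{D(A)', D(A)} = (N_f(t, w), A₀ y)_H`. -/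
def pairF (S : Shape d) (bc : BC) (f : ℝ → ℝ) (yr : ℝ → H S) (t : ℝ) (w y : H S) : ℝ :=
  ∫ x in S.carrier, nonlin S f yr t w x * opA0 S bc y x

/-- `⟨N_g(t, w), y⟩_{D(A)', D(A)}`. -/
def pairG (S : Shape d) (g : ℝ → ℝ) (yr : ℝ → H S) (t : ℝ) (w y : H S) : ℝ :=
  ∫ x in S.carrier, nonlin S g yr t w x * y x

/-- For almost all `t > 0` and all `w ∈ D(A)`: the functionals `A₀ N_f(t, w)` and `N_g(t, w)` on
`D(A)` are well defined and satisfy the growth bounds with constants `Cf`, `Cg` and the given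
exponents. -/
def GrowthBounds (S : Shape d) (bc : BC) (f g : ℝ → ℝ) (yr : ℝ → H S) {n : ℕ}
    (ζf ηf ζg ηg : Fin n → ℝ) (Cf Cg : ℝ) : Prop :=
  ∀ᵐ t ∂(volume.restrict (Ioi (0 : ℝ))), ∀ w ∈ DA S bc,
    MemLp (nonlin S f yr t w) 2 (volume.restrict S.carrier) ∧
    (∀ y ∈ DA S bc, IntegrableOn (fun x => nonlin S g yr t w x * y x) S.carrier) ∧
    -pairF S bc f yr t w w ≤ Cf * ∑ i, ‖w‖ ^ ζf i * normDA S bc w ^ ηf i ∧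
    -pairG S g yr t w w ≤ Cg * ∑ i, ‖w‖ ^ ζg i * normDA S bc w ^ ηg i

/-! ### The system for the difference to the target -/

/-- `ż = ξ` in `L²_loc([0, ∞), X')`, where `X ⊆ H` is a space with norm `nX` and `ξ(t)` is a
functional on `X`. -/
structure IsTimeDeriv (S : Shape d) (X : Set (H S)) (nX : H S → ℝ) (z : ℝ → H S)
    (ξ : ℝ → H S → ℝ) : Prop where
  bound : ∀ T > 0, ∃ k : ℝ → ℝ, MemLp k 2 (volume.restrict (Ioc 0 T)) ∧
    ∀ᵐ t ∂(volume.restrict (Ioc 0 T)), ∀ y ∈ X, |ξ t y| ≤ k t * nX y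
  integrable : ∀ T > 0, ∀ y ∈ X, IntegrableOn (fun t => ξ t y) (Ioc 0 T)
  eq : ∀ y ∈ X, ∀ s t, 0 ≤ s → s ≤ t → ⟪z t, y⟫ - ⟪z s, y⟫ = ∫ τ in s..t, ξ τ y

/-- `z = (z₁, z₂)` is a (weak) solution on `[0, ∞)` of
`ż₁ = -ν₂ A₀² z₁ - ν₁ ν₀ A₀ z₁ + ν₁ A₀ z₂ - A₀ N_f(t, z₁) - N_g(t, z₁) + 𝐅₁ z₁` in `D(A)'`,
`ż₂ = -A₀ z₂ + ν₀ A₀ z₁ + 𝐅₂ z₂` in `V'`,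
with `z ∈ C([0, ∞), H × H) ∩ L²_loc([0, ∞), D(A) × V)` and
`ż ∈ L²_loc([0, ∞), D(A)' × V')`. -/
structure IsSolution (S : Shape d) (bc : BC) (a : ActuatorData d) (M : ℕ) (lam₁ lam₂ : ℝ)
    (ν₀ ν₁ ν₂ : ℝ) (f g : ℝ → ℝ) (yr : ℝ → H S) (z₁ z₂ : ℝ → H S) : Prop where
  cont₁ : ContinuousOn z₁ (Ici 0)
  cont₂ : ContinuousOn z₂ (Ici 0)
  mem₁ : ∀ᵐ t ∂(volume.restrict (Ioi (0 : ℝ))), z₁ t ∈ DA S bc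
  mem₂ : ∀ᵐ t ∂(volume.restrict (Ioi (0 : ℝ))), z₂ t ∈ V S bc
  memLp₁ : ∀ T > 0, MemLp (fun t => opA S bc (z₁ t)) 2 (volume.restrict (Ioc 0 T))
  memLp₂ : ∀ T > 0, ∀ i, MemLp (fun t => grad S bc (z₂ t) i) 2 (volume.restrict (Ioc 0 T))
  eq₁ : IsTimeDeriv S (DA S bc) (normDA S bc) z₁ fun t y =>
    -ν₂ * ⟪opA0 S bc (z₁ t), opA0 S bc y⟫ - ν₁ * ν₀ * ⟪opA0 S bc (z₁ t), y⟫
      + ν₁ * formV0 S bc (z₂ t) y - pairF S bc f yr t (z₁ t) y - pairG S g yr t (z₁ t) y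
      + ⟪feedback₁ S bc a M lam₁ (z₁ t), y⟫
  eq₂ : IsTimeDeriv S (V S bc) (normV S bc) z₂ fun t y =>
    -formV0 S bc (z₂ t) y + ν₀ * ⟪opA0 S bc (z₁ t), y⟫
      + ⟪feedback₂ S bc a M lam₂ (z₂ t), y⟫

/-- `‖z(t)‖²_{H × H}`. -/
def sqNorm {S : Shape d} (z₁ z₂ : ℝ → H S) (t : ℝ) : ℝ := ‖z₁ t‖ ^ 2 + ‖z₂ t‖ ^ 2

end CahnHilliard

end

open MeasureTheory Set
open scoped ContDiff RealInnerProductSpace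

noncomputable section

namespace CahnHilliard

section

variable {d : ℕ} {S : Shape d} {bc : BC}

/-! ### The domain and its `L²` space -/

/-! The proof is an energy estimate. Testing the first equation with `z₁` and the second with `z₂`
produces the good terms `-ν₂ ‖A₀ z₁‖²` and `-‖∇z₂‖²`. All other terms without feedback are of lower
order. The interpolation inequality `‖w‖_V² ≤ ‖w‖_{D(A)} ‖w‖_H` (`normV_sq_le`) and Young's
inequality (every `η` is below 2) bound the linear terms, the coupling and the nonlinearities by
fractions of `ν₂ ‖z₁‖_{D(A)}²` and `‖z₂‖_V²`, plus multiples of `‖z₁‖_H²` and `‖z₂‖_H²`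
(`energy_algebra`, `growth_le`, `energy_pointwise`).

The feedback absorbs these remainders in the `H`-norm. Let `Θ` be the oblique projection of `w` onto
the span of the auxiliary functions. The two oblique projections in a feedback operator are adjoint
to each other, so `⟨F w, w⟩ = -λ s` with `s = ‖Θ‖²` in the norm of `X = D(A)`, respectively `X = V`
(`IsActFamily.feedback_structure`). The rest `w - Θ` has zero mean over every actuator box.
Poincaré's inequality on cells of size of order at most `1/M` (`exists_poincare_tiling`) therefore
makes its `H`-norm small relative to its `X`-norm, whence `‖w‖² ≤ (C/M) (‖w‖_X² + s) + 2 s`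
(`exists_coercive_feedback₁`, `exists_coercive_feedback₂`). With `M` and `λ` large, any prescribed
multiple of `‖w‖²` is absorbed (`absorb_of_coercive`).

The nonlinear constants depend on a bound for `‖z₁‖`: the condition `ζ + η ≥ 2` leaves a factor
`‖z₁‖²` and a nonnegative power of `‖z₁‖`. As long as the energy is at most `4 R²` it does not
increase; as it starts at or below `R²`, it never gets near `4 R²` (`energy_le_of_bootstrap`). Decay
and the integral bounds follow from the integrated inequality.

Three analytic facts carry this: an energy inequality for functions whose time derivative lies in a
dual space, proved with backward difference quotients (`IsWeakDeriv.norm_sq_sub_le`); a Poincaré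
inequality on convex sets whose constant scales with the diameter (`volume_mul_integral_sq_le`); and
the fact that the truncated sine product lies in `V` and its square in `D(A)`, whatever the boundary
condition (`IsBoundaryFun.mem_V`, `IsBoundaryFun.sq_mem_DA`). -/

lemma isOpen_carrier (S : Shape d) : IsOpen S.carrier := by
  cases S with
  | rectangle L =>
    have : (Shape.rectangle L).carrier = ⋂ n, (fun x : E d => x n) ⁻¹' Ioo 0 (L n) := by
      ext x; simp [Shape.carrier]
    rw [this]
    exact isOpen_iInter_of_finite fun n => isOpen_Ioo.preimage (by fun_prop)
  | triangle v => exact isOpen_interior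

lemma isBounded_carrier (S : Shape d) : Bornology.IsBounded S.carrier := by
  cases S with
  | rectangle L =>
    have h : Bornology.IsBounded (Set.pi univ fun n => Ioo 0 (L n)) :=
      Bornology.IsBounded.pi fun n => Metric.isBounded_Ioo _ _
    have h2 := (PiLp.antilipschitzWith_ofLp 2 (fun _ : Fin d => ℝ)).isBounded_preimage h
    refine h2.subset fun x hx => ?_
    simpa [Shape.carrier] using hx
  | triangle v =>
    exact ((isBounded_convexHull.2 (finite_range v).isBounded)).subset interior_subset

lemma convex_carrier (S : Shape d) : Convex ℝ S.carrier := by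
  cases S with
  | rectangle L =>
    have : (Shape.rectangle L).carrier = ⋂ n, (EuclideanSpace.proj (𝕜 := ℝ) n :
        E d →L[ℝ] ℝ).toLinearMap ⁻¹' Ioo 0 (L n) := by
      ext x; simp [Shape.carrier]
    rw [this]
    exact convex_iInter fun n => (convex_Ioo _ _).linear_preimage _
  | triangle v => exact (convex_convexHull ℝ _).interior

lemma measurableSet_carrier (S : Shape d) : MeasurableSet S.carrier :=
  (isOpen_carrier S).measurableSet

lemma volume_carrier_lt_top (S : Shape d) : volume S.carrier < ⊤ :=
  (isBounded_carrier S).measure_lt_top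

instance : IsFiniteMeasure (volume.restrict S.carrier) :=
  ⟨by simpa using volume_carrier_lt_top S⟩

lemma memLp_of_continuous {u : E d → ℝ} (hu : Continuous u) (p : ENNReal) :
    MemLp u p (volume.restrict S.carrier) := by
  obtain ⟨C, hC⟩ := (isBounded_carrier S).isCompact_closure.exists_bound_of_continuousOn
    hu.continuousOn
  refine MemLp.of_bound hu.aestronglyMeasurable C ?_
  filter_upwards [ae_restrict_mem (measurableSet_carrier S)] with x hx
  exact hC x (subset_closure hx)

lemma coeFn_toH {u : E d → ℝ} (hu : MemLp u 2 (volume.restrict S.carrier)) :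
    toH S u =ᵐ[volume.restrict S.carrier] u := by
  rw [toH, dif_pos hu]; exact hu.coeFn_toLp

lemma toH_add {u v : E d → ℝ} (hu : MemLp u 2 (volume.restrict S.carrier))
    (hv : MemLp v 2 (volume.restrict S.carrier)) :
    toH S (fun x => u x + v x) = toH S u + toH S v := by
  have h : MemLp (fun x => u x + v x) 2 (volume.restrict S.carrier) := hu.add hv
  rw [toH, toH, toH, dif_pos hu, dif_pos hv, dif_pos h]; rfl

lemma toH_const_mul {u : E d → ℝ} (hu : MemLp u 2 (volume.restrict S.carrier)) (c : ℝ) :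
    toH S (fun x => c * u x) = c • toH S u := by
  have h : MemLp (fun x => c * u x) 2 (volume.restrict S.carrier) := hu.const_mul c
  rw [toH, toH, dif_pos hu, dif_pos h]; rfl

lemma inner_eq_integral (u v : H S) : ⟪u, v⟫ = ∫ x in S.carrier, u x * v x := by
  rw [L2.inner_def]
  refine integral_congr_ae (ae_of_all _ fun x => ?_)
  simp [mul_comm]

lemma inner_toH (u : H S) {v : E d → ℝ} (hv : MemLp v 2 (volume.restrict S.carrier)) :
    ⟪u, toH S v⟫ = ∫ x in S.carrier, u x * v x := by
  rw [inner_eq_integral]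
  refine integral_congr_ae ?_
  filter_upwards [coeFn_toH hv] with x hx
  rw [hx]

lemma norm_sq_eq_integral (u : H S) : ‖u‖ ^ 2 = ∫ x in S.carrier, u x ^ 2 := by
  rw [← real_inner_self_eq_norm_sq, inner_eq_integral]
  simp [sq]

lemma norm_sub_toH_sq (u : H S) {v : E d → ℝ} (hv : MemLp v 2 (volume.restrict S.carrier)) :
    ‖u - toH S v‖ ^ 2 = ∫ x in S.carrier, (u x - v x) ^ 2 := by
  rw [norm_sq_eq_integral]
  refine integral_congr_ae ?_
  filter_upwards [coeFn_toH hv, Lp.coeFn_sub u (toH S v)] with x hx hx'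
  rw [hx', Pi.sub_apply, hx]

/-! ### Test functions -/

lemma continuous_partialD {φ : E d → ℝ} (hφ : ContDiff ℝ ∞ φ) (i : Fin d) :
    Continuous (partialD φ i) :=
  (hφ.continuous_fderiv (by simp)).clm_apply continuous_const

lemma memLp_partialD {φ : E d → ℝ} (hφ : ContDiff ℝ ∞ φ) (i : Fin d) :
    MemLp (partialD φ i) 2 (volume.restrict S.carrier) :=
  memLp_of_continuous (continuous_partialD hφ i) 2

lemma partialD_add {φ ψ : E d → ℝ} (hφ : ContDiff ℝ ∞ φ) (hψ : ContDiff ℝ ∞ ψ) (i : Fin d) :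
    partialD (fun x => φ x + ψ x) i = fun x => partialD φ i x + partialD ψ i x := by
  ext x
  simp only [partialD]
  rw [fderiv_fun_add (hφ.differentiable (by simp) x) (hψ.differentiable (by simp) x)]
  simp

lemma partialD_const_mul {φ : E d → ℝ} (hφ : ContDiff ℝ ∞ φ) (c : ℝ) (i : Fin d) :
    partialD (fun x => c * φ x) i = fun x => c * partialD φ i x := by
  ext x
  simp only [partialD]
  rw [fderiv_const_mul (hφ.differentiable (by simp) x)]
  simp

lemma partialD_mul {φ ψ : E d → ℝ} (hφ : ContDiff ℝ ∞ φ) (hψ : ContDiff ℝ ∞ ψ) (i : Fin d) :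
    partialD (fun x => φ x * ψ x) i = fun x => partialD φ i x * ψ x + φ x * partialD ψ i x := by
  ext x
  simp only [partialD]
  rw [fderiv_fun_mul (hφ.differentiable (by simp) x) (hψ.differentiable (by simp) x)]
  simp; ring

lemma contDiff_partialD {φ : E d → ℝ} (hφ : ContDiff ℝ ∞ φ) (i : Fin d) :
    ContDiff ℝ ∞ (partialD φ i) :=
  (hφ.fderiv_right (m := ∞) (by simp)).clm_apply contDiff_const

lemma tsupport_partialD_subset (φ : E d → ℝ) (i : Fin d) :
    tsupport (partialD φ i) ⊆ tsupport φ := by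
  refine closure_minimal (fun x hx => ?_) (isClosed_tsupport φ)
  by_contra h
  exact hx (by simp [partialD, fderiv_of_notMem_tsupport (𝕜 := ℝ) h])

lemma partialD_eq_zero_of_notMem {φ : E d → ℝ} {x : E d} (h : x ∉ tsupport φ) (i : Fin d) :
    partialD φ i x = 0 := by
  simp [partialD, fderiv_of_notMem_tsupport (𝕜 := ℝ) h]

/-- Integration by parts on an open set against a smooth compactly supported function. -/
lemma setIntegral_mul_partialD {U : Set (E d)} {φ η : E d → ℝ} (hφ : ContDiff ℝ ∞ φ)
    (hc : HasCompactSupport φ) (hs : tsupport φ ⊆ U) (hη : ContDiff ℝ ∞ η) (i : Fin d) :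
    ∫ x in U, φ x * partialD η i x = -∫ x in U, partialD φ i x * η x := by
  have hz : ∀ x, x ∉ U → φ x = 0 := fun x hx => image_eq_zero_of_notMem_tsupport fun h => hx (hs h)
  have hz' : ∀ x, x ∉ U → partialD φ i x = 0 := fun x hx =>
    partialD_eq_zero_of_notMem (fun h => hx (hs h)) i
  rw [setIntegral_eq_integral_of_forall_compl_eq_zero fun x hx => by rw [hz x hx, zero_mul],
    setIntegral_eq_integral_of_forall_compl_eq_zero fun x hx => by rw [hz' x hx, zero_mul]]
  have hc' : HasCompactSupport (partialD φ i) :=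
    hc.mono' ((subset_tsupport _).trans (tsupport_partialD_subset φ i))
  refine integral_mul_fderiv_eq_neg_fderiv_mul_of_integrable ?_ ?_ ?_
    (fun x _ => hφ.differentiable (by simp) x) (fun x _ => hη.differentiable (by simp) x)
  · exact ((continuous_partialD hφ i).mul hη.continuous).integrable_of_hasCompactSupport
      (hc'.mul_right)
  · exact (hφ.continuous.mul (continuous_partialD hη i)).integrable_of_hasCompactSupport
      hc.mul_right
  · exact (hφ.continuous.mul hη.continuous).integrable_of_hasCompactSupport hc.mul_right

/-! ### Weak gradients -/

lemma isGrad_dirichlet_iff {u : H S} {g : Fin d → H S} :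
    IsGrad S .dirichlet u g ↔ ∀ ε > 0, ∃ φ ∈ compactTest S,
      ‖u - toH S φ‖ < ε ∧ ∀ i, ‖g i - toH S (partialD φ i)‖ < ε := by
  constructor
  · intro h ε hε
    obtain ⟨φ, hφ, h1, h2⟩ := h (ε ^ 2) (by positivity)
    refine ⟨φ, hφ, ?_, fun i => ?_⟩
    · rw [← norm_sub_toH_sq u (memLp_of_continuous hφ.1.continuous 2)] at h1
      exact lt_of_pow_lt_pow_left₀ 2 hε.le h1
    · have := h2 i
      rw [← norm_sub_toH_sq (g i) (memLp_partialD hφ.1 i)] at this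
      exact lt_of_pow_lt_pow_left₀ 2 hε.le this
  · intro h ε hε
    obtain ⟨φ, hφ, h1, h2⟩ := h (√ε) (by positivity)
    refine ⟨φ, hφ, ?_, fun i => ?_⟩
    · rw [← norm_sub_toH_sq u (memLp_of_continuous hφ.1.continuous 2)]
      calc _ < √ε ^ 2 := by gcongr
        _ = ε := Real.sq_sqrt hε.le
    · rw [← norm_sub_toH_sq (g i) (memLp_partialD hφ.1 i)]
      calc _ < √ε ^ 2 := by gcongr; exact h2 i
        _ = ε := Real.sq_sqrt hε.le

lemma hasWeakGrad_iff {test : Set (E d → ℝ)} (ht : ∀ φ ∈ test, ContDiff ℝ ∞ φ) {u : H S}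
    {g : Fin d → H S} :
    HasWeakGrad S test u g ↔
      ∀ φ ∈ test, ∀ i, ⟪u, toH S (partialD φ i)⟫ = -⟪g i, toH S φ⟫ := by
  refine forall₃_congr fun φ hφ i => ?_
  rw [inner_toH _ (memLp_partialD (ht φ hφ) i),
    inner_toH _ (memLp_of_continuous (ht φ hφ).continuous 2)]

/-- No boundary term appears although `η` is an arbitrary smooth function: `u` is a limit of
compactly supported functions, and for these the integration by parts is classical. -/
lemma IsGrad.inner_partialD_of_dirichlet {u : H S} {g : Fin d → H S}
    (h : IsGrad S .dirichlet u g) {η : E d → ℝ} (hη : ContDiff ℝ ∞ η) (i : Fin d) :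
    ⟪u, toH S (partialD η i)⟫ = -⟪g i, toH S η⟫ := by
  rw [isGrad_dirichlet_iff] at h
  set a := toH S (partialD η i) with ha
  set b := toH S η with hb
  have key : ∀ ε > 0, |⟪u, a⟫ + ⟪g i, b⟫| ≤ ε * (‖a‖ + ‖b‖) := by
    intro ε hε
    obtain ⟨φ, hφ, h1, h2⟩ := h ε hε
    have h0 : ⟪toH S φ, a⟫ + ⟪toH S (partialD φ i), b⟫ = 0 := by
      have := setIntegral_mul_partialD hφ.1 hφ.2.1 hφ.2.2 hη i
      rw [ha, hb, inner_toH _ (memLp_partialD hη i), inner_toH _ (memLp_of_continuous hη.continuous 2)]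
      rw [← sub_eq_zero, sub_neg_eq_add] at this
      rw [← this]
      congr 1
      · refine integral_congr_ae ?_
        filter_upwards [coeFn_toH (memLp_of_continuous (S := S) hφ.1.continuous 2)] with x hx
        rw [hx]
      · refine integral_congr_ae ?_
        filter_upwards [coeFn_toH (memLp_partialD (S := S) hφ.1 i)] with x hx
        rw [hx]
    have e : ⟪u, a⟫ + ⟪g i, b⟫ = ⟪u - toH S φ, a⟫ + ⟪g i - toH S (partialD φ i), b⟫ := by
      rw [inner_sub_left, inner_sub_left]; linarith
    rw [e]
    calc _ ≤ |⟪u - toH S φ, a⟫| + |⟪g i - toH S (partialD φ i), b⟫| := abs_add_le _ _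
      _ ≤ ‖u - toH S φ‖ * ‖a‖ + ‖g i - toH S (partialD φ i)‖ * ‖b‖ :=
        add_le_add (abs_real_inner_le_norm _ _) (abs_real_inner_le_norm _ _)
      _ ≤ ε * ‖a‖ + ε * ‖b‖ := by
        gcongr
        exact (h2 i).le
      _ = _ := by ring
  have hz : |⟪u, a⟫ + ⟪g i, b⟫| ≤ 0 := by
    refine le_of_forall_pos_le_add fun δ hδ => ?_
    have hp : 0 < ‖a‖ + ‖b‖ + 1 := by positivity
    refine (key (δ / (‖a‖ + ‖b‖ + 1)) (by positivity)).trans ?_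
    rw [div_mul_eq_mul_div, zero_add, div_le_iff₀ hp]
    nlinarith [norm_nonneg a, norm_nonneg b]
  have := abs_nonpos_iff.1 hz
  linarith

/-- Elements of `W₀^{1,2}` thus lie in `V` for each boundary condition. The auxiliary functions need
to be studied only in the Dirichlet case. -/
lemma IsGrad.of_dirichlet {u : H S} {g : Fin d → H S} (h : IsGrad S .dirichlet u g) (bc : BC) :
    IsGrad S bc u g := by
  cases bc with
  | dirichlet => exact h
  | neumann =>
    exact (hasWeakGrad_iff fun φ hφ => hφ.1).2 fun φ hφ i => h.inner_partialD_of_dirichlet hφ.1 i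
  | periodic =>
    exact (hasWeakGrad_iff fun φ hφ => hφ.1).2 fun φ hφ i => h.inner_partialD_of_dirichlet hφ.1 i

lemma isGrad_toH {φ : E d → ℝ} (hφ : φ ∈ compactTest S) (bc : BC) :
    IsGrad S bc (toH S φ) fun i => toH S (partialD φ i) :=
  IsGrad.of_dirichlet (isGrad_dirichlet_iff.2 fun ε hε => ⟨φ, hφ, by simpa, fun _ => by simpa⟩) bc

lemma compactTest_add {φ ψ : E d → ℝ} (hφ : φ ∈ compactTest S) (hψ : ψ ∈ compactTest S) :
    (fun x => φ x + ψ x) ∈ compactTest S :=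
  ⟨hφ.1.add hψ.1, hφ.2.1.add hψ.2.1,
    (tsupport_add φ ψ).trans (union_subset hφ.2.2 hψ.2.2)⟩

lemma compactTest_const_mul {φ : E d → ℝ} (hφ : φ ∈ compactTest S) (c : ℝ) :
    (fun x => c * φ x) ∈ compactTest S :=
  ⟨contDiff_const.mul hφ.1, hφ.2.1.mul_left,
    (tsupport_mul_subset_right (f := fun _ => c)).trans hφ.2.2⟩

lemma HasWeakGrad.add {test : Set (E d → ℝ)} (ht : ∀ φ ∈ test, ContDiff ℝ ∞ φ) {u v : H S}
    {g k : Fin d → H S} (h : HasWeakGrad S test u g) (h' : HasWeakGrad S test v k) :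
    HasWeakGrad S test (u + v) (g + k) := by
  rw [hasWeakGrad_iff ht] at *
  intro φ hφ i
  rw [inner_add_left, h φ hφ i, h' φ hφ i, Pi.add_apply, inner_add_left]
  ring

lemma HasWeakGrad.smul {test : Set (E d → ℝ)} (ht : ∀ φ ∈ test, ContDiff ℝ ∞ φ) {u : H S}
    {g : Fin d → H S} (h : HasWeakGrad S test u g) (c : ℝ) :
    HasWeakGrad S test (c • u) (c • g) := by
  rw [hasWeakGrad_iff ht] at *
  intro φ hφ i
  rw [real_inner_smul_left, h φ hφ i, Pi.smul_apply, real_inner_smul_left]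
  ring

lemma IsGrad.add {u v : H S} {g k : Fin d → H S} (h : IsGrad S bc u g) (h' : IsGrad S bc v k) :
    IsGrad S bc (u + v) (g + k) := by
  cases bc with
  | dirichlet =>
    rw [isGrad_dirichlet_iff] at *
    intro ε hε
    obtain ⟨φ, hφ, h1, h2⟩ := h (ε / 2) (by positivity)
    obtain ⟨ψ, hψ, h3, h4⟩ := h' (ε / 2) (by positivity)
    refine ⟨_, compactTest_add hφ hψ, ?_, fun i => ?_⟩
    · rw [toH_add (memLp_of_continuous hφ.1.continuous 2) (memLp_of_continuous hψ.1.continuous 2),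
        add_sub_add_comm]
      exact (norm_add_le _ _).trans_lt (by linarith)
    · rw [partialD_add hφ.1 hψ.1, toH_add (memLp_partialD hφ.1 i) (memLp_partialD hψ.1 i),
        Pi.add_apply, add_sub_add_comm]
      exact (norm_add_le _ _).trans_lt (by linarith [h2 i, h4 i])
  | neumann => exact HasWeakGrad.add (fun φ hφ => hφ.1) h h'
  | periodic => exact HasWeakGrad.add (fun φ hφ => hφ.1) h h'

lemma IsGrad.smul {u : H S} {g : Fin d → H S} (h : IsGrad S bc u g) (c : ℝ) :
    IsGrad S bc (c • u) (c • g) := by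
  cases bc with
  | dirichlet =>
    rw [isGrad_dirichlet_iff] at *
    intro ε hε
    have hp : 0 < |c| + 1 := by positivity
    obtain ⟨φ, hφ, h1, h2⟩ := h (ε / (|c| + 1)) (by positivity)
    have key : ∀ t : ℝ, t < ε / (|c| + 1) → 0 ≤ t → |c| * t < ε := by
      intro t ht ht0
      rw [lt_div_iff₀ hp] at ht
      nlinarith [abs_nonneg c]
    refine ⟨_, compactTest_const_mul hφ c, ?_, fun i => ?_⟩
    · rw [toH_const_mul (memLp_of_continuous hφ.1.continuous 2), ← smul_sub, norm_smul]
      exact key _ h1 (norm_nonneg _)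
    · rw [partialD_const_mul hφ.1, toH_const_mul (memLp_partialD hφ.1 i), Pi.smul_apply,
        ← smul_sub, norm_smul]
      exact key _ (h2 i) (norm_nonneg _)
  | neumann => exact HasWeakGrad.smul (fun φ hφ => hφ.1) h c
  | periodic => exact HasWeakGrad.smul (fun φ hφ => hφ.1) h c

end

section

variable {d : ℕ} {S : Shape d} {bc : BC}

/-! ### Periodic extension of compactly supported functions -/

lemma mul_fract_div_eq {L t : ℝ} (hL : 0 < L) : L * Int.fract (t / L) = t - L * ⌊t / L⌋ := by
  rw [Int.fract, mul_sub, mul_div_cancel₀ _ hL.ne']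

/-- Near a multiple of `L`, the residue modulo `L` is close to `0` from the right or to `L` from the
left, and the closed set `K` stays away from both. -/
lemma eventually_mul_fract_notMem {L t : ℝ} (hL : 0 < L) {K : Set ℝ} (hK : IsClosed K)
    (hKs : K ⊆ Ioo 0 L) (ht : Int.fract (t / L) = 0) :
    ∀ᶠ s in nhds t, L * Int.fract (s / L) ∉ K := by
  have ht' : t - L * ⌊t / L⌋ = 0 := by rw [← mul_fract_div_eq hL, ht, mul_zero]
  set m := ⌊t / L⌋
  have h1 : ∀ᶠ s in nhds t, s - L * m ∉ K := by
    have hc : Filter.Tendsto (fun s => s - L * m) (nhds t) (nhds 0) := by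
      rw [← ht']; exact Continuous.tendsto (by fun_prop) t
    exact hc.eventually (hK.isOpen_compl.mem_nhds fun h => (hKs h).1.ne' rfl)
  have h2 : ∀ᶠ s in nhds t, s - L * m + L ∉ K := by
    have hc : Filter.Tendsto (fun s => s - L * m + L) (nhds t) (nhds L) := by
      have h : Filter.Tendsto (fun s => s - L * m + L) (nhds t) (nhds (t - L * m + L)) :=
        Continuous.tendsto (by fun_prop) t
      rwa [ht', zero_add] at h
    exact hc.eventually (hK.isOpen_compl.mem_nhds fun h => (hKs h).2.ne rfl)
  have h3 : ∀ᶠ s in nhds t, s ∈ Ioo (t - L) (t + L) :=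
    Ioo_mem_nhds (by linarith) (by linarith)
  filter_upwards [h1, h2, h3] with s hs1 hs2 hs3
  rw [mul_fract_div_eq hL]
  rcases le_or_gt t s with h | h
  · have : ⌊s / L⌋ = m := by
      rw [Int.floor_eq_iff, le_div_iff₀ hL, div_lt_iff₀ hL]
      constructor <;> nlinarith [hs3.2]
    rwa [this]
  · have : ⌊s / L⌋ = m - 1 := by
      rw [Int.floor_eq_iff, le_div_iff₀ hL, div_lt_iff₀ hL]
      push_cast
      constructor <;> nlinarith [hs3.1]
    rw [this]
    push_cast
    convert hs2 using 2
    ring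

/-- The extension is `φ` composed with reduction modulo the periods. Off the lattice hyperplanes
this reduction is locally a translation; on them it maps a neighbourhood outside the support of `φ`,
so the extension is locally zero there. Hence it is smooth everywhere. -/
lemma exists_periodicTest_eqOn {L : Fin d → ℝ} (hL : ∀ n, 0 < L n) {φ : E d → ℝ}
    (hφ : φ ∈ compactTest (Shape.rectangle L)) :
    ∃ ψ ∈ periodicTest (Shape.rectangle L), EqOn ψ φ (Shape.rectangle L).carrier := by
  set W : E d → E d := fun x => WithLp.toLp 2 fun n => L n * Int.fract (x n / L n) with hW
  refine ⟨fun x => φ (W x), ⟨?_, fun n x => ?_⟩, fun x hx => ?_⟩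
  · rw [contDiff_iff_contDiffAt]
    intro x
    by_cases hx : ∀ n, Int.fract (x n / L n) ≠ 0
    · have hev : ∀ᶠ y in nhds x, ∀ n, ⌊y n / L n⌋ = ⌊x n / L n⌋ := by
        rw [Filter.eventually_all]
        intro n
        have hpos : (⌊x n / L n⌋ : ℝ) < x n / L n := by
          have := lt_of_le_of_ne (Int.fract_nonneg (x n / L n)) (hx n).symm
          rw [Int.fract] at this; linarith
        have hc : Filter.Tendsto (fun y : E d => y n / L n) (nhds x) (nhds (x n / L n)) :=
          Continuous.tendsto (by fun_prop) x
        filter_upwards [hc.eventually (Ioo_mem_nhds hpos (Int.lt_floor_add_one _))] with y hy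
        exact Int.floor_eq_iff.2 ⟨hy.1.le, hy.2⟩
      have heq : (fun y => φ (W y)) =ᶠ[nhds x] fun y => φ (y - WithLp.toLp 2
          fun n => L n * (⌊x n / L n⌋ : ℝ)) := by
        filter_upwards [hev] with y hy
        congr 1
        ext n
        simp only [hW, PiLp.sub_apply]
        rw [mul_fract_div_eq (hL n), hy n]
      exact ContDiffAt.congr_of_eventuallyEq
        ((hφ.1.comp (contDiff_id.sub contDiff_const)).contDiffAt) heq
    · push Not at hx
      obtain ⟨n, hn⟩ := hx
      have hK : IsCompact ((fun y : E d => y n) '' tsupport φ) :=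
        IsCompact.image hφ.2.1 (by fun_prop)
      have hKs : ((fun y : E d => y n) '' tsupport φ) ⊆ Ioo 0 (L n) := by
        rintro _ ⟨y, hy, rfl⟩
        exact hφ.2.2 hy n
      have hc : Filter.Tendsto (fun y : E d => y n) (nhds x) (nhds (x n)) :=
        Continuous.tendsto (by fun_prop) x
      have heq : (fun y => φ (W y)) =ᶠ[nhds x] fun _ => 0 := by
        filter_upwards [hc.eventually (eventually_mul_fract_notMem (hL n) hK.isClosed hKs hn)]
          with y hy
        exact image_eq_zero_of_notMem_tsupport fun h => hy ⟨_, h, rfl⟩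
      exact contDiffAt_const.congr_of_eventuallyEq heq
  · simp only
    congr 1
    ext m
    simp only [hW, PiLp.add_apply, PiLp.single_apply, Shape.period]
    by_cases h : m = n
    · subst h
      rw [if_pos rfl, add_div, div_self (hL m).ne', Int.fract_add_one]
    · rw [if_neg h, add_zero]
  · simp only
    congr 1
    ext n
    simp only [hW]
    have h := hx n
    have : Int.fract (x n / L n) = x n / L n :=
      Int.fract_eq_self.2 ⟨div_nonneg h.1.le (hL n).le, (div_lt_one (hL n)).2 h.2⟩
    rw [this, mul_div_cancel₀ _ (hL n).ne']

/-! ### Uniqueness of gradients -/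

lemma IsGrad.hasWeakGrad (hS : S.Admissible bc) {u : H S} {g : Fin d → H S}
    (h : IsGrad S bc u g) : HasWeakGrad S (compactTest S) u g := by
  cases bc with
  | dirichlet => exact h.of_dirichlet .neumann
  | neumann => exact h
  | periodic =>
    cases S with
    | triangle v => exact absurd rfl hS.2.2
    | rectangle L =>
      intro φ hφ i
      obtain ⟨ψ, hψ, he⟩ := exists_periodicTest_eqOn hS hφ
      have hm := measurableSet_carrier (Shape.rectangle L)
      have := h ψ hψ i
      have h1 : EqOn (fun x => u x * partialD ψ i x) (fun x => u x * partialD φ i x)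
          (Shape.rectangle L).carrier := fun x hx => by
        simp only [partialD]
        rw [Filter.EventuallyEq.fderiv_eq (he.eventuallyEq_of_mem ((isOpen_carrier _).mem_nhds hx))]
      have h2 : EqOn (fun x => g i x * ψ x) (fun x => g i x * φ x)
          (Shape.rectangle L).carrier := fun x hx => by
        simp only [he hx]
      rwa [setIntegral_congr_fun hm h1, setIntegral_congr_fun hm h2] at this

lemma eq_zero_of_inner_compactTest {u : H S} (h : ∀ φ ∈ compactTest S, ⟪u, toH S φ⟫ = 0) :
    u = 0 := by
  have hint : IntegrableOn u S.carrier := (Lp.memLp u).integrable (by norm_num)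
  have key := (isOpen_carrier S).ae_eq_zero_of_integral_contDiff_smul_eq_zero
    (μ := volume) (f := u) hint.locallyIntegrableOn fun φ h1 h2 h3 => by
      have := h φ ⟨h1, h2, h3⟩
      rw [inner_toH _ (memLp_of_continuous h1.continuous 2)] at this
      rw [← setIntegral_eq_integral_of_forall_compl_eq_zero (s := S.carrier) fun x hx => by
        rw [image_eq_zero_of_notMem_tsupport fun hx' => hx (h3 hx'), zero_smul], ← this]
      simp [mul_comm]
  rw [Lp.eq_zero_iff_ae_eq_zero]
  filter_upwards [(ae_restrict_iff' (measurableSet_carrier S)).2 key] with x hx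
  simpa using hx

/-- `grad` is a choice, so its linearity rests on this uniqueness. For all boundary conditions it
suffices to test with compactly supported functions; in the periodic case these are first extended
periodically. -/
lemma IsGrad.unique (hS : S.Admissible bc) {u : H S} {g k : Fin d → H S}
    (h : IsGrad S bc u g) (h' : IsGrad S bc u k) : g = k := by
  funext i
  rw [← sub_eq_zero]
  refine eq_zero_of_inner_compactTest fun φ hφ => ?_
  have h1 := (hasWeakGrad_iff fun φ hφ => hφ.1).1 (h.hasWeakGrad hS) φ hφ i
  have h2 := (hasWeakGrad_iff fun φ hφ => hφ.1).1 (h'.hasWeakGrad hS) φ hφ i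
  rw [inner_sub_left]
  linarith

/-! ### The spaces `V` and `D(A)` -/

lemma isGrad_grad {u : H S} (hu : u ∈ V S bc) : IsGrad S bc u (grad S bc u) := by
  have h : ∃ g, IsGrad S bc u g := hu
  rw [grad, dif_pos h]
  exact h.choose_spec

lemma IsGrad.grad_eq (hS : S.Admissible bc) {u : H S} {g : Fin d → H S}
    (h : IsGrad S bc u g) : grad S bc u = g :=
  (isGrad_grad ⟨g, h⟩).unique hS h

lemma toH_mem_V {φ : E d → ℝ} (hφ : φ ∈ compactTest S) (bc : BC) : toH S φ ∈ V S bc :=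
  ⟨_, isGrad_toH hφ bc⟩

lemma V_add_mem {u v : H S} (hu : u ∈ V S bc) (hv : v ∈ V S bc) : u + v ∈ V S bc :=
  ⟨_, (isGrad_grad hu).add (isGrad_grad hv)⟩

lemma V_smul_mem {u : H S} (c : ℝ) (hu : u ∈ V S bc) : c • u ∈ V S bc :=
  ⟨_, (isGrad_grad hu).smul c⟩

lemma grad_add (hS : S.Admissible bc) {u v : H S} (hu : u ∈ V S bc) (hv : v ∈ V S bc) :
    grad S bc (u + v) = grad S bc u + grad S bc v :=
  ((isGrad_grad hu).add (isGrad_grad hv)).grad_eq hS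

lemma grad_smul (hS : S.Admissible bc) {u : H S} (c : ℝ) (hu : u ∈ V S bc) :
    grad S bc (c • u) = c • grad S bc u :=
  ((isGrad_grad hu).smul c).grad_eq hS

lemma zero_mem_V : (0 : H S) ∈ V S bc := by
  refine ⟨0, IsGrad.of_dirichlet (isGrad_dirichlet_iff.2 fun ε hε => ?_) bc⟩
  have h0 : toH S (fun _ => 0) = 0 := by
    simpa using toH_const_mul (S := S) (u := fun _ => 0) (memLp_of_continuous continuous_const 2) 0
  refine ⟨fun _ => 0, ⟨contDiff_const, HasCompactSupport.zero, by simp [tsupport]⟩, ?_, fun i => ?_⟩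
  · simpa [h0] using hε
  · have : partialD (fun _ : E d => (0 : ℝ)) i = fun _ => 0 := by ext x; simp [partialD]
    rw [this, h0]; simpa using hε

/-- The space `V` as a subspace of `H`. -/
def submoduleV (S : Shape d) (bc : BC) : Submodule ℝ (H S) where
  carrier := V S bc
  add_mem' := V_add_mem
  zero_mem' := zero_mem_V
  smul_mem' c _ := V_smul_mem c

lemma formV0_add_right (hS : S.Admissible bc) (w : H S) {u v : H S} (hu : u ∈ V S bc)
    (hv : v ∈ V S bc) : formV0 S bc w (u + v) = formV0 S bc w u + formV0 S bc w v := by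
  simp only [formV0, grad_add hS hu hv, Pi.add_apply, inner_add_right, Finset.sum_add_distrib]

lemma formV0_smul_right (hS : S.Admissible bc) (w : H S) {u : H S} (c : ℝ) (hu : u ∈ V S bc) :
    formV0 S bc w (c • u) = c * formV0 S bc w u := by
  simp only [formV0, grad_smul hS c hu, Pi.smul_apply, real_inner_smul_right, Finset.mul_sum]

lemma formV0_comm (w z : H S) : formV0 S bc w z = formV0 S bc z w := by
  simp only [formV0, real_inner_comm]

lemma formV_comm (w z : H S) : formV S bc w z = formV S bc z w := by
  simp only [formV, formV0_comm w z, real_inner_comm]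

lemma formV_add_right (hS : S.Admissible bc) (w : H S) {u v : H S} (hu : u ∈ V S bc)
    (hv : v ∈ V S bc) : formV S bc w (u + v) = formV S bc w u + formV S bc w v := by
  simp only [formV, formV0_add_right hS w hu hv, inner_add_right]; ring

lemma formV_smul_right (hS : S.Admissible bc) (w : H S) {u : H S} (c : ℝ) (hu : u ∈ V S bc) :
    formV S bc w (c • u) = c * formV S bc w u := by
  simp only [formV, formV0_smul_right hS w c hu, real_inner_smul_right]; ring

lemma formV0_self (w : H S) : formV0 S bc w w = ∑ i, ‖grad S bc w i‖ ^ 2 := by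
  simp only [formV0, real_inner_self_eq_norm_sq]

lemma formV0_self_nonneg (w : H S) : 0 ≤ formV0 S bc w w := by
  rw [formV0_self]; positivity

lemma formV_self (w : H S) : formV S bc w w = formV0 S bc w w + ‖w‖ ^ 2 := by
  rw [formV, real_inner_self_eq_norm_sq]

lemma normV_nonneg (w : H S) : 0 ≤ normV S bc w := Real.sqrt_nonneg _

lemma normV_sq (w : H S) : normV S bc w ^ 2 = formV0 S bc w w + ‖w‖ ^ 2 := by
  rw [normV, formV_self, Real.sq_sqrt]
  have := formV0_self_nonneg (bc := bc) w
  positivity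

lemma norm_le_normV (w : H S) : ‖w‖ ≤ normV S bc w := by
  refine le_of_sq_le_sq ?_ (normV_nonneg w)
  rw [normV_sq]; linarith [formV0_self_nonneg (bc := bc) w]

lemma abs_formV0_le (w z : H S) : |formV0 S bc w z| ≤ normV S bc w * normV S bc z := by
  have h1 : formV0 S bc w z ^ 2 ≤ formV0 S bc w w * formV0 S bc z z := by
    rw [formV0_self, formV0_self]
    have h2 : |formV0 S bc w z| ≤ ∑ i, ‖grad S bc w i‖ * ‖grad S bc z i‖ :=
      (Finset.abs_sum_le_sum_abs _ _).trans
        (Finset.sum_le_sum fun i _ => abs_real_inner_le_norm _ _)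
    rw [← sq_abs]
    exact (pow_le_pow_left₀ (abs_nonneg _) h2 2).trans (Finset.sum_mul_sq_le_sq_mul_sq _ _ _)
  refine abs_le_of_sq_le_sq ?_ (mul_nonneg (normV_nonneg w) (normV_nonneg z))
  rw [mul_pow, normV_sq, normV_sq]
  refine h1.trans ?_
  have := formV0_self_nonneg (bc := bc) w
  have := formV0_self_nonneg (bc := bc) z
  gcongr <;> nlinarith [sq_nonneg ‖w‖, sq_nonneg ‖z‖]

lemma IsShiftedLap.unique {w h k : H S} (h1 : IsShiftedLap S bc w h)
    (h2 : IsShiftedLap S bc w k) : h = k := by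
  rw [← sub_eq_zero]
  refine eq_zero_of_inner_compactTest fun φ hφ => ?_
  have e1 := h1.2 _ (toH_mem_V hφ bc)
  have e2 := h2.2 _ (toH_mem_V hφ bc)
  rw [inner_sub_left]; linarith

lemma isShiftedLap_opA {w : H S} (hw : w ∈ DA S bc) : IsShiftedLap S bc w (opA S bc w) := by
  have h : ∃ y, IsShiftedLap S bc w y := hw
  rw [opA, dif_pos h]
  exact h.choose_spec

lemma IsShiftedLap.opA_eq {w h : H S} (hw : IsShiftedLap S bc w h) : opA S bc w = h :=
  (isShiftedLap_opA ⟨h, hw⟩).unique hw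

lemma DA_subset_V {w : H S} (hw : w ∈ DA S bc) : w ∈ V S bc := (isShiftedLap_opA hw).1

lemma IsShiftedLap.add (hS : S.Admissible bc) {w z h k : H S} (h1 : IsShiftedLap S bc w h)
    (h2 : IsShiftedLap S bc z k) : IsShiftedLap S bc (w + z) (h + k) := by
  refine ⟨V_add_mem h1.1 h2.1, fun y hy => ?_⟩
  rw [formV_comm, formV_add_right hS _ h1.1 h2.1, formV_comm y, formV_comm y, h1.2 y hy,
    h2.2 y hy, inner_add_left]

lemma IsShiftedLap.smul (hS : S.Admissible bc) {w h : H S} (h1 : IsShiftedLap S bc w h) (c : ℝ) :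
    IsShiftedLap S bc (c • w) (c • h) := by
  refine ⟨V_smul_mem c h1.1, fun y hy => ?_⟩
  rw [formV_comm, formV_smul_right hS _ c h1.1, formV_comm y, h1.2 y hy, real_inner_smul_left]

/-- The domain of the shifted Laplacian as a subspace of `H`. -/
def submoduleDA (hS : S.Admissible bc) : Submodule ℝ (H S) where
  carrier := DA S bc
  add_mem' hu hv := ⟨_, (isShiftedLap_opA hu).add hS (isShiftedLap_opA hv)⟩
  zero_mem' := ⟨0, zero_mem_V, fun z hz => by
    have := formV_smul_right hS z 0 (zero_mem_V (S := S) (bc := bc))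
    rw [formV_comm]; simpa using this⟩
  smul_mem' c _ hu := ⟨_, (isShiftedLap_opA hu).smul hS c⟩

lemma opA_add (hS : S.Admissible bc) {u v : H S} (hu : u ∈ DA S bc) (hv : v ∈ DA S bc) :
    opA S bc (u + v) = opA S bc u + opA S bc v :=
  ((isShiftedLap_opA hu).add hS (isShiftedLap_opA hv)).opA_eq

lemma opA_smul (hS : S.Admissible bc) {u : H S} (c : ℝ) (hu : u ∈ DA S bc) :
    opA S bc (c • u) = c • opA S bc u :=
  ((isShiftedLap_opA hu).smul hS c).opA_eq

lemma opA0_add (hS : S.Admissible bc) {u v : H S} (hu : u ∈ DA S bc) (hv : v ∈ DA S bc) :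
    opA0 S bc (u + v) = opA0 S bc u + opA0 S bc v := by
  simp only [opA0, opA_add hS hu hv]; abel

lemma opA0_smul (hS : S.Admissible bc) {u : H S} (c : ℝ) (hu : u ∈ DA S bc) :
    opA0 S bc (c • u) = c • opA0 S bc u := by
  simp only [opA0, opA_smul hS c hu, smul_sub]

lemma inner_opA {w z : H S} (hw : w ∈ DA S bc) (hz : z ∈ V S bc) :
    ⟪opA S bc w, z⟫ = formV S bc w z := ((isShiftedLap_opA hw).2 z hz).symm

lemma inner_opA0 {w z : H S} (hw : w ∈ DA S bc) (hz : z ∈ V S bc) :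
    ⟪opA0 S bc w, z⟫ = formV0 S bc w z := by
  rw [opA0, inner_sub_left, inner_opA hw hz, formV]; ring

/-- Interpolation: `‖w‖_V² = (A w, w)_H`, followed by Cauchy–Schwarz. This is what makes every term
of order `V` subordinate to `‖w‖_{D(A)}²`. -/
lemma normV_sq_le {w : H S} (hw : w ∈ DA S bc) : normV S bc w ^ 2 ≤ normDA S bc w * ‖w‖ := by
  rw [normV_sq, ← formV_self, ← inner_opA hw (DA_subset_V hw)]
  exact real_inner_le_norm _ _

lemma norm_le_normDA {w : H S} (hw : w ∈ DA S bc) : ‖w‖ ≤ normDA S bc w := by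
  rcases eq_or_lt_of_le (norm_nonneg w) with h | h
  · rw [← h]; exact norm_nonneg _
  · have h1 := normV_sq_le hw
    have h2 := norm_le_normV (bc := bc) w
    nlinarith

lemma norm_opA0_sq {w : H S} (hw : w ∈ DA S bc) :
    ‖opA0 S bc w‖ ^ 2 = normDA S bc w ^ 2 - 2 * normV S bc w ^ 2 + ‖w‖ ^ 2 := by
  rw [opA0, norm_sub_sq_real, inner_opA hw (DA_subset_V hw), formV_self, ← normV_sq]
  rfl

end

section

variable {d : ℕ}

/-! ### Lower integrals -/

lemma lintegral_mul_sq_le {α : Type*} [MeasurableSpace α] {μ : Measure α} {f g : α → ENNReal}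
    (hf : AEMeasurable f μ) (hg : AEMeasurable g μ) :
    (∫⁻ a, f a * g a ∂μ) ^ 2 ≤ (∫⁻ a, f a ^ 2 ∂μ) * ∫⁻ a, g a ^ 2 ∂μ := by
  have h := ENNReal.lintegral_mul_le_Lp_mul_Lq μ Real.HolderConjugate.two_two hf hg
  calc (∫⁻ a, f a * g a ∂μ) ^ 2
      ≤ ((∫⁻ a, f a ^ (2 : ℝ) ∂μ) ^ (1 / 2 : ℝ) * (∫⁻ a, g a ^ (2 : ℝ) ∂μ) ^ (1 / 2 : ℝ)) ^ 2 := by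
        gcongr; exact h
    _ = _ := by
        rw [mul_pow, ← ENNReal.rpow_natCast, ← ENNReal.rpow_natCast, ← ENNReal.rpow_mul,
          ← ENNReal.rpow_mul]
        norm_num

lemma lintegral_sq_le {α : Type*} [MeasurableSpace α] {μ : Measure α} {f : α → ENNReal}
    (hf : AEMeasurable f μ) : (∫⁻ a, f a ∂μ) ^ 2 ≤ μ univ * ∫⁻ a, f a ^ 2 ∂μ := by
  simpa using lintegral_mul_sq_le (μ := μ) (f := fun _ => 1) aemeasurable_const hf

lemma lintegral_comp_smul_add {h : E d → ENNReal} (hh : Measurable h) {r : ℝ} (hr : r ≠ 0)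
    (c : E d) : ∫⁻ y, h (r • y + c) = ENNReal.ofReal |(r ^ d)⁻¹| * ∫⁻ y, h y := by
  have h1 : ∫⁻ y, h (r • y + c) = ∫⁻ y, h (y + c) ∂(Measure.map (r • ·) volume) :=
    (lintegral_map (hh.comp (measurable_add_const c)) (measurable_const_smul r)).symm
  rw [h1, Measure.map_addHaar_smul _ hr, lintegral_smul_measure, lintegral_add_right_eq_self h c]
  simp

lemma lintegral_lintegral_symmetrize {α : Type*} [MeasurableSpace α] {μ : Measure α} [SFinite μ]
    {Φ : α → α → ENNReal} (hΦ : Measurable (Function.uncurry Φ)) :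
    ∫⁻ x, ∫⁻ y, (2 * Φ x y + 2 * Φ y x) ∂μ ∂μ = 4 * ∫⁻ x, ∫⁻ y, Φ x y ∂μ ∂μ := by
  have hs : Measurable (Function.uncurry fun x y => Φ y x) := hΦ.comp measurable_swap
  have e1 : ∀ x, ∫⁻ y, (2 * Φ x y + 2 * Φ y x) ∂μ
      = 2 * (∫⁻ y, Φ x y ∂μ) + 2 * ∫⁻ y, Φ y x ∂μ := fun x => by
    have m1 : Measurable fun y => Φ x y := hΦ.comp measurable_prodMk_left
    have m2 : Measurable fun y => Φ y x := hΦ.comp measurable_prodMk_right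
    rw [lintegral_add_left (m1.const_mul 2), lintegral_const_mul _ m1, lintegral_const_mul _ m2]
  simp_rw [e1]
  have m3 : Measurable fun x => ∫⁻ y, Φ x y ∂μ := hΦ.lintegral_prod_right'
  have m4 : Measurable fun x => ∫⁻ y, Φ y x ∂μ := hs.lintegral_prod_right'
  rw [lintegral_add_left (m3.const_mul 2), lintegral_const_mul _ m3, lintegral_const_mul _ m4,
    lintegral_lintegral_swap (f := fun x y => Φ y x) hs.aemeasurable, ← add_mul,
    show (2 : ENNReal) + 2 = 4 by norm_num]

/-! ### A difference estimate for smooth functions on convex sets -/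

lemma enorm_sub_le_lintegral_fderiv {f : E d → ℝ} (hf : ContDiff ℝ 1 f) (a v : E d) :
    ‖f (a + v) - f a‖ₑ ≤ ∫⁻ s in Ioc (0 : ℝ) 1, ‖fderiv ℝ f (a + s • v)‖ₑ * ‖v‖ₑ := by
  have hd : ∀ s : ℝ, HasDerivAt (fun s : ℝ => f (a + s • v)) (fderiv ℝ f (a + s • v) v) s := by
    intro s
    have h1 : HasDerivAt (fun s : ℝ => a + s • v) v s := by
      simpa using ((hasDerivAt_id s).smul_const v).const_add a
    exact (hf.differentiable (by simp) _).hasFDerivAt.comp_hasDerivAt s h1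
  have hc : Continuous fun s : ℝ => fderiv ℝ f (a + s • v) v :=
    ((hf.continuous_fderiv (by simp)).comp (by fun_prop)).clm_apply continuous_const
  have h := intervalIntegral.integral_eq_sub_of_hasDerivAt (a := 0) (b := 1) (fun s _ => hd s)
    (hc.intervalIntegrable _ _)
  simp only [one_smul, zero_smul, add_zero] at h
  rw [← h, intervalIntegral.integral_of_le zero_le_one]
  refine (enorm_integral_le_lintegral_enorm _).trans (lintegral_mono fun s => ?_)
  exact ContinuousLinearMap.le_opENorm _ _

/-- Only the half of the segment next to `y` is used. Along it the map `y ↦ (1 - s/2) y + (s/2) x`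
is a homothety of ratio at least `1/2`, so the change of variables costs at most `2 ^ d`. On the
whole segment the ratio `1 - s` would degenerate. -/
lemma lintegral_enorm_sub_midpoint_sq_le {f : E d → ℝ} (hf : ContDiff ℝ 1 f) {K : Set (E d)}
    (hK : Convex ℝ K) (hKm : MeasurableSet K) {D : ENNReal}
    (hD : ∀ x ∈ K, ∀ y ∈ K, ‖x - y‖ₑ ≤ D) {x : E d} (hx : x ∈ K) :
    ∫⁻ y in K, ‖f (y + (1 / 2 : ℝ) • (x - y)) - f y‖ₑ ^ 2
      ≤ D ^ 2 / 4 * 2 ^ d * ∫⁻ y in K, ‖fderiv ℝ f y‖ₑ ^ 2 := by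
  have hcf : Continuous (fderiv ℝ f) := hf.continuous_fderiv (by simp)
  have h1 : ∀ y ∈ K, ‖f (y + (1 / 2 : ℝ) • (x - y)) - f y‖ₑ ^ 2
      ≤ D ^ 2 / 4 * ∫⁻ s in Ioc (0 : ℝ) 1, ‖fderiv ℝ f (y + s • (1 / 2 : ℝ) • (x - y))‖ₑ ^ 2 := by
    intro y hy
    have hv : ‖(1 / 2 : ℝ) • (x - y)‖ₑ ^ 2 ≤ D ^ 2 / 4 := by
      have e : ‖(1 / 2 : ℝ)‖ₑ ^ 2 = 4⁻¹ := by
        rw [Real.enorm_of_nonneg (by norm_num), ← ENNReal.ofReal_pow (by norm_num),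
          show (4 : ENNReal) = ENNReal.ofReal 4 by simp, ← ENNReal.ofReal_inv_of_pos (by norm_num)]
        norm_num
      rw [enorm_smul, mul_pow, e, ENNReal.div_eq_inv_mul]
      gcongr
      exact hD x hx y hy
    have hm : AEMeasurable (fun s : ℝ => ‖fderiv ℝ f (y + s • (1 / 2 : ℝ) • (x - y))‖ₑ)
        (volume.restrict (Ioc (0 : ℝ) 1)) :=
      (hcf.comp (by fun_prop)).enorm.measurable.aemeasurable
    calc _ ≤ (∫⁻ s in Ioc (0 : ℝ) 1, ‖fderiv ℝ f (y + s • (1 / 2 : ℝ) • (x - y))‖ₑ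
            * ‖(1 / 2 : ℝ) • (x - y)‖ₑ) ^ 2 := by
          gcongr; exact enorm_sub_le_lintegral_fderiv hf _ _
      _ = (∫⁻ s in Ioc (0 : ℝ) 1, ‖fderiv ℝ f (y + s • (1 / 2 : ℝ) • (x - y))‖ₑ) ^ 2
            * ‖(1 / 2 : ℝ) • (x - y)‖ₑ ^ 2 := by
          rw [lintegral_mul_const'' _ hm, mul_pow]
      _ ≤ (∫⁻ s in Ioc (0 : ℝ) 1, ‖fderiv ℝ f (y + s • (1 / 2 : ℝ) • (x - y))‖ₑ ^ 2)
            * (D ^ 2 / 4) := by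
          gcongr
          simpa using lintegral_sq_le hm
      _ = _ := mul_comm _ _
  have hjm : Measurable fun p : E d × ℝ =>
      ‖fderiv ℝ f (p.1 + p.2 • (1 / 2 : ℝ) • (x - p.1))‖ₑ ^ 2 :=
    ((hcf.comp (by fun_prop)).enorm.measurable).pow_const 2
  calc _ ≤ ∫⁻ y in K, D ^ 2 / 4 *
        ∫⁻ s in Ioc (0 : ℝ) 1, ‖fderiv ℝ f (y + s • (1 / 2 : ℝ) • (x - y))‖ₑ ^ 2 :=
      setLIntegral_mono' hKm h1
    _ = D ^ 2 / 4 * ∫⁻ s in Ioc (0 : ℝ) 1, ∫⁻ y in K,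
        ‖fderiv ℝ f (y + s • (1 / 2 : ℝ) • (x - y))‖ₑ ^ 2 := by
      rw [lintegral_const_mul _ hjm.lintegral_prod_right', lintegral_lintegral_swap hjm.aemeasurable]
    _ ≤ D ^ 2 / 4 * ∫⁻ s in Ioc (0 : ℝ) 1, 2 ^ d * ∫⁻ y in K, ‖fderiv ℝ f y‖ₑ ^ 2 := by
      gcongr 1
      refine setLIntegral_mono' measurableSet_Ioc fun s hs => ?_
      set r : ℝ := 1 - s / 2
      have hr : (1 / 2 : ℝ) ≤ r := by simp only [r]; linarith [hs.2]
      have hr1 : r ≤ 1 := by simp only [r]; linarith [hs.1]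
      set h : E d → ENNReal := K.indicator fun y => ‖fderiv ℝ f y‖ₑ ^ 2
      have hh : Measurable h := ((hcf.enorm.measurable).pow_const 2).indicator hKm
      calc ∫⁻ y in K, ‖fderiv ℝ f (y + s • (1 / 2 : ℝ) • (x - y))‖ₑ ^ 2
          ≤ ∫⁻ y in K, h (r • y + (s / 2) • x) := by
            refine setLIntegral_mono' hKm fun y hy => ?_
            have e : y + s • (1 / 2 : ℝ) • (x - y) = r • y + (s / 2) • x := by
              simp only [r]; module
            have hmem : r • y + (s / 2) • x ∈ K :=
              hK hy hx (by linarith) (by linarith [hs.1]) (by simp only [r]; ring)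
            rw [e]
            simp only [h, indicator_of_mem hmem, le_refl]
        _ ≤ ∫⁻ y, h (r • y + (s / 2) • x) := setLIntegral_le_lintegral _ _
        _ = ENNReal.ofReal |(r ^ d)⁻¹| * ∫⁻ y, h y := lintegral_comp_smul_add hh (by linarith) _
        _ ≤ 2 ^ d * ∫⁻ y in K, ‖fderiv ℝ f y‖ₑ ^ 2 := by
            rw [lintegral_indicator hKm]
            gcongr
            rw [show (2 : ENNReal) ^ d = ENNReal.ofReal (2 ^ d) by
              rw [ENNReal.ofReal_pow (by norm_num)]; simp]
            apply ENNReal.ofReal_le_ofReal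
            rw [abs_of_nonneg (by positivity), ← inv_pow]
            gcongr
            rw [inv_le_comm₀ (by linarith) (by norm_num)]; linarith
    _ = _ := by simp [mul_assoc]

/-- The difference `f x - f y` is split at the midpoint. The midpoint is symmetric in `x` and `y`,
so both halves are instances of the same half-segment estimate with the variables exchanged. The
factors `4` and `D ^ 2 / 4` combine to `D ^ 2`. -/
lemma lintegral_enorm_sub_sq_le {f : E d → ℝ} (hf : ContDiff ℝ 1 f) {K : Set (E d)}
    (hK : Convex ℝ K) (hKm : MeasurableSet K) {D : ENNReal}
    (hD : ∀ x ∈ K, ∀ y ∈ K, ‖x - y‖ₑ ≤ D) :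
    ∫⁻ x in K, ∫⁻ y in K, ‖f x - f y‖ₑ ^ 2
      ≤ D ^ 2 * 2 ^ d * volume K * ∫⁻ y in K, ‖fderiv ℝ f y‖ₑ ^ 2 := by
  set I := ∫⁻ y in K, ‖fderiv ℝ f y‖ₑ ^ 2
  set Φ : E d → E d → ENNReal := fun x y => ‖f (y + (1 / 2 : ℝ) • (x - y)) - f y‖ₑ ^ 2 with hΦ
  have hfc := hf.continuous
  have hΦm : Measurable (Function.uncurry Φ) := by
    refine Measurable.pow_const (Continuous.measurable (Continuous.enorm ?_)) 2
    fun_prop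
  have hB : ∫⁻ x in K, ∫⁻ y in K, Φ x y ≤ volume K * (D ^ 2 / 4 * 2 ^ d * I) := by
    calc _ ≤ ∫⁻ x in K, D ^ 2 / 4 * 2 ^ d * I := setLIntegral_mono' hKm fun x hx =>
          lintegral_enorm_sub_midpoint_sq_le hf hK hKm hD hx
      _ = _ := by simp [mul_comm]
  have hp : ∀ x y, ‖f x - f y‖ₑ ^ 2 ≤ 2 * Φ x y + 2 * Φ y x := by
    intro x y
    have e : y + (1 / 2 : ℝ) • (x - y) = x + (1 / 2 : ℝ) • (y - x) := by module
    set m := x + (1 / 2 : ℝ) • (y - x) with hm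
    have e2 : f x - f y = (f m - f y) - (f m - f x) := by ring
    simp only [hΦ, e, ← hm]
    rw [e2]
    have h1 : ‖(f m - f y) - (f m - f x)‖ₑ ≤ ‖f m - f y‖ₑ + ‖f m - f x‖ₑ := enorm_sub_le
    calc _ ≤ (‖f m - f y‖ₑ + ‖f m - f x‖ₑ) ^ 2 := by gcongr
      _ ≤ _ := by
        rw [← mul_add]
        have := ENNReal.rpow_add_le_mul_rpow_add_rpow ‖f m - f y‖ₑ ‖f m - f x‖ₑ
          (p := 2) (by norm_num)
        norm_num at this
        exact this
  calc _ ≤ ∫⁻ x in K, ∫⁻ y in K, (2 * Φ x y + 2 * Φ y x) :=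
        lintegral_mono fun x => lintegral_mono fun y => hp x y
    _ = 4 * ∫⁻ x in K, ∫⁻ y in K, Φ x y := lintegral_lintegral_symmetrize hΦm
    _ ≤ 4 * (volume K * (D ^ 2 / 4 * 2 ^ d * I)) := by gcongr
    _ = _ := by
        have : (4 : ENNReal) * (D ^ 2 / 4) = D ^ 2 :=
          ENNReal.mul_div_cancel (by norm_num) (by norm_num)
        calc _ = (4 * (D ^ 2 / 4)) * (2 ^ d * volume K * I) := by ring
          _ = _ := by rw [this]; ring

end

/-! ### Mollification of weakly differentiable functions on an eroded domain -/

section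

variable {d : ℕ}

lemma enorm_clm_sq_le (T : E d →L[ℝ] ℝ) :
    ‖T‖ₑ ^ 2 ≤ ∑ i, ‖T (EuclideanSpace.single i 1)‖ₑ ^ 2 := by
  have h : ‖T‖ ≤ √(∑ i, ‖T (EuclideanSpace.single i 1)‖ ^ 2) := by
    refine T.opNorm_le_bound (Real.sqrt_nonneg _) fun v => ?_
    have hv : T v = ∑ i, v i * T (EuclideanSpace.single i 1) := by
      conv_lhs => rw [← (EuclideanSpace.basisFun (Fin d) ℝ).sum_repr v]
      simp
    rw [hv, EuclideanSpace.norm_eq, ← Real.sqrt_mul (by positivity), Real.norm_eq_abs]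
    refine Real.abs_le_sqrt ?_
    rw [mul_comm]
    simpa using Finset.sum_mul_sq_le_sq_mul_sq Finset.univ (fun i => v i)
      (fun i => T (EuclideanSpace.single i 1))
  have h2 : ‖T‖ ^ 2 ≤ ∑ i, ‖T (EuclideanSpace.single i 1)‖ ^ 2 := by
    rw [← Real.sq_sqrt (show 0 ≤ ∑ i, ‖T (EuclideanSpace.single i 1)‖ ^ 2 by positivity)]
    gcongr
  have := ENNReal.ofReal_le_ofReal h2
  rw [ENNReal.ofReal_sum_of_nonneg fun i _ => by positivity] at this
  simpa only [ENNReal.ofReal_pow (norm_nonneg _), ofReal_norm] using this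

/-- The set of points with distance at least `δ` to the complement of `U`. -/
def erosion (U : Set (E d)) (δ : ℝ) : Set (E d) := (Metric.thickening δ Uᶜ)ᶜ

lemma mem_erosion_iff {U : Set (E d)} {δ : ℝ} {x : E d} :
    x ∈ erosion U δ ↔ Metric.ball x δ ⊆ U := by
  simp only [erosion, mem_compl_iff, Metric.mem_thickening_iff, not_exists, not_and, not_lt]
  constructor
  · intro h y hy
    by_contra hyU
    have := h y hyU
    rw [Metric.mem_ball, dist_comm] at hy
    linarith
  · intro h y hy
    by_contra hlt
    exact hy (h (by rw [Metric.mem_ball, dist_comm]; linarith))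

lemma measurableSet_erosion (U : Set (E d)) (δ : ℝ) : MeasurableSet (erosion U δ) :=
  Metric.isOpen_thickening.measurableSet.compl

lemma convex_erosion {U : Set (E d)} (hU : Convex ℝ U) (δ : ℝ) : Convex ℝ (erosion U δ) := by
  intro x hx y hy a b ha hb hab
  rw [mem_erosion_iff] at *
  intro z hz
  rw [Metric.mem_ball, dist_eq_norm] at hz
  set v := z - (a • x + b • y)
  have h1 : x + v ∈ U := hx (by simpa using hz)
  have h2 : y + v ∈ U := hy (by simpa using hz)
  have : z = a • (x + v) + b • (y + v) := by
    have : a • (x + v) + b • (y + v) = (a • x + b • y) + (a + b) • v := by module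
    rw [this, hab, one_smul]; simp [v]
  rw [this]
  exact hU h1 h2 ha hb hab

lemma erosion_subset {U : Set (E d)} {δ : ℝ} (hδ : 0 < δ) : erosion U δ ⊆ U := fun _ hx =>
  mem_erosion_iff.1 hx (Metric.mem_ball_self hδ)

/-- `g` is the weak gradient of `u` on the open set `U`. -/
def IsWeakGradOn (U : Set (E d)) (u : E d → ℝ) (g : Fin d → E d → ℝ) : Prop :=
  ∀ φ : E d → ℝ, ContDiff ℝ ∞ φ → HasCompactSupport φ → tsupport φ ⊆ U → ∀ i,
    ∫ x in U, u x * partialD φ i x = -∫ x in U, g i x * φ x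

open Convolution in
-- The derivative falls on the kernel. For `x` in the erosion the kernel centred at `x` is supported
-- inside `U`, so it is an admissible test function and the weak gradient can be moved onto `u`.
lemma fderiv_mollify_single {U : Set (E d)} (hUm : MeasurableSet U) {u : E d → ℝ} {g : Fin d → E d → ℝ}
    (hu : IntegrableOn u U) (hw : IsWeakGradOn U u g)
    (φ : ContDiffBump (0 : E d)) {δ : ℝ} (hδ : φ.rOut < δ) {x : E d} (hx : x ∈ erosion U δ)
    (i : Fin d) :
    fderiv ℝ (φ.normed volume ⋆[ContinuousLinearMap.lsmul ℝ ℝ, volume] (U.indicator u)) x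
      (EuclideanSpace.single i 1) = ∫ y, φ.normed volume (x - y) * U.indicator (g i) y := by
  set ρ := φ.normed (volume : Measure (E d))
  have hρ : ContDiff ℝ ∞ ρ := φ.contDiff_normed
  have hρc : HasCompactSupport ρ := φ.hasCompactSupport_normed
  have hi : Integrable (U.indicator u) := hu.integrable_indicator hUm
  have h1 := hρc.hasFDerivAt_convolution_left (ContinuousLinearMap.lsmul ℝ ℝ)
    (hρ.of_le (by simp)) hi.locallyIntegrable x
  have hex := (hρc.fderiv (𝕜 := ℝ)).convolutionExists_left
    ((ContinuousLinearMap.lsmul ℝ ℝ : ℝ →L[ℝ] ℝ →L[ℝ] ℝ).precompL (E d))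
    (hρ.continuous_fderiv (by simp)) hi.locallyIntegrable x
  rw [h1.fderiv, convolution_eq_swap]
  have hex' := hex.integrable_swap
  rw [ContinuousLinearMap.integral_apply hex']
  set η : E d → ℝ := fun y => ρ (x - y)
  have hη : ContDiff ℝ ∞ η := hρ.comp (contDiff_const.sub contDiff_id)
  have hηs : Function.support η ⊆ Metric.closedBall x φ.rOut := by
    intro y hy
    have : x - y ∈ Function.support ρ := hy
    rw [φ.support_normed_eq, mem_ball_zero_iff] at this
    rw [Metric.mem_closedBall, dist_comm, dist_eq_norm]
    exact this.le
  have hts : tsupport η ⊆ Metric.closedBall x φ.rOut :=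
    closure_minimal hηs Metric.isClosed_closedBall
  have hcs : HasCompactSupport η :=
    (isCompact_closedBall x φ.rOut).of_isClosed_subset (isClosed_tsupport _) hts
  have hsU : tsupport η ⊆ U := hts.trans
    ((Metric.closedBall_subset_ball hδ).trans (mem_erosion_iff.1 hx))
  have hder : ∀ y, partialD η i y = -fderiv ℝ ρ (x - y) (EuclideanSpace.single i 1) := by
    intro y
    have h2 : HasFDerivAt η ((fderiv ℝ ρ (x - y)).comp (-ContinuousLinearMap.id ℝ (E d))) y :=
      HasFDerivAt.comp y (hρ.differentiable (by simp) _).hasFDerivAt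
        ((hasFDerivAt_id y).const_sub x)
    rw [partialD, h2.fderiv]; simp
  have hk := hw η hη hcs hsU i
  have e1 : ∀ y, U.indicator (fun y => u y * partialD η i y) y
      = - ((((ContinuousLinearMap.lsmul ℝ ℝ : ℝ →L[ℝ] ℝ →L[ℝ] ℝ).precompL (E d)
        (fderiv ℝ ρ (x - y))) (U.indicator u y)) (EuclideanSpace.single i 1)) := by
    intro y
    by_cases hy : y ∈ U
    · simp [hy, hder, ContinuousLinearMap.precompL_apply, mul_comm]
    · simp [hy]
  have e2 : ∀ y, U.indicator (fun y => g i y * η y) y = ρ (x - y) * U.indicator (g i) y := by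
    intro y
    by_cases hy : y ∈ U
    · simp [hy, η, mul_comm]
    · simp [hy]
  rw [← integral_indicator hUm, ← integral_indicator hUm] at hk
  simp_rw [e1, e2] at hk
  rw [integral_neg] at hk
  exact neg_injective hk

open Convolution in
-- At each point, Cauchy–Schwarz for the probability measure with density `ρ (x - ·)`; then Tonelli
-- and translation invariance remove the kernel. The bound does not depend on the mollifier.
lemma lintegral_fderiv_mollify_le {U : Set (E d)} (hUm : MeasurableSet U) {u : E d → ℝ}
    {g : Fin d → E d → ℝ} (hu : IntegrableOn u U)
    (hg : ∀ i, AEStronglyMeasurable (g i) (volume.restrict U)) (hw : IsWeakGradOn U u g)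
    (φ : ContDiffBump (0 : E d)) {δ : ℝ} (hδ : φ.rOut < δ) :
    ∫⁻ x in erosion U δ, ‖fderiv ℝ (φ.normed volume ⋆[ContinuousLinearMap.lsmul ℝ ℝ, volume]
      (U.indicator u)) x‖ₑ ^ 2 ≤ ∑ i, ∫⁻ x in U, ‖g i x‖ₑ ^ 2 := by
  set ρ := φ.normed (volume : Measure (E d)) with hρ
  have hρc : Continuous ρ := φ.continuous_normed
  have hρ1 : ∫⁻ x, ‖ρ x‖ₑ = 1 := by
    have h := φ.integral_normed (μ := (volume : Measure (E d)))
    rw [← ofReal_integral_norm_eq_lintegral_enorm φ.integrable_normed]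
    simp_rw [Real.norm_of_nonneg (φ.nonneg_normed _)]
    rw [h, ENNReal.ofReal_one]
  have hgm : ∀ i, AEMeasurable (fun y => ‖U.indicator (g i) y‖ₑ) volume := fun i =>
    ((aestronglyMeasurable_indicator_iff hUm).2 (hg i)).enorm
  have hρm : ∀ x, Measurable fun y => ‖ρ (x - y)‖ₑ := fun x =>
    (hρc.comp (by fun_prop)).enorm.measurable
  have h1 : ∀ x ∈ erosion U δ, ‖fderiv ℝ (ρ ⋆[ContinuousLinearMap.lsmul ℝ ℝ, volume]
      (U.indicator u)) x‖ₑ ^ 2 ≤ ∑ i, ∫⁻ y, ‖ρ (x - y)‖ₑ * ‖U.indicator (g i) y‖ₑ ^ 2 := by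
    intro x hx
    refine (enorm_clm_sq_le _).trans (Finset.sum_le_sum fun i _ => ?_)
    rw [fderiv_mollify_single hUm hu hw φ hδ hx i]
    calc _ ≤ (∫⁻ y, ‖U.indicator (g i) y‖ₑ * ‖ρ (x - y)‖ₑ) ^ 2 := by
          gcongr
          refine (enorm_integral_le_lintegral_enorm _).trans (le_of_eq ?_)
          simp_rw [enorm_mul, mul_comm]
          rfl
      _ = (∫⁻ y, ‖U.indicator (g i) y‖ₑ ∂(volume.withDensity fun y => ‖ρ (x - y)‖ₑ)) ^ 2 := by
          rw [lintegral_withDensity_eq_lintegral_mul₀ (hρm x).aemeasurable (hgm i)]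
          simp_rw [Pi.mul_apply, mul_comm]
      _ ≤ _ := lintegral_sq_le ((hgm i).mono_ac (withDensity_absolutelyContinuous _ _))
      _ = _ := by
          rw [withDensity_apply _ MeasurableSet.univ, Measure.restrict_univ,
            lintegral_sub_left_eq_self (fun y => ‖ρ y‖ₑ) x, hρ1, one_mul,
            lintegral_withDensity_eq_lintegral_mul₀ (hρm x).aemeasurable ((hgm i).pow_const 2)]
          simp_rw [Pi.mul_apply]
  have hjm : ∀ i, AEMeasurable (Function.uncurry fun (x y : E d) =>
      ‖ρ (x - y)‖ₑ * ‖U.indicator (g i) y‖ₑ ^ 2) (volume.prod volume) := fun i => by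
    refine AEMeasurable.mul (hρc.comp (by fun_prop : Continuous fun p : E d × E d => p.1 - p.2)
      ).enorm.measurable.aemeasurable ?_
    exact ((hgm i).comp_quasiMeasurePreserving Measure.quasiMeasurePreserving_snd).pow_const 2
  calc _ ≤ ∫⁻ x in erosion U δ, ∑ i, ∫⁻ y, ‖ρ (x - y)‖ₑ * ‖U.indicator (g i) y‖ₑ ^ 2 :=
        setLIntegral_mono' (measurableSet_erosion U δ) h1
    _ ≤ ∫⁻ x, ∑ i, ∫⁻ y, ‖ρ (x - y)‖ₑ * ‖U.indicator (g i) y‖ₑ ^ 2 :=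
        setLIntegral_le_lintegral _ _
    _ = ∑ i, ∫⁻ x, ∫⁻ y, ‖ρ (x - y)‖ₑ * ‖U.indicator (g i) y‖ₑ ^ 2 :=
        lintegral_finsetSum' _ fun i _ => (hjm i).lintegral_prod_right'
    _ = _ := by
        refine Finset.sum_congr rfl fun i _ => ?_
        rw [lintegral_lintegral_swap (hjm i)]
        have : ∀ y, ∫⁻ x, ‖ρ (x - y)‖ₑ * ‖U.indicator (g i) y‖ₑ ^ 2
            = ‖U.indicator (g i) y‖ₑ ^ 2 := fun y => by
          have hm : Measurable fun x => ‖ρ (x - y)‖ₑ :=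
            (hρc.comp (by fun_prop : Continuous fun x : E d => x - y)).enorm.measurable
          rw [lintegral_mul_const _ hm, lintegral_sub_right_eq_self (fun x => ‖ρ x‖ₑ) y, hρ1, one_mul]
        simp_rw [this]
        rw [← lintegral_indicator hUm]
        congr 1 with y
        by_cases hy : y ∈ U <;> simp [hy]

end

/-! ### Passage to the limit and the Poincaré inequality -/

section

variable {d : ℕ}

/-- Fatou's lemma, applied once in each variable. -/
lemma lintegral_lintegral_sub_sq_le_of_tendsto {α : Type*} [MeasurableSpace α] {μ : Measure α}
    [SFinite μ] {f : ℕ → α → ℝ} {u : α → ℝ} (hf : ∀ n, Measurable (f n))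
    (hlim : ∀ᵐ x ∂μ, Filter.Tendsto (fun n => f n x) Filter.atTop (nhds (u x))) {C : ENNReal}
    (hC : ∀ n, ∫⁻ x, ∫⁻ y, ‖f n x - f n y‖ₑ ^ 2 ∂μ ∂μ ≤ C) :
    ∫⁻ x, ∫⁻ y, ‖u x - u y‖ₑ ^ 2 ∂μ ∂μ ≤ C := by
  have hfm : ∀ n, Measurable (Function.uncurry fun x y => ‖f n x - f n y‖ₑ ^ 2) := fun n =>
    (((hf n).comp measurable_fst).sub ((hf n).comp measurable_snd)).enorm.pow_const 2
  calc _ ≤ ∫⁻ x, ∫⁻ y, Filter.liminf (fun n => ‖f n x - f n y‖ₑ ^ 2) Filter.atTop ∂μ ∂μ := by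
        refine lintegral_mono_ae ?_
        filter_upwards [hlim] with x hx
        refine lintegral_mono_ae ?_
        filter_upwards [hlim] with y hy
        have ht : Filter.Tendsto (fun n => ‖f n x - f n y‖ₑ ^ 2) Filter.atTop
            (nhds (‖u x - u y‖ₑ ^ 2)) :=
          ((ENNReal.continuous_pow 2).tendsto _).comp ((hx.sub hy).enorm)
        rw [ht.liminf_eq]
    _ ≤ ∫⁻ x, Filter.liminf (fun n => ∫⁻ y, ‖f n x - f n y‖ₑ ^ 2 ∂μ) Filter.atTop ∂μ := by
        refine lintegral_mono fun x => lintegral_liminf_le fun n => ?_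
        exact (hfm n).comp measurable_prodMk_left
    _ ≤ Filter.liminf (fun n => ∫⁻ x, ∫⁻ y, ‖f n x - f n y‖ₑ ^ 2 ∂μ ∂μ) Filter.atTop :=
        lintegral_liminf_le fun n => (hfm n).lintegral_prod_right'
    _ ≤ _ := Filter.liminf_le_of_le (by isBoundedDefault) fun b hb => by
        obtain ⟨n, hn⟩ := hb.exists
        exact hn.trans (hC n)

open Convolution in
lemma lintegral_erosion_sub_sq_le {U : Set (E d)} (hUm : MeasurableSet U) (hUc : Convex ℝ U)
    {u : E d → ℝ} {g : Fin d → E d → ℝ} (hu : IntegrableOn u U)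
    (hg : ∀ i, AEStronglyMeasurable (g i) (volume.restrict U)) (hw : IsWeakGradOn U u g)
    {D : ENNReal} (hD : ∀ x ∈ U, ∀ y ∈ U, ‖x - y‖ₑ ≤ D) {δ : ℝ} (hδ : 0 < δ) :
    ∫⁻ x in erosion U δ, ∫⁻ y in erosion U δ, ‖U.indicator u x - U.indicator u y‖ₑ ^ 2
      ≤ D ^ 2 * 2 ^ d * volume U * ∑ i, ∫⁻ x in U, ‖g i x‖ₑ ^ 2 := by
  set K := erosion U δ
  have hKU : K ⊆ U := erosion_subset hδ
  have hKm : MeasurableSet K := measurableSet_erosion U δ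
  -- The shift by 2 keeps all outer radii strictly below `δ`, also for `n = 0`. The constant ratio 2
  -- of the radii is what almost everywhere convergence of the mollifications requires.
  obtain ⟨φ, hφ, hφ'⟩ : ∃ φ : ℕ → ContDiffBump (0 : E d),
      (∀ n, (φ n).rOut = δ / (n + 2)) ∧ ∀ n, (φ n).rIn = δ / (n + 2) / 2 :=
    ⟨fun n => ⟨δ / (n + 2) / 2, δ / (n + 2), by positivity, half_lt_self (by positivity)⟩,
      fun n => rfl, fun n => rfl⟩
  let f : ℕ → E d → ℝ := fun n =>
    (φ n).normed volume ⋆[ContinuousLinearMap.lsmul ℝ ℝ, volume] (U.indicator u)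
  have hi : Integrable (U.indicator u) := hu.integrable_indicator hUm
  have hf : ∀ n, ContDiff ℝ 1 (f n) := fun n =>
    (φ n).hasCompactSupport_normed.contDiff_convolution_left _ (φ n).contDiff_normed
      hi.locallyIntegrable
  have hlt : ∀ n, (φ n).rOut < δ := fun n => by
    rw [hφ, div_lt_iff₀ (by positivity)]
    nlinarith [(Nat.cast_nonneg n : (0 : ℝ) ≤ n)]
  have hlim : ∀ᵐ x, Filter.Tendsto (fun n => f n x) Filter.atTop (nhds (U.indicator u x)) := by
    refine ContDiffBump.ae_convolution_tendsto_right_of_locallyIntegrable (K := 2) ?_ ?_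
      hi.locallyIntegrable
    · simp_rw [hφ]
      exact tendsto_const_nhds.div_atTop
        (Filter.tendsto_atTop_add_const_right _ _ tendsto_natCast_atTop_atTop)
    · refine Filter.Eventually.of_forall fun n => le_of_eq ?_
      rw [hφ, hφ']
      ring
  have hbound : ∀ n, ∫⁻ x in K, ∫⁻ y in K, ‖f n x - f n y‖ₑ ^ 2
      ≤ D ^ 2 * 2 ^ d * volume U * ∑ i, ∫⁻ x in U, ‖g i x‖ₑ ^ 2 := fun n => by
    refine (lintegral_enorm_sub_sq_le (hf n) (convex_erosion hUc δ) hKm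
      fun x hx y hy => hD x (hKU hx) y (hKU hy)).trans ?_
    gcongr
    exact lintegral_fderiv_mollify_le hUm hu hg hw (φ n) (hlt n)
  exact lintegral_lintegral_sub_sq_le_of_tendsto (fun n => (hf n).continuous.measurable)
    (ae_restrict_of_ae hlim) hbound

lemma iUnion_erosion {U : Set (E d)} (hU : IsOpen U) :
    ⋃ n : ℕ, erosion U (1 / ((n : ℝ) + 1)) = U := by
  refine subset_antisymm (iUnion_subset fun n => erosion_subset (by positivity)) fun x hx => ?_
  obtain ⟨ε, hε, h⟩ := Metric.isOpen_iff.1 hU x hx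
  obtain ⟨n, hn⟩ := exists_nat_one_div_lt hε
  exact mem_iUnion.2 ⟨n, mem_erosion_iff.2 ((Metric.ball_subset_ball hn.le).trans h)⟩

lemma erosion_antitone (U : Set (E d)) : Antitone (erosion U) := fun _ _ h =>
  compl_subset_compl.2 (Metric.thickening_mono h _)

/-- Monotone convergence along the erosions, which exhaust `U`. The double integral is read on the
product space, where the squares of the erosions increase to `U ×ˢ U`. -/
lemma lintegral_sub_sq_le {U : Set (E d)} (hU : IsOpen U) (hUc : Convex ℝ U)
    {u : E d → ℝ} {g : Fin d → E d → ℝ} (hu : IntegrableOn u U)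
    (hg : ∀ i, AEStronglyMeasurable (g i) (volume.restrict U)) (hw : IsWeakGradOn U u g)
    {D : ENNReal} (hD : ∀ x ∈ U, ∀ y ∈ U, ‖x - y‖ₑ ≤ D) :
    ∫⁻ x in U, ∫⁻ y in U, ‖u x - u y‖ₑ ^ 2
      ≤ D ^ 2 * 2 ^ d * volume U * ∑ i, ∫⁻ x in U, ‖g i x‖ₑ ^ 2 := by
  have hUm := hU.measurableSet
  set F : E d × E d → ENNReal := fun p => ‖U.indicator u p.1 - U.indicator u p.2‖ₑ ^ 2
  have hi : AEStronglyMeasurable (U.indicator u) :=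
    (hu.integrable_indicator hUm).aestronglyMeasurable
  have hF : AEMeasurable F (volume.prod volume) :=
    (hi.comp_fst.sub hi.comp_snd).enorm.pow_const 2
  have hprod : ∀ K : Set (E d), ∫⁻ p in K ×ˢ K, F p ∂(volume.prod volume)
      = ∫⁻ x in K, ∫⁻ y in K, ‖U.indicator u x - U.indicator u y‖ₑ ^ 2 := fun K => by
    rw [← Measure.prod_restrict, lintegral_prod]
    rw [Measure.prod_restrict]; exact hF.restrict
  have e1 : ∫⁻ x in U, ∫⁻ y in U, ‖u x - u y‖ₑ ^ 2 = ∫⁻ p in U ×ˢ U, F p ∂(volume.prod volume) := by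
    rw [hprod U]
    refine setLIntegral_congr_fun hUm fun x hx => ?_
    refine setLIntegral_congr_fun hUm fun y hy => ?_
    simp [hx, hy]
  set K : ℕ → Set (E d) := fun n => erosion U (1 / ((n : ℝ) + 1)) with hK
  have hKmono : Monotone K := fun m n h => erosion_antitone U (Nat.one_div_le_one_div h)
  have e2 : U ×ˢ U = ⋃ n, K n ×ˢ K n := by
    rw [iUnion_prod_of_monotone hKmono hKmono, hK, iUnion_erosion hU]
  rw [e1, e2, setLIntegral_iUnion_of_directed]
  · refine iSup_le fun n => ?_
    rw [hprod]
    exact lintegral_erosion_sub_sq_le hUm hUc hu hg hw hD (by positivity)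
  · exact Monotone.directed_le fun m n h => prod_mono (hKmono h) (hKmono h)

/-- **Poincaré inequality** on a bounded convex open set `U`, for functions with zero mean over a
subset `B`. -/
theorem volume_mul_integral_sq_le {U B : Set (E d)} (hU : IsOpen U) (hUc : Convex ℝ U)
    (hUv : volume U < ⊤) (hB : B ⊆ U) {u : E d → ℝ}
    {g : Fin d → E d → ℝ} (hu : MemLp u 2 (volume.restrict U))
    (hg : ∀ i, MemLp (g i) 2 (volume.restrict U)) (hw : IsWeakGradOn U u g) {D : ℝ} (hD0 : 0 ≤ D)
    (hD : ∀ x ∈ U, ∀ y ∈ U, ‖x - y‖ ≤ D) (hmean : ∫ x in B, u x = 0) :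
    volume.real B * ∫ x in U, u x ^ 2
      ≤ D ^ 2 * 2 ^ d * volume.real U * ∑ i, ∫ x in U, g i x ^ 2 := by
  have : IsFiniteMeasure (volume.restrict U) := ⟨by simpa using hUv⟩
  have hBv : volume B < ⊤ := (measure_mono hB).trans_lt hUv
  have : IsFiniteMeasure (volume.restrict B) := ⟨by simpa using hBv⟩
  have huI : IntegrableOn u U := hu.integrable (by norm_num)
  have huB : MemLp u 2 (volume.restrict B) := hu.mono_measure (Measure.restrict_mono hB le_rfl)
  have h1 := lintegral_sub_sq_le hU hUc huI (fun i => (hg i).1) hw (D := ENNReal.ofReal D)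
    fun x hx y hy => by
      rw [← ofReal_norm]; exact ENNReal.ofReal_le_ofReal (hD x hx y hy)
  have hsq : ∀ {v : E d → ℝ}, MemLp v 2 (volume.restrict U) →
      ∫⁻ x in U, ‖v x‖ₑ ^ 2 = ENNReal.ofReal (∫ x in U, v x ^ 2) := fun {v} hv => by
    rw [ofReal_integral_eq_lintegral_ofReal hv.integrable_sq (ae_of_all _ fun x => sq_nonneg _)]
    refine lintegral_congr fun x => ?_
    rw [← sq_abs, ENNReal.ofReal_pow (abs_nonneg _), ← Real.enorm_eq_ofReal_abs]
  -- Integrating `(u x - u y) ^ 2` over `y ∈ B`, the mixed term vanishes by the zero mean and the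
  -- integral of `u y ^ 2` is dropped.
  have h2 : ∀ x : E d, volume B * ‖u x‖ₑ ^ 2 ≤ ∫⁻ y in U, ‖u x - u y‖ₑ ^ 2 := by
    intro x
    have hint : Integrable (fun y => (u x - u y) ^ 2) (volume.restrict B) :=
      ((memLp_const (u x)).sub huB).integrable_sq
    have huB1 : Integrable u (volume.restrict B) := huB.integrable (by norm_num)
    have e : volume.real B * u x ^ 2 ≤ ∫ y in B, (u x - u y) ^ 2 := by
      have e1 : ∫ y in B, (u x - u y) ^ 2
          = ∫ y in B, (u x ^ 2 - 2 * u x * u y + u y ^ 2) := by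
        congr 1 with y; ring
      have i1 : Integrable (fun y => u x ^ 2 - 2 * u x * u y) (volume.restrict B) :=
        (integrable_const _).sub (huB1.const_mul _)
      rw [e1, integral_add i1 huB.integrable_sq, integral_sub (integrable_const _) (huB1.const_mul _), integral_const_mul, hmean]
      have : 0 ≤ ∫ y in B, u y ^ 2 := integral_nonneg fun y => sq_nonneg _
      simp only [integral_const, smul_eq_mul, measureReal_restrict_apply_univ]
      linarith
    calc volume B * ‖u x‖ₑ ^ 2 = ENNReal.ofReal (volume.real B * u x ^ 2) := by
          rw [ENNReal.ofReal_mul measureReal_nonneg, Measure.real, ENNReal.ofReal_toReal hBv.ne,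
            ← sq_abs, ENNReal.ofReal_pow (abs_nonneg _), ← Real.enorm_eq_ofReal_abs]
      _ ≤ ENNReal.ofReal (∫ y in B, (u x - u y) ^ 2) := ENNReal.ofReal_le_ofReal e
      _ = ∫⁻ y in B, ‖u x - u y‖ₑ ^ 2 := by
          rw [ofReal_integral_eq_lintegral_ofReal hint (ae_of_all _ fun x => sq_nonneg _)]
          refine lintegral_congr fun y => ?_
          rw [← sq_abs, ENNReal.ofReal_pow (abs_nonneg _), ← Real.enorm_eq_ofReal_abs]
      _ ≤ _ := lintegral_mono_set hB
  have h3 : volume B * ∫⁻ x in U, ‖u x‖ₑ ^ 2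
      ≤ ENNReal.ofReal D ^ 2 * 2 ^ d * volume U * ∑ i, ∫⁻ x in U, ‖g i x‖ₑ ^ 2 := by
    rw [← lintegral_const_mul' _ _ hBv.ne]
    exact (lintegral_mono h2).trans h1
  rw [hsq hu] at h3
  simp_rw [fun i => hsq (hg i)] at h3
  rw [← ENNReal.ofReal_sum_of_nonneg fun i _ => integral_nonneg fun x => sq_nonneg _,
    ← ENNReal.ofReal_toReal hBv.ne, ← ENNReal.ofReal_toReal hUv.ne,
    show (2 : ENNReal) ^ d = ENNReal.ofReal (2 ^ d) by
      rw [ENNReal.ofReal_pow (by norm_num)]; simp, ← ENNReal.ofReal_pow hD0, ← ENNReal.ofReal_mul (by positivity),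
    ← ENNReal.ofReal_mul (by positivity), ← ENNReal.ofReal_mul (by positivity),
    ← ENNReal.ofReal_mul (by positivity)] at h3
  refine (ENNReal.ofReal_le_ofReal_iff ?_).1 h3
  have : 0 ≤ ∑ i, ∫ x in U, g i x ^ 2 :=
    Finset.sum_nonneg fun i _ => integral_nonneg fun x => sq_nonneg _
  positivity

end

section

variable {d : ℕ}

/-! ### Homotheties -/

lemma ae_smul_add {P : E d → Prop} (h : ∀ᵐ x, P x) {ρ : ℝ} (hρ : ρ ≠ 0) (b : E d) :
    ∀ᵐ x : E d, P (ρ • x + b) := by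
  have h1 : ∀ᵐ x : E d, P (x + b) := by
    rw [ae_iff] at h ⊢
    exact (measure_preimage_add_right volume b {x | ¬ P x}).trans h
  rw [ae_iff] at h1 ⊢
  have := Measure.addHaar_preimage_smul (volume : Measure (E d)) hρ {x | ¬ P (x + b)}
  rw [h1, mul_zero] at this
  exact this

lemma volume_preimage_smul_add (s : Set (E d)) {ρ : ℝ} (hρ : ρ ≠ 0) (b : E d) :
    volume ((fun x : E d => ρ • x + b) ⁻¹' s) = ENNReal.ofReal |(ρ ^ d)⁻¹| * volume s := by
  have := Measure.addHaar_preimage_smul (volume : Measure (E d)) hρ ((fun x => x + b) ⁻¹' s)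
  rw [measure_preimage_add_right, finrank_euclideanSpace_fin] at this
  exact this

/-- A finite family of homotheties of ratio `± r`, whose inverse images of `U` tile `U`. -/
structure IsTiling (U : Set (E d)) (r : ℝ) (C : Set (E d → E d)) : Prop where
  finite : C.Finite
  homothety : ∀ χ ∈ C, ∃ (ρ : ℝ) (b : E d), |ρ| = r ∧ χ = fun x => ρ • x + b
  subset : ∀ χ ∈ C, χ ⁻¹' U ⊆ U
  disjoint : ∀ χ ∈ C, ∀ χ' ∈ C, ∀ x, χ x ∈ U → χ' x ∈ U → χ = χ'
  cover : ∀ᵐ x, x ∈ U → ∃ χ ∈ C, χ x ∈ U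

/-! ### Partition of a rectangle -/

lemma ae_apply_ne (n : Fin d) (c : ℝ) : ∀ᵐ x : E d, x n ≠ c := by
  have h := Measure.ae_eval_ne (μ := fun _ : Fin d => (volume : Measure ℝ)) n c
  exact (PiLp.volume_preserving_ofLp (Fin d)).quasiMeasurePreserving.ae h

lemma isTiling_rectangle {L : Fin d → ℝ} (hL : ∀ n, 0 < L n) {M : ℕ} (hM : 1 ≤ M) :
    IsTiling (Shape.rectangle L).carrier M ((Shape.rectangle L).charts M) := by
  have hM0 : (0 : ℝ) < M := by exact_mod_cast hM
  refine ⟨?_, ?_, ?_, ?_, ?_⟩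
  · refine (finite_range fun k : Fin d → Fin M => fun x : E d =>
      (WithLp.toLp 2 fun n => (M : ℝ) * x n - ((k n : ℕ) : ℝ) * L n : E d)).subset ?_
    rintro χ ⟨k, rfl⟩
    exact ⟨k, rfl⟩
  · rintro χ ⟨k, rfl⟩
    refine ⟨M, WithLp.toLp 2 fun n => -(((k n : ℕ) : ℝ) * L n), abs_of_pos hM0, ?_⟩
    ext x n
    simp [sub_eq_add_neg]
  · rintro χ ⟨k, rfl⟩ x hx n
    have h := hx n
    simp only [mem_Ioo] at h ⊢
    have hk : ((k n : ℕ) : ℝ) + 1 ≤ M := by exact_mod_cast (k n).2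
    have hk0 : (0 : ℝ) ≤ ((k n : ℕ) : ℝ) := Nat.cast_nonneg _
    have := hL n
    constructor
    · nlinarith [mul_nonneg hk0 this.le]
    · nlinarith
  · rintro χ ⟨k, rfl⟩ χ' ⟨k', rfl⟩ x hx hx'
    have : k = k' := by
      funext n
      have h := hx n
      have h' := hx' n
      simp only [mem_Ioo] at h h'
      have hLn := hL n
      have h1 : ((k n : ℕ) : ℝ) < (k' n : ℕ) + 1 := by
        by_contra hc; push Not at hc; nlinarith
      have h2 : ((k' n : ℕ) : ℝ) < (k n : ℕ) + 1 := by
        by_contra hc; push Not at hc; nlinarith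
      have h1' : (k n : ℕ) < (k' n : ℕ) + 1 := by exact_mod_cast h1
      have h2' : (k' n : ℕ) < (k n : ℕ) + 1 := by exact_mod_cast h2
      exact Fin.ext (by omega)
    rw [this]
  -- Points on the grid hyperplanes lie in no open cell, but form a null set. Elsewhere the integer
  -- part of `M x n / L n` selects the cell.
  · have hae : ∀ᵐ x : E d, ∀ (n : Fin d) (m : ℕ), x n ≠ m * L n / M :=
      ae_all_iff.2 fun n => ae_all_iff.2 fun m => ae_apply_ne n _
    filter_upwards [hae] with x hx hxU
    have hpos : ∀ n, 0 ≤ (M : ℝ) * x n / L n := fun n =>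
      div_nonneg (mul_nonneg hM0.le (hxU n).1.le) (hL n).le
    have hlt : ∀ n, ⌊(M : ℝ) * x n / L n⌋₊ < M := fun n => by
      rw [Nat.floor_lt (hpos n), div_lt_iff₀ (hL n)]
      have := (hxU n).2
      gcongr
    refine ⟨_, ⟨fun n => ⟨⌊(M : ℝ) * x n / L n⌋₊, hlt n⟩, rfl⟩, fun n => ?_⟩
    have h1 := Nat.floor_le (hpos n)
    have h2 := Nat.lt_floor_add_one ((M : ℝ) * x n / L n)
    have h3 := hx n ⌊(M : ℝ) * x n / L n⌋₊
    simp only [mem_Ioo]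
    set m := (⌊(M : ℝ) * x n / L n⌋₊ : ℝ)
    rw [le_div_iff₀ (hL n)] at h1
    rw [div_lt_iff₀ (hL n)] at h2
    have h4 : m * L n ≠ M * x n := fun h => h3 (by rw [h]; field_simp)
    have h5 := lt_of_le_of_ne h1 h4
    constructor <;> linarith

/-! ### Midpoint refinement of a triangle -/

/-- The four maps of the midpoint refinement of a triangle. -/
def midpointMap (v : Fin 3 → E d) : Option (Fin 3) → E d → E d
  | none => fun x => v 0 + v 1 + v 2 - (2 : ℝ) • x
  | some i => fun x => (2 : ℝ) • x - v i

lemma triangleCharts_succ (v : Fin 3 → E d) (m : ℕ) :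
    triangleCharts v (m + 1)
      = {χ | ∃ χ' ∈ triangleCharts v m, ∃ o, χ = χ' ∘ midpointMap v o} := by
  ext χ
  simp only [triangleCharts, mem_ofPred_eq, Option.exists, midpointMap, Function.comp_def]
  constructor
  · rintro ⟨χ', h, h1 | h1⟩
    · exact ⟨χ', h, Or.inr h1⟩
    · exact ⟨χ', h, Or.inl h1⟩
  · rintro ⟨χ', h, h1 | h1⟩
    · exact ⟨χ', h, Or.inr h1⟩
    · exact ⟨χ', h, Or.inl h1⟩

/-- In barycentric coordinates the corner map `some i` sends `t j` to `2 t j - δ i j`, and `none`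
sends it to `1 - 2 t j`. The corner cells are therefore `t i > 1/2` and the middle one is given by
all `t j < 1/2`. The second claim, that a point determines its index, is used to iterate the
refinement. -/
lemma isTiling_midpointMap {v : Fin 3 → E 2} (hv : AffineIndependent ℝ v) :
    IsTiling (Shape.triangle v).carrier 2 (range (midpointMap v)) ∧
      ∀ o o' x, midpointMap v o x ∈ (Shape.triangle v).carrier →
        midpointMap v o' x ∈ (Shape.triangle v).carrier → o = o' := by
  have htop : affineSpan ℝ (range v) = ⊤ := by
    rw [hv.affineSpan_eq_top_iff_card_eq_finrank_add_one]; simp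
  let b : AffineBasis (Fin 3) ℝ (E 2) := ⟨v, hv, htop⟩
  have hbv : ∀ i, b i = v i := fun i => rfl
  have hU : (Shape.triangle v).carrier = {x | ∀ i, 0 < b.coord i x} := b.interior_convexHull
  have hlin : ∀ (j : Fin 3) (x y : E 2), b.coord j ((2 : ℝ) • x - y)
      = 2 * b.coord j x - b.coord j y := fun j x y => by
    have h : ∀ z, b.coord j z = (b.coord j).linear z + b.coord j 0 := fun z => by
      conv_lhs => rw [(b.coord j).decomp]
      simp
    rw [h, h x, h y, map_sub, map_smul]; simp; ring
  have hc : ∀ i j x, b.coord j (midpointMap v (some i) x)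
      = 2 * b.coord j x - if j = i then 1 else 0 := fun i j x => by
    rw [midpointMap, hlin, ← hbv, b.coord_apply]
  have hn : ∀ j x, b.coord j (midpointMap v none x) = 1 - 2 * b.coord j x := fun j x => by
    have h : ∀ z, b.coord j z = (b.coord j).linear z + b.coord j 0 := fun z => by
      conv_lhs => rw [(b.coord j).decomp]
      simp
    have e0 : b.coord j (v 0) + b.coord j (v 1) + b.coord j (v 2) = 1 := by
      rw [← hbv, ← hbv, ← hbv, b.coord_apply, b.coord_apply, b.coord_apply]
      fin_cases j <;> simp
    rw [midpointMap, h, map_sub, map_smul, map_add, map_add]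
    rw [h (v 0), h (v 1), h (v 2)] at e0
    rw [h x]
    simp only [smul_eq_mul]
    linarith
  have hsum : ∀ x, b.coord 0 x + b.coord 1 x + b.coord 2 x = 1 := fun x => by
    have := b.sum_coord_apply_eq_one x
    rwa [Fin.sum_univ_three] at this
  have hdisj : ∀ o o' x, midpointMap v o x ∈ (Shape.triangle v).carrier →
        midpointMap v o' x ∈ (Shape.triangle v).carrier → o = o' := by
    intro o o' x h h'
    rw [hU] at h h'
    simp only [mem_ofPred_eq, Fin.forall_fin_succ, Fin.forall_fin_zero] at h h'
    have := hsum x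
    rcases o with _ | o <;> rcases o' with _ | o' <;>
      simp only [hc, hn] at h h'
    · rfl
    · fin_cases o' <;> simp at h h' <;> linarith
    · fin_cases o <;> simp at h h' <;> linarith
    · fin_cases o <;> fin_cases o' <;> simp at h h' ⊢ <;> linarith
  refine ⟨⟨finite_range _, ?_, ?_, ?_, ?_⟩, hdisj⟩
  · rintro _ ⟨o, rfl⟩
    rcases o with _ | i
    · refine ⟨-2, v 0 + v 1 + v 2, by norm_num, ?_⟩
      funext x; simp only [midpointMap]; module
    · refine ⟨2, -v i, by norm_num, ?_⟩
      funext x; simp only [midpointMap]; module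
  · rintro _ ⟨o, rfl⟩ x hx
    rw [mem_preimage, hU] at hx
    rw [hU]
    simp only [mem_ofPred_eq, Fin.forall_fin_succ, Fin.forall_fin_zero] at hx ⊢
    have := hsum x
    rcases o with _ | o <;> simp only [hc, hn] at hx
    · simp at hx ⊢
      refine ⟨?_, ?_, ?_⟩ <;> linarith
    · fin_cases o <;> simp at hx ⊢ <;> refine ⟨?_, ?_, ?_⟩ <;> linarith
  · rintro _ ⟨o, rfl⟩ _ ⟨o', rfl⟩ x h h'
    rw [hdisj o o' x h h']
  -- The lines `t i = 1/2` separate the four cells; each is a proper affine subspace, hence a null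
  -- set.
  · have hae : ∀ᵐ x : E 2, ∀ i, b.coord i x ≠ 1 / 2 := by
      refine ae_all_iff.2 fun i => ?_
      rw [ae_iff]
      set s : AffineSubspace ℝ (E 2) :=
        (AffineSubspace.mk' (1 / 2 : ℝ) (⊥ : Submodule ℝ ℝ)).comap (b.coord i)
      have hs : {x | ¬ b.coord i x ≠ 1 / 2} = (s : Set (E 2)) := by
        ext x
        simp [s, sub_eq_zero]
      rw [hs]
      refine Measure.addHaar_affineSubspace _ s fun h => ?_
      have : b i ∈ s := by rw [h]; trivial
      have h2 : b i ∈ (s : Set (E 2)) := this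
      rw [← hs] at h2
      simp only [mem_ofPred_eq, b.coord_apply_eq, not_not] at h2
      norm_num at h2
    filter_upwards [hae] with x hx hxU
    rw [hU] at hxU
    simp only [mem_ofPred_eq, Fin.forall_fin_succ, Fin.forall_fin_zero] at hxU
    have hs := hsum x
    by_cases h : ∃ i, 1 / 2 < b.coord i x
    · obtain ⟨i, hi⟩ := h
      refine ⟨_, ⟨some i, rfl⟩, ?_⟩
      rw [hU]
      simp only [mem_ofPred_eq, Fin.forall_fin_succ, Fin.forall_fin_zero, hc]
      fin_cases i <;> simp at hxU hi ⊢ <;> refine ⟨?_, ?_, ?_⟩ <;> linarith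
    · push Not at h
      refine ⟨_, ⟨none, rfl⟩, ?_⟩
      rw [hU]
      intro i
      rw [hn]
      have := lt_of_le_of_ne (h i) (hx i)
      linarith

lemma isTiling_triangleCharts {v : Fin 3 → E 2} (hv : AffineIndependent ℝ v) (m : ℕ) :
    IsTiling (Shape.triangle v).carrier (2 ^ m) (triangleCharts v m) := by
  obtain ⟨hT, hinj⟩ := isTiling_midpointMap hv
  induction m with
  | zero =>
    refine ⟨by simp [triangleCharts], ?_, ?_, ?_, ?_⟩
    · rintro χ rfl
      exact ⟨1, 0, by simp, by ext; simp⟩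
    · rintro χ rfl
      exact subset_rfl
    · rintro χ rfl χ' rfl x _ _
      rfl
    · exact ae_of_all _ fun x hx => ⟨id, rfl, hx⟩
  | succ m ih =>
    rw [triangleCharts_succ]
    have hsub : ∀ χ ∈ triangleCharts v m, ∀ o x, (χ ∘ midpointMap v o) x ∈
        (Shape.triangle v).carrier → midpointMap v o x ∈ (Shape.triangle v).carrier :=
      fun χ hχ o x hx => ih.subset χ hχ hx
    refine ⟨?_, ?_, ?_, ?_, ?_⟩
    · have := (ih.finite.prod (finite_univ (α := Option (Fin 3)))).image
        fun p => p.1 ∘ midpointMap v p.2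
      refine this.subset ?_
      rintro χ ⟨χ', h, o, rfl⟩
      exact ⟨(χ', o), ⟨h, mem_univ _⟩, rfl⟩
    · rintro χ ⟨χ', h, o, rfl⟩
      obtain ⟨ρ, b, hρ, rfl⟩ := ih.homothety χ' h
      obtain ⟨ρ', b', hρ', he⟩ := hT.homothety _ ⟨o, rfl⟩
      refine ⟨ρ * ρ', ρ • b' + b, by rw [abs_mul, hρ, hρ', pow_succ], ?_⟩
      rw [he]
      funext x
      simp only [Function.comp_apply]
      module
    · rintro χ ⟨χ', h, o, rfl⟩ x hx
      exact hT.subset _ ⟨o, rfl⟩ (hsub χ' h o x hx)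
    · rintro χ ⟨χ', h, o, rfl⟩ χ₁ ⟨χ₁', h₁, o₁, rfl⟩ x hx hx₁
      obtain rfl := hinj o o₁ x (hsub χ' h o x hx) (hsub χ₁' h₁ o₁ x hx₁)
      rw [ih.disjoint χ' h χ₁' h₁ _ hx hx₁]
    -- The null set missed at level `m` is pulled back through four homotheties, and so remains
    -- null.
    · have hall : ∀ᵐ x : E 2, ∀ o, midpointMap v o x ∈ (Shape.triangle v).carrier →
          ∃ χ ∈ triangleCharts v m, χ (midpointMap v o x) ∈ (Shape.triangle v).carrier := by
        refine ae_all_iff.2 fun o => ?_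
        obtain ⟨ρ', b', hρ', he⟩ := hT.homothety _ ⟨o, rfl⟩
        rw [he]
        exact ae_smul_add ih.cover (by rintro rfl; simp at hρ') b'
      filter_upwards [hT.cover, hall] with x hx hx' hxU
      obtain ⟨_, ⟨o, rfl⟩, ho⟩ := hx hxU
      obtain ⟨χ, hχ, hχU⟩ := hx' o ho
      exact ⟨_, ⟨χ, hχ, o, rfl⟩, hχU⟩

/-- The ratio is `M` for a rectangle and `2 ^ (M - 1)` for a triangle. Only `r ≥ M` matters later,
which allows one estimate in terms of `M` for both shapes. -/
lemma exists_isTiling {S : Shape d} {bc : BC} (hS : S.Admissible bc) {M : ℕ} (hM : 1 ≤ M) :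
    ∃ r : ℝ, (M : ℝ) ≤ r ∧ IsTiling S.carrier r (S.charts M) := by
  cases S with
  | rectangle L => exact ⟨M, le_rfl, isTiling_rectangle hS hM⟩
  | triangle v =>
    obtain ⟨rfl, hv, -⟩ := hS
    refine ⟨2 ^ (M - 1), ?_, isTiling_triangleCharts hv (M - 1)⟩
    have : M ≤ 2 ^ (M - 1) := by
      have := Nat.lt_two_pow_self (n := M - 1)
      omega
    exact_mod_cast this

end

section

variable {d : ℕ} {S : Shape d} {bc : BC}

/-! ### Poincaré inequality on a tiling -/

lemma IsTiling.measurable {U : Set (E d)} {r : ℝ} {C : Set (E d → E d)} (h : IsTiling U r C)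
    {χ : E d → E d} (hχ : χ ∈ C) : Continuous χ := by
  obtain ⟨ρ, b, -, rfl⟩ := h.homothety χ hχ
  fun_prop

lemma IsTiling.setIntegral_eq_sum {U : Set (E d)} (hU : MeasurableSet U) {r : ℝ}
    {C : Set (E d → E d)} (h : IsTiling U r C) {u : E d → ℝ} (hu : IntegrableOn u U) :
    ∫ x in U, u x = ∑ χ ∈ h.finite.toFinset, ∫ x in χ ⁻¹' U, u x := by
  have hm : ∀ χ ∈ h.finite.toFinset, MeasurableSet (χ ⁻¹' U) := fun χ hχ =>
    (h.measurable ((h.finite.mem_toFinset).1 hχ)).measurable hU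
  rw [← integral_biUnion_finset _ hm]
  · refine setIntegral_congr_set ?_
    filter_upwards [h.cover] with x hx
    refine propext ⟨fun hxU => ?_, fun hxU => ?_⟩
    · obtain ⟨χ, hχ, hχU⟩ := hx hxU
      exact mem_iUnion₂.2 ⟨χ, (h.finite.mem_toFinset).2 hχ, hχU⟩
    · obtain ⟨χ, hχ, hχU⟩ := mem_iUnion₂.1 hxU
      exact h.subset χ ((h.finite.mem_toFinset).1 hχ) hχU
  · intro χ hχ χ' hχ' hne
    refine Set.disjoint_left.2 fun x hx hx' => hne ?_
    exact h.disjoint χ (by simpa using hχ) χ' (by simpa using hχ') x hx hx'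
  · exact fun χ hχ => hu.mono_set (h.subset χ ((h.finite.mem_toFinset).1 hχ))

lemma HasWeakGrad.isWeakGradOn {u : H S} {g : Fin d → H S}
    (h : HasWeakGrad S (compactTest S) u g) {U : Set (E d)} (hU : U ⊆ S.carrier) :
    IsWeakGradOn U u fun i => g i := by
  intro φ h1 h2 h3 i
  have := h φ ⟨h1, h2, h3.trans hU⟩ i
  have hz : ∀ x, x ∉ U → φ x = 0 := fun x hx => image_eq_zero_of_notMem_tsupport fun h => hx (h3 h)
  have hz' : ∀ x, x ∉ U → partialD φ i x = 0 := fun x hx =>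
    partialD_eq_zero_of_notMem (fun h => hx (h3 h)) i
  rw [setIntegral_eq_of_subset_of_forall_sdiff_eq_zero (measurableSet_carrier S) hU
      fun x hx => by rw [hz' x hx.2, mul_zero],
    setIntegral_eq_of_subset_of_forall_sdiff_eq_zero (measurableSet_carrier S) hU
      fun x hx => by rw [hz x hx.2, mul_zero]] at this
  exact this

/-- Poincaré on each cell, then summation. Under a homothety the ratio of the volumes of the cell
and of its box is unchanged, whereas the diameter is divided by `r`. This gives the factor `1 / r ^
2` with a constant `C` independent of the tiling. -/
lemma exists_poincare_tiling (S : Shape d) {B : Set (E d)} (hB : B ⊆ S.carrier)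
    (hB0 : 0 < volume B) :
    ∃ C : ℝ, 0 ≤ C ∧ ∀ (r : ℝ) (T : Set (E d → E d)), 0 < r → IsTiling S.carrier r T →
      ∀ (u : H S) (g : Fin d → H S), HasWeakGrad S (compactTest S) u g →
        (∀ χ ∈ T, ∫ x in χ ⁻¹' B, u x = 0) → ‖u‖ ^ 2 ≤ C / r ^ 2 * ∑ i, ‖g i‖ ^ 2 := by
  obtain ⟨D, hD⟩ := Metric.isBounded_iff.1 (isBounded_carrier S)
  have hUv := volume_carrier_lt_top S
  have hBv : volume B < ⊤ := (measure_mono hB).trans_lt hUv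
  have hBr : 0 < volume.real B := ENNReal.toReal_pos hB0.ne' hBv.ne
  have hD0 : 0 ≤ D := by
    obtain ⟨x, hx⟩ : B.Nonempty := nonempty_of_measure_ne_zero hB0.ne'
    exact dist_nonneg.trans (hD (hB hx) (hB hx))
  set A := 2 ^ d * volume.real S.carrier / volume.real B with hA
  refine ⟨D ^ 2 * A, by positivity, fun r T hr hT u g hw hmean => ?_⟩
  have hmem : ∀ (v : H S) χ, χ ∈ T → MemLp v 2 (volume.restrict (χ ⁻¹' S.carrier)) :=
    fun v χ hχ => (Lp.memLp v).mono_measure (Measure.restrict_mono (hT.subset χ hχ) le_rfl)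
  have key : ∀ χ ∈ T, ∫ x in χ ⁻¹' S.carrier, u x ^ 2
      ≤ D ^ 2 * A / r ^ 2 * ∑ i, ∫ x in χ ⁻¹' S.carrier, g i x ^ 2 := by
    intro χ hχ
    obtain ⟨ρ, b, hρ, he⟩ := hT.homothety χ hχ
    have hρ0 : ρ ≠ 0 := by rintro rfl; simp at hρ; linarith
    have hlin : IsOpen (χ ⁻¹' S.carrier) := (isOpen_carrier S).preimage (hT.measurable hχ)
    have hconv : Convex ℝ (χ ⁻¹' S.carrier) := by
      intro x hx y hy α β hα hβ hαβ
      have := convex_carrier S hx hy hα hβ hαβ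
      rw [mem_preimage]
      convert this using 1
      rw [he]
      have : b = α • b + β • b := by rw [← add_smul, hαβ, one_smul]
      simp only
      nth_rw 1 [this]
      module
    have hvol : ∀ s : Set (E d), volume.real (χ ⁻¹' s) = |(ρ ^ d)⁻¹| * volume.real s := fun s => by
      rw [Measure.real, he, volume_preimage_smul_add s hρ0 b, ENNReal.toReal_mul,
        ENNReal.toReal_ofReal (abs_nonneg _)]
      rfl
    have hfin : volume (χ ⁻¹' S.carrier) < ⊤ := by
      rw [he, volume_preimage_smul_add _ hρ0 b]
      exact ENNReal.mul_lt_top ENNReal.ofReal_lt_top hUv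
    have hdiam : ∀ x ∈ χ ⁻¹' S.carrier, ∀ y ∈ χ ⁻¹' S.carrier, ‖x - y‖ ≤ D / r := by
      intro x hx y hy
      have := hD hx hy
      rw [he, dist_eq_norm] at this
      have e : ρ • x + b - (ρ • y + b) = ρ • (x - y) := by module
      rw [e, norm_smul, Real.norm_eq_abs, hρ] at this
      rwa [le_div_iff₀' hr]
    have := volume_mul_integral_sq_le hlin hconv hfin (preimage_mono hB)
      (hmem u χ hχ) (fun i => hmem (g i) χ hχ) (hw.isWeakGradOn (hT.subset χ hχ))
      (div_nonneg hD0 hr.le) hdiam (hmean χ hχ)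
    rw [hvol, hvol] at this
    have hq : 0 < |(ρ ^ d)⁻¹| := by positivity
    set G := ∑ i, ∫ x in χ ⁻¹' S.carrier, g i x ^ 2
    have e : D ^ 2 * A / r ^ 2 * G = ((D / r) ^ 2 * 2 ^ d * (|(ρ ^ d)⁻¹| * volume.real S.carrier) * G)
        / (|(ρ ^ d)⁻¹| * volume.real B) := by
      rw [hA]; field_simp
    rw [e, le_div_iff₀ (by positivity)]
    linarith
  have hint : ∀ v : H S, IntegrableOn (fun x => v x ^ 2) S.carrier := fun v =>
    (Lp.memLp v).integrable_sq
  have hm := measurableSet_carrier S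
  rw [norm_sq_eq_integral, hT.setIntegral_eq_sum hm (hint u)]
  simp_rw [norm_sq_eq_integral, fun i => hT.setIntegral_eq_sum hm (hint (g i))]
  rw [Finset.sum_comm, Finset.mul_sum]
  exact Finset.sum_le_sum fun χ hχ => key χ ((hT.finite.mem_toFinset).1 hχ)

end

section

variable {d : ℕ} {S : Shape d} {bc : BC}

/-! ### Functions vanishing at the boundary of a subdomain -/

/-- One factor in `W₀^{1,2}` is enough for integration by parts without boundary terms, again by
density. The other factor may be any weakly differentiable function, in particular any element of
`V`. -/
lemma IsGrad.inner_of_dirichlet {h z : H S} {k g : Fin d → H S} (hh : IsGrad S .dirichlet h k)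
    (hz : HasWeakGrad S (compactTest S) z g) (i : Fin d) : ⟪h, g i⟫ = -⟪k i, z⟫ := by
  rw [isGrad_dirichlet_iff] at hh
  rw [hasWeakGrad_iff fun φ hφ => hφ.1] at hz
  have key : ∀ ε > 0, |⟪h, g i⟫ + ⟪k i, z⟫| ≤ ε * (‖g i‖ + ‖z‖) := by
    intro ε hε
    obtain ⟨φ, hφ, h1, h2⟩ := hh ε hε
    have h0 : ⟪toH S φ, g i⟫ + ⟪toH S (partialD φ i), z⟫ = 0 := by
      have := hz φ hφ i
      rw [real_inner_comm (g i), real_inner_comm z]; linarith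
    have e : ⟪h, g i⟫ + ⟪k i, z⟫ = ⟪h - toH S φ, g i⟫ + ⟪k i - toH S (partialD φ i), z⟫ := by
      rw [inner_sub_left, inner_sub_left]; linarith
    rw [e]
    calc _ ≤ |⟪h - toH S φ, g i⟫| + |⟪k i - toH S (partialD φ i), z⟫| := abs_add_le _ _
      _ ≤ ‖h - toH S φ‖ * ‖g i‖ + ‖k i - toH S (partialD φ i)‖ * ‖z‖ :=
        add_le_add (abs_real_inner_le_norm _ _) (abs_real_inner_le_norm _ _)
      _ ≤ ε * ‖g i‖ + ε * ‖z‖ := by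
        gcongr
        exact (h2 i).le
      _ = _ := by ring
  have hz : |⟪h, g i⟫ + ⟪k i, z⟫| ≤ 0 := by
    refine le_of_forall_pos_le_add fun δ hδ => ?_
    have hp : 0 < ‖g i‖ + ‖z‖ + 1 := by positivity
    refine (key (δ / (‖g i‖ + ‖z‖ + 1)) (by positivity)).trans ?_
    rw [div_mul_eq_mul_div, zero_add, div_le_iff₀ hp]
    nlinarith [norm_nonneg (g i), norm_nonneg z]
  have := abs_nonpos_iff.1 hz
  linarith

lemma isGrad_dirichlet_of_tendsto {u : E d → ℝ} {g : Fin d → E d → ℝ}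
    (hu : MemLp u 2 (volume.restrict S.carrier))
    (hg : ∀ i, MemLp (g i) 2 (volume.restrict S.carrier)) {φ : ℕ → E d → ℝ}
    (hφ : ∀ k, φ k ∈ compactTest S)
    (h1 : Filter.Tendsto (fun k => ∫ x in S.carrier, (u x - φ k x) ^ 2) Filter.atTop (nhds 0))
    (h2 : ∀ i, Filter.Tendsto (fun k => ∫ x in S.carrier, (g i x - partialD (φ k) i x) ^ 2)
      Filter.atTop (nhds 0)) :
    IsGrad S .dirichlet (toH S u) fun i => toH S (g i) := by
  intro ε hε
  have h2' : ∀ᶠ k in Filter.atTop, ∀ i, ∫ x in S.carrier, (g i x - partialD (φ k) i x) ^ 2 < ε :=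
    Filter.eventually_all.2 fun i => (h2 i).eventually_lt_const hε
  obtain ⟨k, hk1, hk2⟩ := ((h1.eventually_lt_const hε).and h2').exists
  refine ⟨φ k, hφ k, ?_, fun i => ?_⟩
  · refine lt_of_eq_of_lt (integral_congr_ae ?_) hk1
    filter_upwards [coeFn_toH hu] with x hx
    rw [hx]
  · refine lt_of_eq_of_lt (integral_congr_ae ?_) (hk2 i)
    filter_upwards [coeFn_toH (hg i)] with x hx
    rw [hx]

lemma tendsto_integral_sq_zero {F : ℕ → E d → ℝ} (hm : ∀ k, Measurable (F k)) {C : ℝ}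
    (hC : ∀ k, ∀ x ∈ S.carrier, |F k x| ≤ C)
    (hlim : ∀ x ∈ S.carrier, ∀ᶠ k in Filter.atTop, F k x = 0) :
    Filter.Tendsto (fun k => ∫ x in S.carrier, F k x ^ 2) Filter.atTop (nhds 0) := by
  have := tendsto_integral_of_dominated_convergence (μ := volume.restrict S.carrier)
    (F := fun k x => F k x ^ 2) (f := fun _ => 0) (fun _ => C ^ 2)
    (fun k => ((hm k).pow_const 2).aestronglyMeasurable) (integrable_const _) (fun k => by
      filter_upwards [ae_restrict_mem (measurableSet_carrier S)] with x hx
      rw [Real.norm_eq_abs, abs_pow]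
      exact pow_le_pow_left₀ (abs_nonneg _) (hC k x hx) 2) (by
      filter_upwards [ae_restrict_mem (measurableSet_carrier S)] with x hx
      refine tendsto_const_nhds.congr' ?_
      filter_upwards [hlim x hx] with k hk
      rw [hk]; norm_num)
  simpa using this

lemma exists_abs_le_of_continuous (S : Shape d) {f : E d → ℝ} (hf : Continuous f) :
    ∃ C, 0 ≤ C ∧ ∀ x ∈ S.carrier, |f x| ≤ C := by
  obtain ⟨C, hC⟩ := (isBounded_carrier S).isCompact_closure.exists_bound_of_continuousOn
    hf.continuousOn
  exact ⟨max C 0, le_max_right _ _, fun x hx => (hC x (subset_closure hx)).trans (le_max_left _ _)⟩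

lemma memLp_indicator {B : Set (E d)} (hB : MeasurableSet B) {f : E d → ℝ} (hf : Continuous f) :
    MemLp (B.indicator f) 2 (volume.restrict S.carrier) :=
  (memLp_of_continuous hf 2).indicator hB

/-- `p` is smooth, positive on the open set `B`, and vanishes at the boundary of `B`. -/
structure IsBoundaryFun (B : Set (E d)) (p : E d → ℝ) : Prop where
  isOpen : IsOpen B
  smooth : ContDiff ℝ ∞ p
  pos : ∀ x ∈ B, 0 < p x
  compact : ∀ ε > 0, IsCompact {x | x ∈ B ∧ ε ≤ p x}

/-- A smooth cutoff of `1_B q`. -/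
def cutoff (B : Set (E d)) (p q : E d → ℝ) (k : ℕ) : E d → ℝ :=
  B.indicator fun x => Real.smoothTransition (((k : ℝ) + 1) * p x - 1) * q x

lemma contDiff_smoothTransition_comp {p : E d → ℝ} (hp : ContDiff ℝ ∞ p) (k : ℕ) :
    ContDiff ℝ ∞ fun x => Real.smoothTransition (((k : ℝ) + 1) * p x - 1) :=
  Real.smoothTransition.contDiff.comp ((contDiff_const.mul hp).sub contDiff_const)

/-- `Real.smoothTransition` vanishes for nonpositive arguments and is one from 1 on. On `B` the
cutoff is therefore zero where `p ≤ 1 / (k + 1)` and equal to `q` where `p ≥ 2 / (k + 1)`. -/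
lemma IsBoundaryFun.support_cutoff {B : Set (E d)} {p : E d → ℝ} (q : E d → ℝ)
    (k : ℕ) : Function.support (cutoff B p q k) ⊆ {x | x ∈ B ∧ 1 / ((k : ℝ) + 1) ≤ p x} := by
  intro x hx
  have hxB : x ∈ B := by
    by_contra h
    exact hx (by simp [cutoff, h])
  refine ⟨hxB, ?_⟩
  by_contra h
  push Not at h
  refine hx ?_
  rw [cutoff, indicator_of_mem hxB, Real.smoothTransition.zero_of_nonpos, zero_mul]
  rw [lt_div_iff₀ (by positivity)] at h
  linarith

lemma IsBoundaryFun.cutoff_mem {B : Set (E d)} {p q : E d → ℝ} (h : IsBoundaryFun B p)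
    (hB : B ⊆ S.carrier) (hq : ContDiff ℝ ∞ q) (k : ℕ) : cutoff B p q k ∈ compactTest S := by
  have hK := h.compact (1 / ((k : ℝ) + 1)) (by positivity)
  have hs := IsBoundaryFun.support_cutoff (B := B) (p := p) q k
  have hts : tsupport (cutoff B p q k) ⊆ {x | x ∈ B ∧ 1 / ((k : ℝ) + 1) ≤ p x} :=
    closure_minimal hs hK.isClosed
  refine ⟨?_, hK.of_isClosed_subset (isClosed_tsupport _) hts, hts.trans fun x hx => hB hx.1⟩
  rw [contDiff_iff_contDiffAt]
  intro x
  by_cases hx : x ∈ B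
  · refine (((contDiff_smoothTransition_comp h.smooth k).mul hq).contDiffAt).congr_of_eventuallyEq ?_
    filter_upwards [h.isOpen.mem_nhds hx] with y hy
    simp [cutoff, hy]
  · refine (contDiffAt_const (c := (0 : ℝ))).congr_of_eventuallyEq ?_
    filter_upwards [hK.isClosed.isOpen_compl.mem_nhds fun hx' => hx hx'.1] with y hy
    by_contra hne
    exact hy (hs hne)

lemma IsBoundaryFun.partialD_cutoff {B : Set (E d)} {p q : E d → ℝ} (h : IsBoundaryFun B p)
    (hq : ContDiff ℝ ∞ q) (k : ℕ) (i : Fin d) {x : E d} (hx : x ∈ B) :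
    partialD (cutoff B p q k) i x
      = deriv Real.smoothTransition (((k : ℝ) + 1) * p x - 1) * (((k : ℝ) + 1) * partialD p i x)
          * q x + Real.smoothTransition (((k : ℝ) + 1) * p x - 1) * partialD q i x := by
  have he : cutoff B p q k =ᶠ[nhds x]
      fun x => Real.smoothTransition (((k : ℝ) + 1) * p x - 1) * q x := by
    filter_upwards [h.isOpen.mem_nhds hx] with y hy
    simp [cutoff, hy]
  have h1 : HasFDerivAt (fun x => ((k : ℝ) + 1) * p x - 1) (((k : ℝ) + 1) • fderiv ℝ p x) x :=
    (((h.smooth.differentiable (by simp) x).hasFDerivAt).const_mul _).sub_const 1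
  have h2 : HasDerivAt Real.smoothTransition
      (deriv Real.smoothTransition (((k : ℝ) + 1) * p x - 1)) (((k : ℝ) + 1) * p x - 1) :=
    ((Real.smoothTransition.contDiff (n := 1)).differentiable (by simp) _).hasDerivAt
  have h3 := h2.comp_hasFDerivAt x h1
  have h4 : partialD (fun x => Real.smoothTransition (((k : ℝ) + 1) * p x - 1)) i x
      = deriv Real.smoothTransition (((k : ℝ) + 1) * p x - 1) * (((k : ℝ) + 1) * partialD p i x) := by
    have := h3.fderiv
    simp only [Function.comp_def] at this
    rw [partialD, this]
    simp [partialD]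
  have h5 : partialD (cutoff B p q k) i x
      = partialD (fun x => Real.smoothTransition (((k : ℝ) + 1) * p x - 1) * q x) i x := by
    rw [partialD, partialD, he.fderiv_eq]
  rw [h5, partialD_mul (contDiff_smoothTransition_comp h.smooth k) hq, ← h4]

lemma deriv_smoothTransition_of_one_lt {t : ℝ} (ht : 1 < t) :
    deriv Real.smoothTransition t = 0 := by
  have : Real.smoothTransition =ᶠ[nhds t] fun _ => 1 := by
    filter_upwards [lt_mem_nhds ht] with s hs
    exact Real.smoothTransition.one_of_one_le hs.le
  rw [this.deriv_eq]; simp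

/-- This controls the derivative of the cutoff. With `t = (k + 1) p - 1`, the growing factor `k + 1`
always occurs multiplied by `p`, that is, as `t + 1`; and the derivative of the transition vanishes
for `t > 1`, so a compact interval is all that matters. -/
lemma exists_mul_deriv_smoothTransition_le :
    ∃ C, 0 ≤ C ∧ ∀ t, -1 ≤ t → |(t + 1) * deriv Real.smoothTransition t| ≤ C := by
  have hc : Continuous fun t => (t + 1) * deriv Real.smoothTransition t :=
    (by fun_prop : Continuous fun t : ℝ => t + 1).mul
      ((Real.smoothTransition.contDiff (n := 1)).continuous_deriv (by simp))
  obtain ⟨C, hC⟩ := (isCompact_Icc (a := (-1 : ℝ)) (b := 1)).exists_bound_of_continuousOn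
    hc.continuousOn
  refine ⟨max C 0, le_max_right _ _, fun t ht => ?_⟩
  rcases le_or_gt t 1 with h | h
  · exact (hC t ⟨ht, h⟩).trans (le_max_left _ _)
  · simp [deriv_smoothTransition_of_one_lt h]

/-- A smooth function times a boundary function, extended by zero, lies in `W₀^{1,2}`. -/
lemma IsBoundaryFun.isGrad {B : Set (E d)} {p m : E d → ℝ} (h : IsBoundaryFun B p)
    (hB : B ⊆ S.carrier) (hm : ContDiff ℝ ∞ m) :
    IsGrad S .dirichlet (toH S (B.indicator fun x => p x * m x))
      fun i => toH S (B.indicator (partialD (fun x => p x * m x) i)) := by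
  have hBm := h.isOpen.measurableSet
  have hpm : ContDiff ℝ ∞ fun x => p x * m x := h.smooth.mul hm
  have hmem := fun k => h.cutoff_mem hB hpm k
  have hev : ∀ x ∈ B, ∀ᶠ k : ℕ in Filter.atTop, 1 < ((k : ℝ) + 1) * p x - 1 := fun x hx => by
    have : Filter.Tendsto (fun k : ℕ => ((k : ℝ) + 1) * p x - 1) Filter.atTop Filter.atTop := by
      refine Filter.tendsto_atTop_add_const_right _ _ (Filter.Tendsto.atTop_mul_const (h.pos x hx) ?_)
      exact Filter.tendsto_atTop_add_const_right _ _ tendsto_natCast_atTop_atTop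
    exact this.eventually_gt_atTop 1
  have hθ : ∀ t, |1 - Real.smoothTransition t| ≤ 1 := fun t => by
    rw [abs_of_nonneg (by linarith [Real.smoothTransition.le_one t])]
    linarith [Real.smoothTransition.nonneg t]
  refine isGrad_dirichlet_of_tendsto (memLp_indicator hBm hpm.continuous)
    (fun i => memLp_indicator hBm (continuous_partialD hpm i)) hmem ?_ fun i => ?_
  · obtain ⟨C, hC0, hC⟩ := exists_abs_le_of_continuous S hpm.continuous
    refine tendsto_integral_sq_zero (C := C) (fun k => (hpm.continuous.measurable.indicator hBm).sub
      (hmem k).1.continuous.measurable) (fun k x hx => ?_) fun x hx => ?_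
    · by_cases hxB : x ∈ B
      · simp only [cutoff, indicator_of_mem hxB]
        rw [← one_sub_mul, abs_mul]
        calc _ ≤ 1 * C := mul_le_mul (hθ _) (hC x hx) (abs_nonneg _) zero_le_one
          _ = C := one_mul _
      · simpa [cutoff, hxB] using hC0
    · by_cases hxB : x ∈ B
      · filter_upwards [hev x hxB] with k hk
        simp [cutoff, hxB, Real.smoothTransition.one_of_one_le hk.le]
      · simp [cutoff, hxB]
  · obtain ⟨C₁, hC₁0, hC₁⟩ := exists_abs_le_of_continuous S (continuous_partialD hpm i)
    obtain ⟨C₂, hC₂0, hC₂⟩ := exists_abs_le_of_continuous S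
      ((continuous_partialD h.smooth i).mul hm.continuous)
    obtain ⟨C₃, hC₃0, hC₃⟩ := exists_mul_deriv_smoothTransition_le
    have hout : ∀ k, ∀ x ∉ B, partialD (cutoff B p (fun x => p x * m x) k) i x = 0 :=
      fun k x hx => partialD_eq_zero_of_notMem (fun hx' => hx (by
        have hK := h.compact (1 / ((k : ℝ) + 1)) (by positivity)
        exact (closure_minimal (IsBoundaryFun.support_cutoff _ k) hK.isClosed hx').1)) i
    refine tendsto_integral_sq_zero (C := C₁ + C₃ * C₂) (fun k =>
      ((continuous_partialD hpm i).measurable.indicator hBm).sub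
      (continuous_partialD (hmem k).1 i).measurable) (fun k x hx => ?_) fun x hx => ?_
    · by_cases hxB : x ∈ B
      · rw [h.partialD_cutoff hpm k i hxB, indicator_of_mem hxB]
        set t := ((k : ℝ) + 1) * p x - 1 with ht
        have hpx : 0 ≤ ((k : ℝ) + 1) * p x := mul_nonneg (by positivity) (h.pos x hxB).le
        -- The second term comes from differentiating the cutoff: `(k + 1) p = t + 1`, so it is
        -- bounded uniformly in `k`. This needs the factor `p` in the function being truncated.
        have e : partialD (fun x => p x * m x) i x -
            (deriv Real.smoothTransition t * (((k : ℝ) + 1) * partialD p i x) * (p x * m x)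
              + Real.smoothTransition t * partialD (fun x => p x * m x) i x)
            = (1 - Real.smoothTransition t) * partialD (fun x => p x * m x) i x
              - ((t + 1) * deriv Real.smoothTransition t) * (partialD p i x * m x) := by
          rw [ht]; ring
        rw [e]
        refine (abs_sub _ _).trans ?_
        rw [abs_mul, abs_mul]
        refine add_le_add ?_ ?_
        · calc _ ≤ 1 * C₁ := mul_le_mul (hθ _) (hC₁ x hx) (abs_nonneg _) zero_le_one
            _ = C₁ := one_mul _
        · exact mul_le_mul (hC₃ t (by rw [ht]; linarith)) (hC₂ x hx) (abs_nonneg _) hC₃0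
      · rw [hout k x hxB, indicator_of_notMem hxB]
        simp only [sub_zero, abs_zero]; positivity
    · by_cases hxB : x ∈ B
      · filter_upwards [hev x hxB] with k hk
        rw [h.partialD_cutoff hpm k i hxB, indicator_of_mem hxB,
          deriv_smoothTransition_of_one_lt hk, Real.smoothTransition.one_of_one_le hk.le]
        ring
      · refine Filter.Eventually.of_forall fun k => ?_
        rw [hout k x hxB, indicator_of_notMem hxB, sub_zero]

lemma IsBoundaryFun.mem_V {B : Set (E d)} {p : E d → ℝ} (h : IsBoundaryFun B p)
    (hB : B ⊆ S.carrier) (bc : BC) : toH S (B.indicator p) ∈ V S bc := by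
  have := h.isGrad (S := S) hB (m := fun _ => 1) contDiff_const
  simp only [mul_one] at this
  exact ⟨_, this.of_dirichlet bc⟩

/-- The gradient `2 p ∇p` of `p²` still carries a factor `p`. Its truncation to `B` is thus in
`W₀^{1,2}` too, and a second integration by parts against any `z ∈ V` leaves no boundary term. The
witness is `ψ - Δψ`, with the Laplacian truncated to `B`. One factor `p` gives membership in `V`,
two give `D(A)`: hence `φ` for the heat equation and `φ²` for the fourth-order one. -/
lemma IsBoundaryFun.sq_mem_DA {B : Set (E d)} {p : E d → ℝ} (h : IsBoundaryFun B p)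
    (hB : B ⊆ S.carrier) (hS : S.Admissible bc) :
    toH S (B.indicator fun x => p x * p x) ∈ DA S bc := by
  have h1 := (h.isGrad (S := S) hB h.smooth).of_dirichlet bc
  have e : ∀ i, partialD (fun x => p x * p x) i = fun x => p x * (2 * partialD p i x) := fun i => by
    rw [partialD_mul h.smooth h.smooth]
    ext x; ring
  have h2 := fun i => h.isGrad (S := S) hB (m := fun x => 2 * partialD p i x)
    (contDiff_const.mul (contDiff_partialD h.smooth i))
  set ψ := toH S (B.indicator fun x => p x * p x)
  refine ⟨ψ - ∑ i, toH S (B.indicator (partialD (fun x => p x * (2 * partialD p i x)) i)),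
    ⟨_, h1⟩, fun z hz => ?_⟩
  have hzg := (isGrad_grad hz).hasWeakGrad hS
  have key : ∀ i, ⟪grad S bc ψ i, grad S bc z i⟫
      = -⟪toH S (B.indicator (partialD (fun x => p x * (2 * partialD p i x)) i)), z⟫ := fun i => by
    rw [h1.grad_eq hS]
    simp only [e]
    exact (h2 i).inner_of_dirichlet hzg i
  rw [formV, formV0, Finset.sum_congr rfl fun i _ => key i, inner_sub_left, sum_inner,
    Finset.sum_neg_distrib]
  ring

end

section

variable {d : ℕ} {S : Shape d} {bc : BC}

/-! ### Actuators and auxiliary functions -/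

/-- The smooth function with `bump l = 1_ω sineProd l`. -/
def sineProd (l : Fin d → ℝ) (z : E d) : ℝ := ∏ n, Real.sin (Real.pi * ((z n + l n) / (2 * l n)))

lemma isBoundaryFun_sineProd {l : Fin d → ℝ} (hl : ∀ n, 0 < l n) :
    IsBoundaryFun (refBox l) (sineProd l) := by
  have hsm : ContDiff ℝ ∞ (sineProd l) := by
    unfold sineProd
    fun_prop
  refine ⟨?_, hsm, fun z hz => ?_, fun ε hε => ?_⟩
  · have : refBox l = ⋂ n, (fun x : E d => x n) ⁻¹' Ioo (-(l n)) (l n) := by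
      ext x; simp [refBox]
    rw [this]
    exact isOpen_iInter_of_finite fun n => isOpen_Ioo.preimage (by fun_prop)
  · refine Finset.prod_pos fun n _ => Real.sin_pos_of_pos_of_lt_pi ?_ ?_
    · have := (hz n).1
      exact mul_pos Real.pi_pos (div_pos (by linarith) (by linarith [hl n]))
    · have := (hz n).2
      have h1 : (z n + l n) / (2 * l n) < 1 := by
        rw [div_lt_one (by linarith [hl n])]; linarith
      nlinarith [Real.pi_pos]
  -- The sine product vanishes on the faces of the box, so on a superlevel set the open box may be
  -- replaced by the closed one. This makes the set closed.
  · have he : {z : E d | z ∈ refBox l ∧ ε ≤ sineProd l z}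
        = (⋂ n, (fun x : E d => x n) ⁻¹' Icc (-(l n)) (l n)) ∩ {z | ε ≤ sineProd l z} := by
      ext z
      simp only [mem_ofPred_eq, mem_inter_iff, mem_iInter, mem_preimage]
      refine ⟨fun h => ⟨fun n => Ioo_subset_Icc_self (h.1 n), h.2⟩, fun h => ⟨fun n => ?_, h.2⟩⟩
      have hne : Real.sin (Real.pi * ((z n + l n) / (2 * l n))) ≠ 0 := fun h0 => by
        have : sineProd l z = 0 := Finset.prod_eq_zero (Finset.mem_univ n) h0
        linarith [h.2]
      have hln := hl n
      refine ⟨lt_of_le_of_ne (h.1 n).1 fun h0 => hne ?_, lt_of_le_of_ne (h.1 n).2 fun h0 => hne ?_⟩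
      · rw [← h0]; simp
      · rw [h0, show (l n + l n) / (2 * l n) = 1 by field_simp; ring, mul_one, Real.sin_pi]
    rw [he]
    have hb : Bornology.IsBounded (⋂ n, (fun x : E d => x n) ⁻¹' Icc (-(l n)) (l n)) := by
      have h : Bornology.IsBounded (Set.pi univ fun n => Icc (-(l n)) (l n)) :=
        Bornology.IsBounded.pi fun n => Metric.isBounded_Icc _ _
      have h2 := (PiLp.antilipschitzWith_ofLp 2 (fun _ : Fin d => ℝ)).isBounded_preimage h
      exact h2.subset fun x hx n _ => mem_iInter.1 hx n
    refine Metric.isCompact_of_isClosed_isBounded ?_ (hb.subset inter_subset_left)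
    refine IsClosed.inter (isClosed_iInter fun n => isClosed_Icc.preimage (by fun_prop)) ?_
    exact isClosed_le continuous_const hsm.continuous

lemma IsBoundaryFun.comp_homothety {B : Set (E d)} {p : E d → ℝ} (h : IsBoundaryFun B p) {ρ : ℝ}
    (hρ : ρ ≠ 0) (b : E d) :
    IsBoundaryFun ((fun x : E d => ρ • x + b) ⁻¹' B) fun x => p (ρ • x + b) := by
  refine ⟨h.isOpen.preimage (by fun_prop), h.smooth.comp (by fun_prop), fun x hx => h.pos _ hx,
    fun ε hε => ?_⟩
  let T : E d ≃ₜ E d := (Homeomorph.smulOfNeZero ρ hρ).trans (Homeomorph.addRight b)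
  exact T.isCompact_preimage.2 (h.compact ε hε)

/-- The rescaled copy of `ω` on which an actuator is supported. -/
def actBox (l : Fin d → ℝ) (χ : E d → E d) (c : E d) : Set (E d) := {x | χ x - c ∈ refBox l}

lemma actBox_eq_preimage (l : Fin d → ℝ) (χ : E d → E d) (c : E d) :
    actBox l χ c = χ ⁻¹' ((fun z => c + z) '' refBox l) := by
  ext x
  simp only [actBox, mem_ofPred_eq, mem_preimage, mem_image]
  exact ⟨fun h => ⟨_, h, by abel⟩, by rintro ⟨z, hz, h⟩; rw [← h]; simpa using hz⟩

lemma isBoundaryFun_actBox {r : ℝ} (hr : 0 < r) {T : Set (E d → E d)}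
    (hT : IsTiling S.carrier r T) {l : Fin d → ℝ} (hl : ∀ n, 0 < l n) {χ : E d → E d} (hχ : χ ∈ T)
    (c : E d) : IsBoundaryFun (actBox l χ c) fun x => sineProd l (χ x - c) := by
  obtain ⟨ρ, b, hρ, rfl⟩ := hT.homothety χ hχ
  have := (isBoundaryFun_sineProd hl).comp_homothety (ρ := ρ)
    (by rintro rfl; simp at hρ; linarith) (b - c)
  simp only [← add_sub_assoc] at this
  exact this

lemma actBox_subset {r : ℝ} {T : Set (E d → E d)} (hT : IsTiling S.carrier r T) {l : Fin d → ℝ}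
    {χ : E d → E d} (hχ : χ ∈ T) {c : E d} (hc : (fun z => c + z) '' refBox l ⊆ S.carrier) :
    actBox l χ c ⊆ S.carrier := by
  rw [actBox_eq_preimage]
  exact (preimage_mono hc).trans (hT.subset χ hχ)

lemma volume_image_refBox_pos {l : Fin d → ℝ} (hl : ∀ n, 0 < l n) (c : E d) :
    0 < volume ((fun z => c + z) '' refBox l) := by
  rw [image_add_left, measure_preimage_add]
  exact (isBoundaryFun_sineProd hl).isOpen.measure_pos _ ⟨0, fun n => by simpa using hl n⟩

lemma volume_actBox_pos {r : ℝ} (hr : 0 < r) {T : Set (E d → E d)}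
    (hT : IsTiling S.carrier r T) {l : Fin d → ℝ} (hl : ∀ n, 0 < l n) {χ : E d → E d} (hχ : χ ∈ T)
    (c : E d) : 0 < volume (actBox l χ c) := by
  obtain ⟨ρ, b, hρ, he⟩ := hT.homothety χ hχ
  have hρ0 : ρ ≠ 0 := by rintro rfl; simp at hρ; linarith
  rw [actBox_eq_preimage, he, volume_preimage_smul_add _ hρ0 b]
  refine ENNReal.mul_pos ?_ (volume_image_refBox_pos hl c).ne'
  simp only [ne_eq, ENNReal.ofReal_eq_zero, not_le]
  positivity

lemma disjoint_actBox {r : ℝ} {T : Set (E d → E d)} (hT : IsTiling S.carrier r T) {l : Fin d → ℝ}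
    {χ χ' : E d → E d} (hχ : χ ∈ T) (hχ' : χ' ∈ T) {c c' : E d}
    (hc : (fun z => c + z) '' refBox l ⊆ S.carrier) (hc' : (fun z => c' + z) '' refBox l ⊆ S.carrier)
    (h : χ ≠ χ' ∨ Disjoint ((fun z => c + z) '' refBox l) ((fun z => c' + z) '' refBox l)) :
    Disjoint (actBox l χ c) (actBox l χ' c') := by
  rw [actBox_eq_preimage, actBox_eq_preimage]
  refine Set.disjoint_left.2 fun x hx hx' => ?_
  obtain rfl := hT.disjoint χ hχ χ' hχ' x (hc hx) (hc' hx')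
  rcases h with h | h
  · exact h rfl
  · exact Set.disjoint_left.1 h hx hx'

/-! ### Oblique projections -/

/-- Biorthogonality makes the Gram matrix diagonal, so the solution is explicit. It guarantees that
the choice in `obliqueProj` is a genuine projection and not the default value `0`. The functional
has to be linear on the span only, as `A` is available only there. -/
lemma exists_inner_eq_of_biorthogonal {F : Type*} [NormedAddCommGroup F] [InnerProductSpace ℝ F]
    {ι : Type*} [Finite ι] {e f : ι → F} (hdiag : ∀ i, ⟪e i, f i⟫ ≠ 0)
    (hoff : ∀ i j, i ≠ j → ⟪e i, f j⟫ = 0) {ξ : F → ℝ}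
    (hadd : ∀ x ∈ Submodule.span ℝ (range f), ∀ y ∈ Submodule.span ℝ (range f),
      ξ (x + y) = ξ x + ξ y)
    (hsmul : ∀ (c : ℝ), ∀ x ∈ Submodule.span ℝ (range f), ξ (c • x) = c * ξ x) :
    ∃ u ∈ Submodule.span ℝ (range e), ∀ y ∈ Submodule.span ℝ (range f), ⟪u, y⟫ = ξ y := by
  have := Fintype.ofFinite ι
  classical
  refine ⟨∑ i, (ξ (f i) / ⟪e i, f i⟫) • e i, Submodule.sum_mem _ fun i _ =>
    Submodule.smul_mem _ _ (Submodule.subset_span ⟨i, rfl⟩), fun y hy => ?_⟩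
  induction hy using Submodule.span_induction with
  | mem x hx =>
    obtain ⟨j, rfl⟩ := hx
    rw [sum_inner, Finset.sum_eq_single j]
    · rw [real_inner_smul_left, div_mul_cancel₀ _ (hdiag j)]
    · intro i _ hij
      rw [real_inner_smul_left, hoff i j hij, mul_zero]
    · simp
  | zero =>
    have := hsmul 0 0 (Submodule.zero_mem _)
    simp only [zero_smul, zero_mul] at this
    rw [inner_zero_right, this]
  | add x y hx hy hx' hy' => rw [inner_add_right, hx', hy', hadd x hx y hy]
  | smul c x hx hx' => rw [real_inner_smul_right, hx', hsmul c x hx]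

lemma inner_toH_indicator {B B' : Set (E d)} (hB : MeasurableSet B) (hB' : MeasurableSet B')
    {p : E d → ℝ} (hp : Continuous p) :
    ⟪toH S (B.indicator fun _ => (1 : ℝ)), toH S (B'.indicator p)⟫
      = ∫ x in S.carrier, (B ∩ B').indicator p x := by
  rw [inner_toH _ (memLp_indicator hB' hp)]
  refine integral_congr_ae ?_
  filter_upwards [coeFn_toH (memLp_indicator (S := S) hB (continuous_const (y := (1 : ℝ))))]
    with x hx
  rw [hx]
  by_cases h : x ∈ B <;> by_cases h' : x ∈ B' <;> simp [h, h']

lemma inner_toH_indicator_pos {B : Set (E d)} (hBo : IsOpen B) (hB : B ⊆ S.carrier)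
    (hv : 0 < volume B) {p : E d → ℝ} (hp : Continuous p) (hpos : ∀ x ∈ B, 0 < p x) :
    0 < ⟪toH S (B.indicator fun _ => (1 : ℝ)), toH S (B.indicator p)⟫ := by
  have hBm := hBo.measurableSet
  rw [inner_toH_indicator hBm hBm hp, inter_self, setIntegral_indicator hBm,
    inter_eq_self_of_subset_right hB]
  rw [setIntegral_pos_iff_support_of_nonneg_ae]
  · refine hv.trans_le (measure_mono fun x hx => ⟨(hpos x hx).ne', hx⟩)
  · filter_upwards [ae_restrict_mem hBm] with x hx using (hpos x hx).le
  · exact ((memLp_of_continuous hp 1).integrable le_rfl).mono_measure (Measure.restrict_mono hB le_rfl)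

/-- The span of the indicator functions of a family of sets. -/
def indicatorSpan (S : Shape d) {ι : Type*} (B : ι → Set (E d)) : Submodule ℝ (H S) :=
  Submodule.span ℝ (range fun i => toH S ((B i).indicator fun _ => (1 : ℝ)))

/-- The span of the truncations of functions to sets. -/
def truncSpan (S : Shape d) {ι : Type*} (B : ι → Set (E d)) (p : ι → E d → ℝ) :
    Submodule ℝ (H S) :=
  Submodule.span ℝ (range fun i => toH S ((B i).indicator (p i)))

/-- Disjoint open subsets of `Ω`, with continuous functions which are positive on them. -/
structure IsActFamily (S : Shape d) {ι : Type*} (B : ι → Set (E d)) (p : ι → E d → ℝ) : Prop where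
  isOpen : ∀ i, IsOpen (B i)
  subset : ∀ i, B i ⊆ S.carrier
  volume_pos : ∀ i, 0 < volume (B i)
  disjoint : ∀ i j, i ≠ j → Disjoint (B i) (B j)
  continuous : ∀ i, Continuous (p i)
  pos : ∀ i, ∀ x ∈ B i, 0 < p i x

lemma IsActFamily.inner_eq_zero {ι : Type*} {B : ι → Set (E d)} {p : ι → E d → ℝ}
    (h : IsActFamily S B p) {i j : ι} (hij : i ≠ j) :
    ⟪toH S ((B i).indicator fun _ => (1 : ℝ)), toH S ((B j).indicator (p j))⟫ = 0 := by
  rw [inner_toH_indicator (h.isOpen i).measurableSet (h.isOpen j).measurableSet (h.continuous j),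
    (h.disjoint i j hij).inter_eq]
  simp

lemma IsActFamily.inner_ne_zero {ι : Type*} {B : ι → Set (E d)} {p : ι → E d → ℝ}
    (h : IsActFamily S B p) (i : ι) :
    ⟪toH S ((B i).indicator fun _ => (1 : ℝ)), toH S ((B i).indicator (p i))⟫ ≠ 0 :=
  (inner_toH_indicator_pos (h.isOpen i) (h.subset i) (h.volume_pos i) (h.continuous i)
    (h.pos i)).ne'

lemma obliqueProj_spec {F G : Submodule ℝ (H S)} {ξ : H S → ℝ}
    (h : ∃ u ∈ F, ∀ y ∈ G, ⟪u, y⟫ = ξ y) :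
    obliqueProj S F G ξ ∈ F ∧ ∀ y ∈ G, ⟪obliqueProj S F G ξ, y⟫ = ξ y := by
  rw [obliqueProj, dif_pos h]
  exact h.choose_spec

/-- The structure of the quadratic form of an oblique projection feedback. The bilinear form `b` is
`(A ·, A ·)_H` or `⟨A ·, ·⟩_{V', V}`, on the span of the auxiliary functions. -/
lemma IsActFamily.feedback_structure {ι : Type*} [Finite ι] {B : ι → Set (E d)}
    {p : ι → E d → ℝ} (h : IsActFamily S B p) {b : H S → H S → ℝ}
    (hadd : ∀ w ∈ truncSpan S B p, ∀ x ∈ truncSpan S B p, ∀ y ∈ truncSpan S B p,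
      b w (x + y) = b w x + b w y)
    (hsmul : ∀ w ∈ truncSpan S B p, ∀ (c : ℝ), ∀ x ∈ truncSpan S B p, b w (c • x) = c * b w x)
    (w : H S) :
    let Θ := obliqueProj S (truncSpan S B p) (indicatorSpan S B) fun x => ⟪w, x⟫
    Θ ∈ truncSpan S B p ∧ (∀ i, ∫ x in B i, (w - Θ) x = 0) ∧
      ⟪obliqueProj S (indicatorSpan S B) (truncSpan S B p) fun y => b Θ y, w⟫ = b Θ Θ := by
  intro Θ
  have h1 : Θ ∈ truncSpan S B p ∧ ∀ y ∈ indicatorSpan S B, ⟪Θ, y⟫ = ⟪w, y⟫ :=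
    obliqueProj_spec (exists_inner_eq_of_biorthogonal
      (fun i => by rw [real_inner_comm]; exact h.inner_ne_zero i)
      (fun i j hij => by rw [real_inner_comm]; exact h.inner_eq_zero hij.symm)
      (fun x _ y _ => inner_add_right _ _ _) (fun c x _ => real_inner_smul_right _ _ _))
  set u := obliqueProj S (indicatorSpan S B) (truncSpan S B p) fun y => b Θ y
  have h2 : u ∈ indicatorSpan S B ∧ ∀ y ∈ truncSpan S B p, ⟪u, y⟫ = b Θ y :=
    obliqueProj_spec (exists_inner_eq_of_biorthogonal
      (fun i => h.inner_ne_zero i) (fun i j hij => h.inner_eq_zero hij)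
      (fun x hx y hy => hadd Θ h1.1 x hx y hy) (fun c x hx => hsmul Θ h1.1 c x hx))
  refine ⟨h1.1, fun i => ?_, ?_⟩
  · have := h1.2 _ (Submodule.subset_span ⟨i, rfl⟩)
    have h3 : ⟪w - Θ, toH S ((B i).indicator fun _ => (1 : ℝ))⟫ = 0 := by
      rw [inner_sub_left, this, sub_self]
    have hm := (h.isOpen i).measurableSet
    rw [inner_toH _ (memLp_indicator hm continuous_const)] at h3
    have e : ∀ x, (w - Θ) x * (B i).indicator (fun _ => (1 : ℝ)) x
        = (B i).indicator (fun x => (w - Θ) x) x := fun x => by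
      by_cases hx : x ∈ B i <;> simp [hx]
    simp_rw [e] at h3
    rwa [setIntegral_indicator hm, inter_eq_self_of_subset_right (h.subset i)] at h3
  -- Duality: `(u, w) = (u, Θ)`, because `u` is in the span of the indicators, to which `w - Θ` is
  -- orthogonal; and `(u, Θ) = b Θ Θ`, because `Θ` is in the span on which `u` represents `b Θ`.
  · rw [real_inner_comm, ← h1.2 _ h2.1, real_inner_comm]
    exact h2.2 Θ h1.1

end

section

variable {d : ℕ} {S : Shape d} {bc : BC}

/-! ### Coercivity of the feedback operators -/

lemma bump_sq_comp (l : Fin d → ℝ) (χ : E d → E d) (c : E d) :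
    (fun x => bump l (χ x - c) ^ 2)
      = (actBox l χ c).indicator fun x => sineProd l (χ x - c) * sineProd l (χ x - c) := by
  ext x
  have : bump l (χ x - c) = (actBox l χ c).indicator (fun x => sineProd l (χ x - c)) x := rfl
  rw [this]
  by_cases h : x ∈ actBox l χ c <;> simp [h, sq]

variable {a : ActuatorData d} {M : ℕ}

lemma actU_eq : actU S a M = indicatorSpan S
    fun i : S.charts M × Fin (d + 1) => actBox a.l i.1 (a.c₁ i.2) := by
  rw [actU, indicatorSpan]
  congr 1
  ext Φ
  constructor
  · rintro ⟨χ, hχ, j, rfl⟩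
    exact ⟨(⟨χ, hχ⟩, j), rfl⟩
  · rintro ⟨⟨⟨χ, hχ⟩, j⟩, rfl⟩
    exact ⟨χ, hχ, j, rfl⟩

lemma auxU_eq : auxU S a M = truncSpan S
    (fun i : S.charts M × Fin (d + 1) => actBox a.l i.1 (a.c₁ i.2))
    fun i x => sineProd a.l (i.1.1 x - a.c₁ i.2) * sineProd a.l (i.1.1 x - a.c₁ i.2) := by
  rw [auxU, truncSpan]
  congr 1
  ext Φ
  constructor
  · rintro ⟨χ, hχ, j, rfl⟩
    exact ⟨(⟨χ, hχ⟩, j), by rw [bump_sq_comp]⟩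
  · rintro ⟨⟨⟨χ, hχ⟩, j⟩, rfl⟩
    exact ⟨χ, hχ, j, by rw [bump_sq_comp]⟩

lemma actV_eq : actV S a M = indicatorSpan S
    fun i : S.charts M => actBox a.l i a.c₂ := by
  rw [actV, indicatorSpan]
  congr 1
  ext Φ
  constructor
  · rintro ⟨χ, hχ, rfl⟩
    exact ⟨⟨χ, hχ⟩, rfl⟩
  · rintro ⟨⟨χ, hχ⟩, rfl⟩
    exact ⟨χ, hχ, rfl⟩

lemma auxV_eq : auxV S a M = truncSpan S
    (fun i : S.charts M => actBox a.l i a.c₂) fun i x => sineProd a.l (i.1 x - a.c₂) := by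
  rw [auxV, truncSpan]
  congr 1
  ext Φ
  constructor
  · rintro ⟨χ, hχ, rfl⟩
    exact ⟨⟨χ, hχ⟩, rfl⟩
  · rintro ⟨⟨χ, hχ⟩, rfl⟩
    exact ⟨χ, hχ, rfl⟩

lemma isActFamily_U {r : ℝ} (hr : 0 < r) (hT : IsTiling S.carrier r (S.charts M))
    (ha : a.Admissible S) : IsActFamily S
      (fun i : S.charts M × Fin (d + 1) => actBox a.l i.1 (a.c₁ i.2))
      fun i x => sineProd a.l (i.1.1 x - a.c₁ i.2) * sineProd a.l (i.1.1 x - a.c₁ i.2) := by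
  have hb := fun i : S.charts M × Fin (d + 1) =>
    isBoundaryFun_actBox hr hT ha.l_pos i.1.2 (a.c₁ i.2)
  refine ⟨fun i => (hb i).isOpen, fun i => actBox_subset hT i.1.2 (ha.subset₁ i.2),
    fun i => volume_actBox_pos hr hT ha.l_pos i.1.2 _, fun i j hij => ?_,
    fun i => (hb i).smooth.continuous.mul (hb i).smooth.continuous,
    fun i x hx => mul_pos ((hb i).pos x hx) ((hb i).pos x hx)⟩
  refine disjoint_actBox hT i.1.2 j.1.2 (ha.subset₁ _) (ha.subset₁ _) ?_
  by_cases h : i.1 = j.1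
  · exact Or.inr (ha.disjoint₁ _ _ fun h2 => hij (Prod.ext h h2))
  · exact Or.inl fun h2 => h (Subtype.ext h2)

lemma isActFamily_V {r : ℝ} (hr : 0 < r) (hT : IsTiling S.carrier r (S.charts M))
    (ha : a.Admissible S) : IsActFamily S
      (fun i : S.charts M => actBox a.l i a.c₂) fun i x => sineProd a.l (i.1 x - a.c₂) := by
  have hb := fun i : S.charts M => isBoundaryFun_actBox hr hT ha.l_pos i.2 a.c₂
  refine ⟨fun i => (hb i).isOpen, fun i => actBox_subset hT i.2 ha.subset₂,
    fun i => volume_actBox_pos hr hT ha.l_pos i.2 _, fun i j hij => ?_,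
    fun i => (hb i).smooth.continuous, fun i => (hb i).pos⟩
  exact disjoint_actBox hT i.2 j.2 ha.subset₂ ha.subset₂ (Or.inl fun h => hij (Subtype.ext h))

lemma auxU_le (hS : S.Admissible bc) {r : ℝ} (hr : 0 < r)
    (hT : IsTiling S.carrier r (S.charts M)) (ha : a.Admissible S) :
    auxU S a M ≤ submoduleDA hS := by
  rw [auxU_eq, truncSpan, Submodule.span_le]
  rintro _ ⟨i, rfl⟩
  exact (isBoundaryFun_actBox hr hT ha.l_pos i.1.2 (a.c₁ i.2)).sq_mem_DA
    (actBox_subset hT i.1.2 (ha.subset₁ i.2)) hS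

lemma auxV_le {r : ℝ} (hr : 0 < r) (hT : IsTiling S.carrier r (S.charts M))
    (ha : a.Admissible S) : auxV S a M ≤ submoduleV S bc := by
  rw [auxV_eq, truncSpan, Submodule.span_le]
  rintro _ ⟨i, rfl⟩
  exact (isBoundaryFun_actBox hr hT ha.l_pos i.2 a.c₂).mem_V
    (actBox_subset hT i.2 ha.subset₂) bc

lemma add_sq_le_two_mul (x y : ℝ) : (x + y) ^ 2 ≤ 2 * x ^ 2 + 2 * y ^ 2 := by
  nlinarith [sq_nonneg (x - y)]

lemma norm_sq_le_two_mul {F : Type*} [SeminormedAddCommGroup F] (w Θ : F) :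
    ‖w‖ ^ 2 ≤ 2 * ‖w - Θ‖ ^ 2 + 2 * ‖Θ‖ ^ 2 := by
  have h : ‖w‖ ≤ ‖w - Θ‖ + ‖Θ‖ := by simpa using norm_add_le (w - Θ) Θ
  exact (pow_le_pow_left₀ (norm_nonneg _) h 2).trans (add_sq_le_two_mul _ _)

lemma norm_sub_sq_le_two_mul {F : Type*} [SeminormedAddCommGroup F] (w Θ : F) :
    ‖w - Θ‖ ^ 2 ≤ 2 * ‖w‖ ^ 2 + 2 * ‖Θ‖ ^ 2 :=
  (pow_le_pow_left₀ (norm_nonneg _) (norm_sub_le w Θ) 2).trans (add_sq_le_two_mul _ _)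

lemma normV_sub_sq_le (hS : S.Admissible bc) {w Θ : H S} (hw : w ∈ V S bc) (hΘ : Θ ∈ V S bc) :
    normV S bc (w - Θ) ^ 2 ≤ 2 * normV S bc w ^ 2 + 2 * normV S bc Θ ^ 2 := by
  have e : w - Θ = w + (-1 : ℝ) • Θ := by simp [sub_eq_add_neg]
  have hg : ∀ i, grad S bc (w - Θ) i = grad S bc w i - grad S bc Θ i := fun i => by
    rw [e, grad_add hS hw (V_smul_mem _ hΘ), grad_smul hS _ hΘ]
    simp [sub_eq_add_neg]
  rw [normV_sq, normV_sq, normV_sq, formV0_self, formV0_self, formV0_self]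
  simp_rw [hg]
  have h1 : ∑ i, ‖grad S bc w i - grad S bc Θ i‖ ^ 2
      ≤ 2 * ∑ i, ‖grad S bc w i‖ ^ 2 + 2 * ∑ i, ‖grad S bc Θ i‖ ^ 2 := by
    rw [Finset.mul_sum, Finset.mul_sum, ← Finset.sum_add_distrib]
    exact Finset.sum_le_sum fun i _ => norm_sub_sq_le_two_mul _ _
  linarith [norm_sub_sq_le_two_mul w Θ]

/-- The feedback acting on the order parameter equation controls the `H`-norm, up to a small part
of the norm of `D(A)`. -/
lemma exists_coercive_feedback₁ (hS : S.Admissible bc) (ha : a.Admissible S) :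
    ∃ C : ℝ, 0 ≤ C ∧ ∀ M : ℕ, 1 ≤ M → ∀ w ∈ DA S bc, ∃ s : ℝ, 0 ≤ s ∧
      (∀ lam, ⟪feedback₁ S bc a M lam w, w⟫ = -lam * s) ∧
      ‖w‖ ^ 2 ≤ C / M * (normDA S bc w ^ 2 + s) + 2 * s := by
  -- Zero mean over one box per cell is enough for Poincaré; the box with index `0` serves. The
  -- constant `4 * C ^ 2` below collects two factors 2, from `‖w‖² ≤ 2 ‖w - Θ‖² + 2 ‖Θ‖²` and from
  -- splitting the `D(A)` norm of `w - Θ`.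
  obtain ⟨C, hC0, hC⟩ := exists_poincare_tiling S (ha.subset₁ 0)
    (volume_image_refBox_pos ha.l_pos (a.c₁ 0))
  refine ⟨4 * C ^ 2, by positivity, fun M hM w hw => ?_⟩
  obtain ⟨r, hMr, hT⟩ := exists_isTiling hS hM
  have hM0 : (1 : ℝ) ≤ M := by exact_mod_cast hM
  have hr : 0 < r := by linarith
  have hfin : Finite (S.charts M) := hT.finite
  have hle := auxU_le (bc := bc) hS hr hT ha
  have key := (isActFamily_U hr hT ha).feedback_structure
    (b := fun w y => ⟪opA S bc w, opA S bc y⟫)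
    (fun w _ x hx y hy => by
      rw [← auxU_eq] at hx hy
      simp only [opA_add hS (hle hx) (hle hy), inner_add_right])
    (fun w _ c x hx => by
      rw [← auxU_eq] at hx
      simp only [opA_smul hS c (hle hx), real_inner_smul_right]) w
  rw [← auxU_eq, ← actU_eq] at key
  obtain ⟨h1, h2, h3⟩ := key
  set Θ := obliqueProj S (auxU S a M) (actU S a M) fun x => ⟪w, x⟫
  have hΘ : Θ ∈ DA S bc := hle h1
  have hϑ : w - Θ ∈ DA S bc := (submoduleDA hS).sub_mem hw hΘ
  have hopA : opA S bc (w - Θ) = opA S bc w - opA S bc Θ := by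
    have e : w - Θ = w + (-1 : ℝ) • Θ := by simp [sub_eq_add_neg]
    rw [e, opA_add hS hw ((submoduleDA hS).smul_mem _ hΘ), opA_smul hS _ hΘ]
    simp [sub_eq_add_neg]
  refine ⟨normDA S bc Θ ^ 2, sq_nonneg _, fun lam => ?_, ?_⟩
  · rw [feedback₁, real_inner_smul_left, h3, real_inner_self_eq_norm_sq, normDA]
  · have hP := hC r _ hr hT (w - Θ) (grad S bc (w - Θ))
      ((isGrad_grad (DA_subset_V hϑ)).hasWeakGrad hS) fun χ hχ => by
        have := h2 (⟨χ, hχ⟩, 0)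
        rwa [actBox_eq_preimage] at this
    have hv := normV_sq_le hϑ
    rw [← formV0_self] at hP
    have hCr : C / r ^ 2 ≤ C / M := by
      have : (M : ℝ) ≤ r ^ 2 := by nlinarith
      gcongr
    have hCM : 0 ≤ C / M := by positivity
    -- The gradient in Poincaré's inequality is interpolated between `D(A)` and `H`. One power of
    -- `‖w - Θ‖` then cancels, and the first-order inequality controls `‖w - Θ‖` by the `D(A)` norm.
    have h4 : ‖w - Θ‖ ^ 2 ≤ C / M * (normDA S bc (w - Θ) * ‖w - Θ‖) := by
      refine hP.trans (mul_le_mul hCr ?_ (formV0_self_nonneg _) hCM)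
      rw [normV_sq] at hv
      nlinarith [sq_nonneg ‖w - Θ‖]
    have h5 : ‖w - Θ‖ ≤ C / M * normDA S bc (w - Θ) := by
      rcases eq_or_lt_of_le (norm_nonneg (w - Θ)) with h0 | h0
      · rw [← h0]; exact mul_nonneg hCM (norm_nonneg _)
      · nlinarith
    have h6 : ‖w - Θ‖ ^ 2 ≤ (C / M) ^ 2 * (2 * normDA S bc w ^ 2 + 2 * normDA S bc Θ ^ 2) := by
      calc _ ≤ (C / M * normDA S bc (w - Θ)) ^ 2 := by gcongr
        _ = (C / M) ^ 2 * normDA S bc (w - Θ) ^ 2 := mul_pow _ _ _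
        _ ≤ _ := by
          gcongr
          rw [normDA, hopA]
          exact norm_sub_sq_le_two_mul _ _
    -- One power of `1 / M` is given away to obtain the same form as for the second feedback.
    have h7 : (C / M) ^ 2 ≤ C ^ 2 / M := by
      rw [div_pow]
      gcongr
      nlinarith
    have h8 := norm_sq_le_two_mul w Θ
    have h9 := pow_le_pow_left₀ (norm_nonneg _) (norm_le_normDA hΘ) 2
    have h10 : (C / M) ^ 2 * (2 * normDA S bc w ^ 2 + 2 * normDA S bc Θ ^ 2)
        ≤ C ^ 2 / M * (2 * normDA S bc w ^ 2 + 2 * normDA S bc Θ ^ 2) := by gcongr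
    have e : 4 * C ^ 2 / M * (normDA S bc w ^ 2 + normDA S bc Θ ^ 2)
        = 2 * (C ^ 2 / M * (2 * normDA S bc w ^ 2 + 2 * normDA S bc Θ ^ 2)) := by ring
    rw [e]
    linarith

/-- The feedback acting on the heat equation controls the `H`-norm, up to a small part
of the norm of `V`. -/
lemma exists_coercive_feedback₂ (hS : S.Admissible bc) (ha : a.Admissible S) :
    ∃ C : ℝ, 0 ≤ C ∧ ∀ M : ℕ, 1 ≤ M → ∀ w ∈ V S bc, ∃ s : ℝ, 0 ≤ s ∧
      (∀ lam, ⟪feedback₂ S bc a M lam w, w⟫ = -lam * s) ∧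
      ‖w‖ ^ 2 ≤ C / M * (normV S bc w ^ 2 + s) + 2 * s := by
  obtain ⟨C, hC0, hC⟩ := exists_poincare_tiling S ha.subset₂
    (volume_image_refBox_pos ha.l_pos a.c₂)
  refine ⟨4 * C, by positivity, fun M hM w hw => ?_⟩
  obtain ⟨r, hMr, hT⟩ := exists_isTiling hS hM
  have hM0 : (1 : ℝ) ≤ M := by exact_mod_cast hM
  have hr : 0 < r := by linarith
  have hfin : Finite (S.charts M) := hT.finite
  have hle := auxV_le (bc := bc) hr hT ha
  have key := (isActFamily_V hr hT ha).feedback_structure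
    (b := fun w y => formV S bc w y)
    (fun w _ x hx y hy => by
      rw [← auxV_eq] at hx hy
      exact formV_add_right hS w (hle hx) (hle hy))
    (fun w _ c x hx => by
      rw [← auxV_eq] at hx
      exact formV_smul_right hS w c (hle hx)) w
  rw [← auxV_eq, ← actV_eq] at key
  obtain ⟨h1, h2, h3⟩ := key
  set Θ := obliqueProj S (auxV S a M) (actV S a M) fun x => ⟪w, x⟫
  have hΘ : Θ ∈ V S bc := hle h1
  have hϑ : w - Θ ∈ V S bc := (submoduleV S bc).sub_mem hw hΘ
  refine ⟨normV S bc Θ ^ 2, sq_nonneg _, fun lam => ?_, ?_⟩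
  · rw [feedback₂, real_inner_smul_left, h3, formV_self, normV_sq]
  · have hP := hC r _ hr hT (w - Θ) (grad S bc (w - Θ))
      ((isGrad_grad hϑ).hasWeakGrad hS) fun χ hχ => by
        have := h2 ⟨χ, hχ⟩
        rwa [actBox_eq_preimage] at this
    rw [← formV0_self] at hP
    have hCr : C / r ^ 2 ≤ C / M := by
      have : (M : ℝ) ≤ r ^ 2 := by nlinarith
      gcongr
    have hCM : 0 ≤ C / M := by positivity
    have h4 : ‖w - Θ‖ ^ 2 ≤ C / M * normV S bc (w - Θ) ^ 2 := by
      refine hP.trans (mul_le_mul hCr ?_ (formV0_self_nonneg _) hCM)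
      rw [normV_sq]
      nlinarith [sq_nonneg ‖w - Θ‖]
    have h5 := mul_le_mul_of_nonneg_left (normV_sub_sq_le hS hw hΘ) hCM
    have h8 := norm_sq_le_two_mul w Θ
    have h9 := pow_le_pow_left₀ (norm_nonneg _) (norm_le_normV (bc := bc) Θ) 2
    have e : 4 * C / M * (normV S bc w ^ 2 + normV S bc Θ ^ 2)
        = 2 * (C / M * (2 * normV S bc w ^ 2 + 2 * normV S bc Θ ^ 2)) := by ring
    rw [e]
    linarith

end

section

/-! ### An energy inequality for weak time derivatives -/

lemma lintegral_mul_enorm_le {α X Y : Type*} [MeasurableSpace α] {μ : Measure α}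
    [NormedAddCommGroup X] [NormedAddCommGroup Y] {f : α → X} {g : α → Y}
    (hf : AEStronglyMeasurable f μ) (hg : AEStronglyMeasurable g μ) :
    ∫⁻ a, ‖f a‖ₑ * ‖g a‖ₑ ∂μ ≤ eLpNorm f 2 μ * eLpNorm g 2 μ := by
  have h := ENNReal.lintegral_mul_le_Lp_mul_Lq μ Real.HolderConjugate.two_two hf.enorm hg.enorm
  rw [eLpNorm_eq_lintegral_rpow_enorm_toReal (by norm_num) (by norm_num),
    eLpNorm_eq_lintegral_rpow_enorm_toReal (by norm_num) (by norm_num)]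
  simpa using h

lemma lintegral_Ioc_sub_eq (f : ℝ → ENNReal) (τ h : ℝ) :
    ∫⁻ σ in Ioc (τ - h) τ, f σ = ∫⁻ r in Ico 0 h, f (τ - r) := by
  rw [← lintegral_indicator measurableSet_Ioc, ← lintegral_indicator measurableSet_Ico,
    ← lintegral_sub_left_eq_self _ τ]
  congr 1 with r
  by_cases h1 : r ∈ Ico 0 h
  · have h2 : τ - r ∈ Ioc (τ - h) τ := ⟨by linarith [h1.2], by linarith [h1.1]⟩
    rw [indicator_of_mem h1, indicator_of_mem h2]
  · have h2 : τ - r ∉ Ioc (τ - h) τ := fun h2 => h1 ⟨by linarith [h2.2], by linarith [h2.1]⟩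
    rw [indicator_of_notMem h1, indicator_of_notMem h2]

/-- The integral over the window is an integral over shifts `r ∈ [0, h)`. For each shift,
Cauchy–Schwarz and translation invariance give the same bound. The resulting factor `h` cancels the
`h⁻¹` of a difference quotient. -/
lemma lintegral_window_mul_le {P : Type*} [NormedAddCommGroup P] {K : ℝ → ℝ} (hK : Measurable K)
    {v : ℝ → P} {s t : ℝ} (hv : AEStronglyMeasurable v (volume.restrict (Ioc s t))) (h : ℝ) :
    ∫⁻ τ in Ioc s t, (∫⁻ σ in Ioc (τ - h) τ, ‖K σ‖ₑ) * ‖v τ‖ₑ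
      ≤ ENNReal.ofReal h * (eLpNorm K 2 volume * eLpNorm v 2 (volume.restrict (Ioc s t))) := by
  have hKe : Measurable fun σ => ‖K σ‖ₑ := hK.enorm
  have hj : AEMeasurable (Function.uncurry fun (τ r : ℝ) => ‖K (τ - r)‖ₑ * ‖v τ‖ₑ)
      ((volume.restrict (Ioc s t)).prod (volume.restrict (Ico 0 h))) := by
    refine AEMeasurable.mul ?_ hv.comp_fst.enorm
    exact (hKe.comp (measurable_fst.sub measurable_snd)).aemeasurable
  calc _ = ∫⁻ τ in Ioc s t, ∫⁻ r in Ico 0 h, ‖K (τ - r)‖ₑ * ‖v τ‖ₑ := by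
        refine lintegral_congr fun τ => ?_
        rw [lintegral_Ioc_sub_eq, lintegral_mul_const]
        exact hKe.comp (measurable_const.sub measurable_id)
    _ = ∫⁻ r in Ico 0 h, ∫⁻ τ in Ioc s t, ‖K (τ - r)‖ₑ * ‖v τ‖ₑ := lintegral_lintegral_swap hj
    _ ≤ ∫⁻ r in Ico 0 h, eLpNorm K 2 volume * eLpNorm v 2 (volume.restrict (Ioc s t)) := by
        refine lintegral_mono fun r => ?_
        have hm : AEStronglyMeasurable (fun τ => K (τ - r)) (volume.restrict (Ioc s t)) :=
          (hK.comp (measurable_id.sub_const r)).aestronglyMeasurable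
        refine (lintegral_mul_enorm_le hm hv).trans ?_
        gcongr
        refine (eLpNorm_mono_measure _ Measure.restrict_le_self).trans (le_of_eq ?_)
        exact eLpNorm_comp_measurePreserving (g := K) (f := fun τ => τ - r)
          hK.aestronglyMeasurable (measurePreserving_sub_right volume r)
    _ = _ := by simp [mul_comm]

/-- The integral telescopes: what remains is the mean of `a` over `[β - h, β]` minus its mean over
`[α - h, α]`. The condition `0 < α` leaves room for the backward shift. -/
lemma tendsto_integral_diff_quotient {a : ℝ → ℝ} {T : ℝ} (ha : ContinuousOn a (Icc 0 T)) {α β : ℝ}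
    (hα : 0 < α) (hαβ : α ≤ β) (hβ : β < T) :
    Filter.Tendsto (fun h => h⁻¹ * ∫ τ in α..β, (a τ - a (τ - h))) (nhdsWithin 0 (Ioi 0))
      (nhds (a β - a α)) := by
  have hint : ∀ x y, 0 ≤ x → x ≤ T → 0 ≤ y → y ≤ T → IntervalIntegrable a volume x y :=
    fun x y hx hx' hy hy' => (ha.mono (uIcc_subset_Icc ⟨hx, hx'⟩ ⟨hy, hy'⟩)).intervalIntegrable
  set F : ℝ → ℝ := fun x => ∫ τ in (0 : ℝ)..x, a τ
  have hF : ∀ x, 0 < x → x < T → HasDerivAt F (a x) x := fun x hx hxT =>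
    intervalIntegral.integral_hasDerivAt_right (hint 0 x le_rfl (by linarith) hx.le hxT.le)
      (ha.stronglyMeasurableAtFilter_nhdsWithin measurableSet_Icc x |>.filter_mono (by
        rw [nhdsWithin_eq_nhds.2 (Icc_mem_nhds hx hxT)]))
      (ha.continuousAt (Icc_mem_nhds hx hxT))
  have hq : ∀ x, 0 < x → x < T →
      Filter.Tendsto (fun h => h⁻¹ * (F x - F (x - h))) (nhdsWithin 0 (Ioi 0)) (nhds (a x)) := by
    intro x hx hxT
    have h1 := (hF x hx hxT).tendsto_slope_zero
    have h2 : Filter.Tendsto (fun h : ℝ => -h) (nhdsWithin 0 (Ioi 0)) (nhdsWithin 0 {0}ᶜ) := by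
      refine tendsto_nhdsWithin_iff.2 ⟨?_, ?_⟩
      · have : Filter.Tendsto (fun h : ℝ => -h) (nhds 0) (nhds 0) := by
          simpa using (continuous_neg (G := ℝ)).tendsto 0
        exact this.mono_left nhdsWithin_le_nhds
      · filter_upwards [self_mem_nhdsWithin] with h hh
        simpa using (ne_of_gt hh)
    refine (h1.comp h2).congr fun h => ?_
    simp only [Function.comp_apply, smul_eq_mul, inv_neg, ← sub_eq_add_neg]
    ring
  refine ((hq β (by linarith) hβ).sub (hq α hα (by linarith))).congr' ?_
  have hlt : ∀ᶠ h in nhdsWithin (0 : ℝ) (Ioi 0), h < α :=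
    nhdsWithin_le_nhds (Iio_mem_nhds hα)
  filter_upwards [self_mem_nhdsWithin, hlt] with h hh hhα
  have hh0 : (0 : ℝ) < h := hh
  have e1 : ∫ τ in α..β, a (τ - h) = F (β - h) - F (α - h) := by
    rw [intervalIntegral.integral_comp_sub_right (fun x => a x) h]
    exact (intervalIntegral.integral_interval_sub_left
      (hint 0 (β - h) le_rfl (by linarith) (by linarith) (by linarith))
      (hint 0 (α - h) le_rfl (by linarith) (by linarith) (by linarith))).symm
  have e2 : ∫ τ in α..β, a τ = F β - F α :=
    (intervalIntegral.integral_interval_sub_left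
      (hint 0 β le_rfl (by linarith) (by linarith) (by linarith))
      (hint 0 α le_rfl (by linarith) (by linarith) (by linarith))).symm
  have hi2 : IntervalIntegrable (fun τ => a (τ - h)) volume α β := by
    have := (hint (α - h) (β - h) (by linarith) (by linarith) (by linarith)
      (by linarith)).comp_sub_right h
    simpa using this
  rw [intervalIntegral.integral_sub (hint α β hα.le (by linarith) (by linarith) hβ.le) hi2, e1, e2]
  ring

variable {P F : Type*} [NormedAddCommGroup P] [NormedSpace ℝ P] [NormedAddCommGroup F]
  [InnerProductSpace ℝ F]

/-- `ż = ξ` in `L²(0, T; P')`, for a space `P` mapped into the pivot space `F` by `J`. -/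
structure IsWeakDeriv (J : P →L[ℝ] F) (z : ℝ → F) (ξ : ℝ → P → ℝ) (K : ℝ → ℝ) (T : ℝ) : Prop where
  cont : ContinuousOn z (Icc 0 T)
  measurable : Measurable K
  memLp : MemLp K 2 volume
  linear : ∀ᵐ t ∂(volume.restrict (Ioc 0 T)), IsLinearMap ℝ (ξ t)
  bound : ∀ᵐ t ∂(volume.restrict (Ioc 0 T)), ∀ y, |ξ t y| ≤ K t * ‖y‖
  integrable : ∀ y, IntegrableOn (fun t => ξ t y) (Ioc 0 T)
  eq : ∀ y s t, 0 ≤ s → s ≤ t → t ≤ T → ⟪z t, J y⟫ - ⟪z s, J y⟫ = ∫ τ in s..t, ξ τ y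

namespace IsWeakDeriv

variable {J : P →L[ℝ] F} {z : ℝ → F} {ξ : ℝ → P → ℝ} {K : ℝ → ℝ} {T : ℝ}

/-- Measurability in time is given only for a fixed element of `P`. It passes to simple functions by
summation, and to `v` by the continuity of `ξ τ` for almost every `τ`. -/
lemma aestronglyMeasurable_apply (h : IsWeakDeriv J z ξ K T) {v : ℝ → P} {s t : ℝ} (hs : 0 ≤ s)
    (ht : t ≤ T) (hv : AEStronglyMeasurable v (volume.restrict (Ioc s t))) :
    AEStronglyMeasurable (fun τ => ξ τ (v τ)) (volume.restrict (Ioc s t)) := by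
  set μ := volume.restrict (Ioc s t)
  have hle : μ ≤ volume.restrict (Ioc 0 T) :=
    Measure.restrict_mono (Ioc_subset_Ioc hs ht) le_rfl
  have hsm : StronglyMeasurable (hv.mk v) := hv.stronglyMeasurable_mk
  have hsimple : ∀ f : SimpleFunc ℝ P, AEStronglyMeasurable (fun τ => ξ τ (f τ)) μ := by
    intro f
    have e : (fun τ => ξ τ (f τ)) = ∑ c ∈ f.range, (f ⁻¹' {c}).indicator fun τ => ξ τ c := by
      funext τ
      rw [Finset.sum_apply, Finset.sum_eq_single (f τ)]
      · rw [indicator_of_mem (by simp)]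
      · intro c _ hc
        exact indicator_of_notMem (fun hτ => hc (by simpa using hτ.symm)) _
      · intro hn
        exact absurd (f.mem_range_self τ) hn
    rw [e]
    refine Finset.aestronglyMeasurable_sum _ fun c _ => ?_
    exact (((h.integrable c).1).mono_measure hle).indicator (f.measurableSet_preimage _)
  refine aestronglyMeasurable_of_tendsto_ae Filter.atTop (fun n => hsimple (hsm.approx n)) ?_
  filter_upwards [hv.ae_eq_mk, ae_mono hle h.linear, ae_mono hle h.bound] with τ h1 h2 h3
  have hlim := hsm.tendsto_approx τ
  rw [← h1] at hlim
  rw [tendsto_iff_norm_sub_tendsto_zero] at hlim ⊢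
  refine squeeze_zero (fun _ => norm_nonneg _) (fun n => ?_)
    (by simpa using hlim.const_mul (K τ))
  rw [← h2.map_sub]
  exact h3 _

lemma integrable_apply (h : IsWeakDeriv J z ξ K T) {v : ℝ → P} {s t : ℝ} (hs : 0 ≤ s)
    (ht : t ≤ T) (hv : MemLp v 2 (volume.restrict (Ioc s t))) :
    IntegrableOn (fun τ => ξ τ (v τ)) (Ioc s t) := by
  have hK : MemLp K 2 (volume.restrict (Ioc s t)) := h.memLp.restrict _
  refine (hK.integrable_mul hv.norm).mono' (h.aestronglyMeasurable_apply hs ht hv.1) ?_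
  filter_upwards [ae_mono (Measure.restrict_mono (Ioc_subset_Ioc hs ht) le_rfl) h.bound] with τ hτ
  exact hτ _

lemma enorm_integral_apply_le (h : IsWeakDeriv J z ξ K T) {v : ℝ → P} {s t : ℝ} (hs : 0 ≤ s)
    (ht : t ≤ T) (hv : AEStronglyMeasurable v (volume.restrict (Ioc s t))) :
    ‖∫ τ in Ioc s t, ξ τ (v τ)‖ₑ
      ≤ eLpNorm K 2 volume * eLpNorm v 2 (volume.restrict (Ioc s t)) := by
  refine (enorm_integral_le_lintegral_enorm _).trans ?_
  calc _ ≤ ∫⁻ τ in Ioc s t, ‖K τ‖ₑ * ‖v τ‖ₑ := by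
        refine lintegral_mono_ae ?_
        filter_upwards [ae_mono (Measure.restrict_mono (Ioc_subset_Ioc hs ht) le_rfl) h.bound]
          with τ hτ
        rw [← enorm_norm (v τ), ← enorm_mul, Real.enorm_eq_ofReal_abs, Real.enorm_eq_ofReal_abs]
        exact ENNReal.ofReal_le_ofReal ((hτ _).trans (le_abs_self _))
    _ ≤ _ := lintegral_mul_enorm_le h.measurable.aestronglyMeasurable hv
    _ ≤ _ := mul_le_mul_left (eLpNorm_mono_measure K Measure.restrict_le_self) _

/-- The pairing of the backward difference quotient of `z` with `v`. -/
def diffPairing (J : P →L[ℝ] F) (z : ℝ → F) (s t : ℝ) (v : ℝ → P) (h : ℝ) : ℝ :=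
  h⁻¹ * ∫ τ in Ioc s t, ⟪z τ - z (τ - h), J (v τ)⟫

lemma enorm_inner_sub_le (h : IsWeakDeriv J z ξ K T) {τ δ : ℝ} (hδ : 0 ≤ δ) (hτ : δ ≤ τ)
    (hτT : τ ≤ T) (y : P) :
    ‖⟪z τ - z (τ - δ), J y⟫‖ₑ ≤ (∫⁻ σ in Ioc (τ - δ) τ, ‖K σ‖ₑ) * ‖y‖ₑ := by
  rw [inner_sub_left, h.eq y (τ - δ) τ (by linarith) (by linarith) hτT,
    intervalIntegral.integral_of_le (by linarith)]
  refine (enorm_integral_le_lintegral_enorm _).trans ?_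
  rw [← lintegral_mul_const _ h.measurable.enorm]
  refine lintegral_mono_ae ?_
  filter_upwards [ae_mono (Measure.restrict_mono (Ioc_subset_Ioc (by linarith) hτT) le_rfl) h.bound]
    with σ hσ
  rw [← enorm_norm y, ← enorm_mul, Real.enorm_eq_ofReal_abs, Real.enorm_eq_ofReal_abs]
  exact ENNReal.ofReal_le_ofReal ((hσ _).trans (le_abs_self _))

/-- The bound is uniform in the step `δ`. It makes the difference quotients equicontinuous in `v ∈
L²`, so their convergence has to be verified only on a dense class. -/
lemma enorm_diffPairing_le (h : IsWeakDeriv J z ξ K T) {v : ℝ → P} {s t δ : ℝ} (hδ : 0 < δ)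
    (hs : δ ≤ s) (ht : t ≤ T) (hv : AEStronglyMeasurable v (volume.restrict (Ioc s t))) :
    ‖diffPairing J z s t v δ‖ₑ
      ≤ eLpNorm K 2 volume * eLpNorm v 2 (volume.restrict (Ioc s t)) := by
  rw [diffPairing, enorm_mul]
  have h1 : ‖∫ τ in Ioc s t, ⟪z τ - z (τ - δ), J (v τ)⟫‖ₑ
      ≤ ENNReal.ofReal δ * (eLpNorm K 2 volume * eLpNorm v 2 (volume.restrict (Ioc s t))) := by
    refine (enorm_integral_le_lintegral_enorm _).trans ?_
    refine (setLIntegral_mono' measurableSet_Ioc fun τ hτ => ?_).trans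
      (lintegral_window_mul_le h.measurable hv δ)
    exact h.enorm_inner_sub_le hδ.le (by linarith [hτ.1]) (hτ.2.trans ht) _
  calc _ ≤ ‖δ⁻¹‖ₑ * (ENNReal.ofReal δ *
        (eLpNorm K 2 volume * eLpNorm v 2 (volume.restrict (Ioc s t)))) := by gcongr
    _ = _ := by
      rw [← mul_assoc, Real.enorm_of_nonneg (by positivity), ← ENNReal.ofReal_mul (by positivity),
        inv_mul_cancel₀ hδ.ne', ENNReal.ofReal_one, one_mul]

lemma integrable_inner_sub (h : IsWeakDeriv J z ξ K T) {v : ℝ → P} {s t δ : ℝ} (hδ : 0 < δ)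
    (hs : δ ≤ s) (ht : t ≤ T) (hv : MemLp v 2 (volume.restrict (Ioc s t))) :
    IntegrableOn (fun τ => ⟪z τ - z (τ - δ), J (v τ)⟫) (Ioc s t) := by
  have hc : ContinuousOn (fun τ => z τ - z (τ - δ)) (Icc s t) := by
    refine (h.cont.mono (Icc_subset_Icc (by linarith) ht)).sub
      (h.cont.comp (by fun_prop) fun τ hτ => ⟨by linarith [hτ.1], by linarith [hτ.2]⟩)
  have hm : AEStronglyMeasurable (fun τ => z τ - z (τ - δ)) (volume.restrict (Ioc s t)) :=
    (hc.mono Ioc_subset_Icc_self).aestronglyMeasurable_of_isSeparable measurableSet_Ioc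
      (TopologicalSpace.IsSeparable.of_separableSpace _)
  obtain ⟨C, hC⟩ := isCompact_Icc.exists_bound_of_continuousOn hc
  have hJv : MemLp (fun τ => J (v τ)) 2 (volume.restrict (Ioc s t)) := J.comp_memLp' hv
  have hzm : MemLp (fun τ => z τ - z (τ - δ)) 2 (volume.restrict (Ioc s t)) := by
    refine MemLp.of_bound hm C ?_
    filter_upwards [ae_restrict_mem measurableSet_Ioc] with τ hτ
    exact hC τ (Ioc_subset_Icc_self hτ)
  refine (hzm.norm.integrable_mul hJv.norm).mono' (hm.inner hJv.1) (ae_of_all _ fun τ => ?_)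
  exact norm_inner_le_norm _ _

end IsWeakDeriv

end

section

/-! ### Convergence of backward difference quotients -/

lemma exists_step_approx {P : Type*} [NormedAddCommGroup P] {v : ℝ → P} {s t : ℝ} (hst : s < t)
    (hv : ContinuousOn v (Icc s t)) {ε : ℝ} (hε : 0 < ε) :
    ∃ N : ℕ, ∃ p : ℕ → ℝ, Monotone p ∧ (∀ i ≤ N, p i ∈ Icc s t) ∧
      ∀ τ ∈ Ioc s t,
        ‖v τ - ∑ i ∈ Finset.range N, (Ioc (p i) (p (i + 1))).indicator (fun _ => v (p i)) τ‖ ≤ ε := by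
  obtain ⟨δ, hδ, hvδ⟩ := Metric.uniformContinuousOn_iff.1
    (isCompact_Icc.uniformContinuousOn_of_continuous hv) ε hε
  obtain ⟨N, hN⟩ := exists_nat_gt ((t - s) / δ)
  have hN0 : (0 : ℝ) < N := (div_pos (by linarith) hδ).trans hN
  set η := (t - s) / N with hη
  have hη0 : 0 < η := div_pos (by linarith) hN0
  have hηδ : η < δ := by
    rw [hη, div_lt_iff₀ hN0]; rw [div_lt_iff₀ hδ] at hN; linarith
  have hNη : N * η = t - s := by rw [hη]; field_simp
  set p : ℕ → ℝ := fun i => s + i * η with hp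
  have hmono : Monotone p := fun i j hij => by
    have : (i : ℝ) ≤ j := by exact_mod_cast hij
    simp only [hp]; gcongr
  have hmem : ∀ i ≤ N, p i ∈ Icc s t := fun i hi => by
    have h1 : (i : ℝ) ≤ N := by exact_mod_cast hi
    have h2 : (0 : ℝ) ≤ i := Nat.cast_nonneg i
    constructor
    · simp only [hp]; nlinarith
    · simp only [hp]; nlinarith
  refine ⟨N, p, hmono, hmem, fun τ hτ => ?_⟩
  obtain ⟨i, hiN, hi⟩ : ∃ i < N, τ ∈ Ioc (p i) (p (i + 1)) := by
    have hpos : 0 < (τ - s) / η := div_pos (by linarith [hτ.1]) hη0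
    -- The intervals are open on the left, so `τ` lies in the one whose index is the ceiling minus
    -- one.
    have hc : 0 < ⌈(τ - s) / η⌉₊ := Nat.ceil_pos.2 hpos
    obtain ⟨i, hi⟩ := Nat.exists_eq_succ_of_ne_zero hc.ne'
    have h1 := Nat.ceil_lt_add_one hpos.le
    have h2 := Nat.le_ceil ((τ - s) / η)
    rw [hi] at h1 h2
    push_cast at h1 h2
    rw [div_le_iff₀ hη0] at h2
    have h3 : (i : ℝ) < (τ - s) / η := by linarith
    rw [lt_div_iff₀ hη0] at h3
    refine ⟨i, ?_, ?_⟩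
    · have : (i : ℝ) < N := by
        by_contra hc; push Not at hc; nlinarith [hτ.2]
      exact_mod_cast this
    · simp only [hp, mem_Ioc]
      push_cast
      constructor <;> linarith
  rw [Finset.sum_eq_single i]
  · rw [indicator_of_mem hi, ← dist_eq_norm]
    refine (hvδ τ (Ioc_subset_Icc_self hτ) (p i) (hmem i hiN.le) ?_).le
    rw [Real.dist_eq, abs_of_nonneg (by linarith [hi.1])]
    have := hi.2
    simp only [hp] at this ⊢
    push_cast at this
    linarith
  · intro j _ hj
    refine indicator_of_notMem (fun hτj => ?_) _
    exact Set.disjoint_left.1 (hmono.pairwise_disjoint_on_Ioc_succ hj) hτj hi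
  · intro h; exact absurd (Finset.mem_range.2 hiN) h

namespace IsWeakDeriv

variable {P F : Type*} [NormedAddCommGroup P] [NormedSpace ℝ P] [NormedAddCommGroup F]
  [InnerProductSpace ℝ F] {J : P →L[ℝ] F} {z : ℝ → F} {ξ : ℝ → P → ℝ} {K : ℝ → ℝ} {T : ℝ}

/-- The difference quotients of `z`, tested with `v`, converge to the weak derivative. -/
structure Converges (J : P →L[ℝ] F) (z : ℝ → F) (ξ : ℝ → P → ℝ) (s t : ℝ) (v : ℝ → P) : Prop where
  memLp : MemLp v 2 (volume.restrict (Ioc s t))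
  tendsto : Filter.Tendsto (diffPairing J z s t v) (nhdsWithin 0 (Ioi 0))
    (nhds (∫ τ in Ioc s t, ξ τ (v τ)))

lemma eventually_small {s : ℝ} (hs : 0 < s) :
    ∀ᶠ δ in nhdsWithin (0 : ℝ) (Ioi 0), 0 < δ ∧ δ ≤ s := by
  have hlt : ∀ᶠ h in nhdsWithin (0 : ℝ) (Ioi 0), h < s :=
    nhdsWithin_le_nhds (Iio_mem_nhds hs)
  filter_upwards [self_mem_nhdsWithin, hlt] with h hh hhs using ⟨hh, hhs.le⟩

lemma diffPairing_add (h : IsWeakDeriv J z ξ K T) {v w : ℝ → P} {s t δ : ℝ} (hδ : 0 < δ)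
    (hs : δ ≤ s) (ht : t ≤ T) (hv : MemLp v 2 (volume.restrict (Ioc s t)))
    (hw : MemLp w 2 (volume.restrict (Ioc s t))) :
    diffPairing J z s t (fun τ => v τ + w τ) δ
      = diffPairing J z s t v δ + diffPairing J z s t w δ := by
  simp only [diffPairing, map_add, inner_add_right]
  rw [integral_add (h.integrable_inner_sub hδ hs ht hv) (h.integrable_inner_sub hδ hs ht hw),
    mul_add]

lemma integral_apply_add (h : IsWeakDeriv J z ξ K T) {v w : ℝ → P} {s t : ℝ}
    (hs : 0 ≤ s) (ht : t ≤ T) (hv : MemLp v 2 (volume.restrict (Ioc s t)))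
    (hw : MemLp w 2 (volume.restrict (Ioc s t))) :
    ∫ τ in Ioc s t, ξ τ (v τ + w τ)
      = (∫ τ in Ioc s t, ξ τ (v τ)) + ∫ τ in Ioc s t, ξ τ (w τ) := by
  rw [← integral_add (h.integrable_apply hs ht hv) (h.integrable_apply hs ht hw)]
  refine integral_congr_ae ?_
  filter_upwards [ae_mono (Measure.restrict_mono (Ioc_subset_Ioc hs ht) le_rfl) h.linear] with τ hτ
  exact hτ.map_add _ _

lemma Converges.add (h : IsWeakDeriv J z ξ K T) {v w : ℝ → P} {s t : ℝ} (hs : 0 < s) (ht : t ≤ T)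
    (hv : Converges J z ξ s t v) (hw : Converges J z ξ s t w) :
    Converges J z ξ s t fun τ => v τ + w τ := by
  refine ⟨hv.memLp.add hw.memLp, ?_⟩
  rw [h.integral_apply_add hs.le ht hv.memLp hw.memLp]
  refine (hv.tendsto.add hw.tendsto).congr' ?_
  filter_upwards [eventually_small hs] with δ hδ
  rw [h.diffPairing_add hδ.1 hδ.2 ht hv.memLp hw.memLp]

lemma Converges.zero (h : IsWeakDeriv J z ξ K T) {s t : ℝ} (hs : 0 < s) (ht : t ≤ T) :
    Converges J z ξ s t fun _ => 0 := by
  refine ⟨MemLp.zero, ?_⟩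
  have e : ∫ τ in Ioc s t, ξ τ 0 = 0 := by
    rw [← integral_zero ℝ ℝ (μ := volume.restrict (Ioc s t))]
    refine integral_congr_ae ?_
    filter_upwards [ae_mono (Measure.restrict_mono (Ioc_subset_Ioc hs.le ht) le_rfl) h.linear]
      with τ hτ
    exact hτ.map_zero
  rw [e]
  refine tendsto_const_nhds.congr fun δ => ?_
  simp [diffPairing]

lemma Converges.sum (h : IsWeakDeriv J z ξ K T) {s t : ℝ} (hs : 0 < s) (ht : t ≤ T)
    (N : ℕ) {v : ℕ → ℝ → P} (hv : ∀ i < N, Converges J z ξ s t (v i)) :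
    Converges J z ξ s t fun τ => ∑ i ∈ Finset.range N, v i τ := by
  induction N with
  | zero => simpa using Converges.zero h hs ht
  | succ N ih =>
    simp only [Finset.sum_range_succ]
    exact Converges.add h hs ht (ih fun i hi => hv i (by omega)) (hv N (by omega))

/-- For a constant value on an interval, the pairing is the difference quotient of the scalar
function `(z, J c)`, and the limit is known from the integrated equation. -/
lemma Converges.indicator (h : IsWeakDeriv J z ξ K T) {s t α β : ℝ} (hs : 0 < s) (ht : t < T)
    (hα : s ≤ α) (hαβ : α ≤ β) (hβ : β ≤ t) (c : P) :
    Converges J z ξ s t ((Ioc α β).indicator fun _ => c) := by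
  have hsub : Ioc α β ⊆ Ioc s t := Ioc_subset_Ioc hα hβ
  refine ⟨(memLp_const c).indicator measurableSet_Ioc, ?_⟩
  have e1 : ∫ τ in Ioc s t, ξ τ ((Ioc α β).indicator (fun _ => c) τ) = ⟪z β, J c⟫ - ⟪z α, J c⟫ := by
    rw [h.eq c α β (by linarith) hαβ (by linarith), intervalIntegral.integral_of_le hαβ]
    have : ∫ τ in Ioc s t, ξ τ ((Ioc α β).indicator (fun _ => c) τ)
        = ∫ τ in Ioc s t, (Ioc α β).indicator (fun τ => ξ τ c) τ := by
      refine integral_congr_ae ?_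
      filter_upwards [ae_mono (Measure.restrict_mono (Ioc_subset_Ioc hs.le ht.le) le_rfl) h.linear]
        with τ hτ
      by_cases hm : τ ∈ Ioc α β
      · simp [hm]
      · simp [hm, hτ.map_zero]
    rw [this, setIntegral_indicator measurableSet_Ioc, inter_eq_self_of_subset_right hsub]
  rw [e1]
  have hc : ContinuousOn (fun τ => ⟪z τ, J c⟫) (Icc 0 T) := h.cont.inner continuousOn_const
  refine (tendsto_integral_diff_quotient hc (by linarith) hαβ (by linarith)).congr fun δ => ?_
  rw [diffPairing, intervalIntegral.integral_of_le hαβ]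
  have e2 : ∀ τ, ⟪z τ - z (τ - δ), J ((Ioc α β).indicator (fun _ => c) τ)⟫
      = (Ioc α β).indicator (fun τ => ⟪z τ, J c⟫ - ⟪z (τ - δ), J c⟫) τ := fun τ => by
    by_cases hm : τ ∈ Ioc α β
    · simp [hm, inner_sub_left]
    · simp [hm]
  simp_rw [e2]
  rw [setIntegral_indicator measurableSet_Ioc, inter_eq_self_of_subset_right hsub]

lemma Converges.of_approx (h : IsWeakDeriv J z ξ K T) {s t : ℝ} (hs : 0 < s) (ht : t ≤ T)
    {v : ℝ → P} (hv : MemLp v 2 (volume.restrict (Ioc s t)))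
    (happ : ∀ ε : ENNReal, ε ≠ 0 → ∃ w, Converges J z ξ s t w ∧
      eLpNorm (fun τ => v τ - w τ) 2 (volume.restrict (Ioc s t)) ≤ ε) :
    Converges J z ξ s t v := by
  refine ⟨hv, ?_⟩
  rw [Metric.tendsto_nhds]
  intro ε hε
  set N := (eLpNorm K 2 volume).toReal
  have hN0 : 0 ≤ N := ENNReal.toReal_nonneg
  -- Three errors of size `ε / 3`: the two pairings of `v - w` and the convergence for `w`. The
  -- summand 1 avoids a division by zero.
  set η := ε / (3 * (N + 1)) with hη
  have hη0 : 0 < η := by positivity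
  obtain ⟨w, hw, hvw⟩ := happ (ENNReal.ofReal η) (by simpa using hη0)
  have hd : MemLp (fun τ => v τ - w τ) 2 (volume.restrict (Ioc s t)) := hv.sub hw.memLp
  have hfin : eLpNorm K 2 volume * ENNReal.ofReal η ≠ ⊤ :=
    ENNReal.mul_ne_top h.memLp.2.ne ENNReal.ofReal_ne_top
  have hsmall : ∀ x : ℝ, ‖x‖ₑ ≤ eLpNorm K 2 volume *
      eLpNorm (fun τ => v τ - w τ) 2 (volume.restrict (Ioc s t)) → |x| < ε / 3 := by
    intro x hx
    have h1 : ‖x‖ₑ ≤ eLpNorm K 2 volume * ENNReal.ofReal η := hx.trans (by gcongr)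
    have h2 := ENNReal.toReal_mono hfin h1
    rw [toReal_enorm, ENNReal.toReal_mul, ENNReal.toReal_ofReal hη0.le, Real.norm_eq_abs] at h2
    refine h2.trans_lt ?_
    have : (N + 1) * η = ε / 3 := by rw [hη]; field_simp
    linarith
  have hcv : ∀ τ, v τ = (v τ - w τ) + w τ := fun τ => by abel
  have ev : ∫ τ in Ioc s t, ξ τ (v τ)
      = (∫ τ in Ioc s t, ξ τ (v τ - w τ)) + ∫ τ in Ioc s t, ξ τ (w τ) := by
    rw [← h.integral_apply_add hs.le ht hd hw.memLp]
    simp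
  filter_upwards [eventually_small hs, Metric.tendsto_nhds.1 hw.tendsto (ε / 3) (by positivity)]
    with δ hδ hδ2
  have ed : diffPairing J z s t v δ
      = diffPairing J z s t (fun τ => v τ - w τ) δ + diffPairing J z s t w δ := by
    rw [← h.diffPairing_add hδ.1 hδ.2 ht hd hw.memLp]
    simp
  rw [Real.dist_eq] at hδ2 ⊢
  rw [ev, ed]
  have h1 := hsmall _ (h.enorm_diffPairing_le hδ.1 hδ.2 ht hd.1)
  have h2 := hsmall _ (h.enorm_integral_apply_le hs.le ht hd.1)
  rw [abs_lt] at h1 h2 hδ2 ⊢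
  constructor <;> linarith [h1.1, h1.2, h2.1, h2.2, hδ2.1, hδ2.2]

lemma Converges.of_continuous (h : IsWeakDeriv J z ξ K T) {s t : ℝ} (hs : 0 < s) (hst : s < t)
    (ht : t < T) {v : ℝ → P} (hc : ContinuousOn v (Icc s t))
    (hv : MemLp v 2 (volume.restrict (Ioc s t))) :
    Converges J z ξ s t v := by
  refine Converges.of_approx h hs ht.le hv fun ε hε => ?_
  set V := (volume.restrict (Ioc s t)) univ ^ (1 / 2 : ℝ)
  have hV : V ≠ ⊤ := ENNReal.rpow_ne_top_of_nonneg (by norm_num) (by simp)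
  obtain ⟨η, hη0, hη⟩ : ∃ η : ℝ, 0 < η ∧ V * ENNReal.ofReal η ≤ ε := by
    rcases eq_or_ne ε ⊤ with rfl | htop
    · exact ⟨1, one_pos, le_top⟩
    · refine ⟨(ε / (V + 1)).toReal, ?_, ?_⟩
      · refine ENNReal.toReal_pos (ENNReal.div_pos hε (by simp [hV])).ne' ?_
        exact ENNReal.div_ne_top htop (by simp)
      · rw [ENNReal.ofReal_toReal (ENNReal.div_ne_top htop (by simp))]
        calc V * (ε / (V + 1)) ≤ (V + 1) * (ε / (V + 1)) := by gcongr; exact le_self_add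
          _ ≤ ε := ENNReal.mul_div_le
  obtain ⟨N, p, hmono, hmem, happ⟩ := exists_step_approx hst hc hη0
  refine ⟨_, Converges.sum h hs ht.le N (v := fun i => (Ioc (p i) (p (i + 1))).indicator
    fun _ => v (p i)) fun i hi => Converges.indicator h hs ht (hmem i hi.le).1
      (hmono (Nat.le_succ i)) (hmem (i + 1) hi).2 _, ?_⟩
  refine (eLpNorm_le_of_ae_bound (C := η) ?_).trans ?_
  · filter_upwards [ae_restrict_mem measurableSet_Ioc] with τ hτ
    exact happ τ hτ
  · refine le_trans (le_of_eq ?_) hη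
    simp only [V]
    norm_num

/-- Density in two stages: step functions approximate continuous ones uniformly, and continuous
functions are dense in `L²`. -/
lemma converges (h : IsWeakDeriv J z ξ K T) {s t : ℝ} (hs : 0 < s) (hst : s < t) (ht : t < T)
    {v : ℝ → P} (hv : MemLp v 2 (volume.restrict (Ioc s t))) : Converges J z ξ s t v := by
  refine Converges.of_approx h hs ht.le hv fun ε hε => ?_
  obtain ⟨g, hg, hgm⟩ := hv.exists_boundedContinuous_eLpNorm_sub_le (by norm_num) hε
  exact ⟨g, Converges.of_continuous h hs hst ht g.continuous.continuousOn hgm, hg⟩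

/-- Energy inequality: `‖z(t)‖² - ‖z(s)‖² ≤ 2 ∫ ξ(z)`. -/
theorem norm_sq_sub_le (h : IsWeakDeriv J z ξ K T) {s t : ℝ} (hs : 0 < s) (hst : s < t) (ht : t < T)
    {u : ℝ → P} (hu : MemLp u 2 (volume.restrict (Ioc s t)))
    (huz : ∀ᵐ τ ∂(volume.restrict (Ioc s t)), J (u τ) = z τ) :
    ‖z t‖ ^ 2 - ‖z s‖ ^ 2 ≤ 2 * ∫ τ in Ioc s t, ξ τ (u τ) := by
  have h1 := (h.converges hs hst ht hu).tendsto.const_mul 2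
  have hn : ContinuousOn (fun τ => ‖z τ‖ ^ 2) (Icc 0 T) := h.cont.norm.pow 2
  have h2 := tendsto_integral_diff_quotient hn hs hst.le ht
  refine le_of_tendsto_of_tendsto h2 h1 ?_
  filter_upwards [eventually_small hs] with δ hδ
  rw [diffPairing, intervalIntegral.integral_of_le hst.le, ← mul_assoc, mul_comm 2, mul_assoc,
    ← integral_const_mul 2]
  have hδ0 : 0 ≤ δ⁻¹ := (inv_pos.2 hδ.1).le
  refine mul_le_mul_of_nonneg_left ?_ hδ0
  refine integral_mono_ae ?_ ((h.integrable_inner_sub hδ.1 hδ.2 ht.le hu).const_mul 2) ?_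
  · have hc : ContinuousOn (fun τ => ‖z τ‖ ^ 2 - ‖z (τ - δ)‖ ^ 2) (Icc s t) := by
      refine (hn.mono (Icc_subset_Icc hs.le ht.le)).sub (hn.comp (by fun_prop) fun τ hτ =>
        ⟨by linarith [hτ.1, hδ.2], by linarith [hτ.2]⟩)
    exact (hc.integrableOn_Icc).mono_set Ioc_subset_Icc_self
  -- Here `2 (a - b, a) = ‖a‖² - ‖b‖² + ‖a - b‖²`, and the last square is dropped. The inequality is
  -- all that is needed.
  · filter_upwards [huz] with τ hτ
    rw [hτ, inner_sub_left, real_inner_self_eq_norm_sq]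
    have := norm_sub_sq_real (z τ) (z (τ - δ))
    rw [real_inner_comm] at this
    nlinarith [sq_nonneg ‖z τ - z (τ - δ)‖]

end IsWeakDeriv

end

/-! ### Energy inequalities for the two components of a solution -/

section

variable {d : ℕ} {S : Shape d} {bc : BC}

lemma memLp_two_of_continuousOn {F : Type*} [NormedAddCommGroup F] {z : ℝ → F}
    (hz : ContinuousOn z (Ici 0)) {s t : ℝ} (hs : 0 ≤ s) :
    MemLp z 2 (volume.restrict (Ioc s t)) := by
  have hc : ContinuousOn z (Icc s t) := hz.mono fun x hx => hs.trans hx.1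
  obtain ⟨B, hB⟩ := isCompact_Icc.exists_bound_of_continuousOn hc
  refine MemLp.of_bound ?_ B ?_
  · exact (hc.mono Ioc_subset_Icc_self).aestronglyMeasurable measurableSet_Ioc
  · filter_upwards [ae_restrict_mem measurableSet_Ioc] with τ hτ
    exact hB τ ⟨hτ.1.le, hτ.2⟩

lemma memLp_subtype_iff {α P : Type*} [MeasurableSpace α] [NormedAddCommGroup P] [NormedSpace ℝ P]
    {Γ : Submodule ℝ P} {u : α → Γ} {ν : Measure α} {p : ENNReal} :
    MemLp u p ν ↔ MemLp (fun x => (u x : P)) p ν := by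
  unfold MemLp
  rw [← Topology.IsEmbedding.aestronglyMeasurable_comp_iff
    (g := ((↑) : Γ → P)) Topology.IsEmbedding.subtypeVal]
  exact and_congr Iff.rfl (by rw [eLpNorm_congr_norm_ae (f := u) (g := fun x => (u x : P))
    (ae_of_all _ fun _ => rfl)])

lemma ae_Ioc_of_ae_Ioi {p : ℝ → Prop} (h : ∀ᵐ t ∂(volume.restrict (Ioi (0 : ℝ))), p t) {s : ℝ}
    (hs : 0 ≤ s) (t : ℝ) : ∀ᵐ τ ∂(volume.restrict (Ioc s t)), p τ :=
  ae_restrict_of_ae_restrict_of_subset (fun _ hx => lt_of_le_of_lt hs hx.1) h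

/-- Energy inequality for a function with time derivative in the dual of `X`, where `X` is the
domain of an operator `G` with graph contained in the linear space `Γ`. -/
theorem IsTimeDeriv.norm_sq_sub_le {X : Set (H S)} {nX : H S → ℝ} {z : ℝ → H S}
    {ξ : ℝ → H S → ℝ} (h : IsTimeDeriv S X nX z ξ) (hz : ContinuousOn z (Ici 0))
    (hzX : ∀ᵐ t ∂(volume.restrict (Ioi (0 : ℝ))), z t ∈ X)
    {W : Type*} [NormedAddCommGroup W] [NormedSpace ℝ W] (Γ : Submodule ℝ (H S × W))
    (G : H S → W) (hG : ∀ w ∈ X, (w, G w) ∈ Γ) (hΓ : ∀ p ∈ Γ, p.1 ∈ X) (C : ℝ)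
    (hC : ∀ p ∈ Γ, nX p.1 ≤ C * ‖p‖) (hn : ∀ w, 0 ≤ nX w)
    (hGz : ∀ T > 0, MemLp (fun t => G (z t)) 2 (volume.restrict (Ioc 0 T)))
    (hlin : ∀ᵐ t ∂(volume.restrict (Ioi (0 : ℝ))), IsLinearMap ℝ fun p : Γ => ξ t p.1.1)
    {s t : ℝ} (hs : 0 < s) (hst : s < t) :
    IntegrableOn (fun τ => ξ τ (z τ)) (Ioc s t) ∧
      ‖z t‖ ^ 2 - ‖z s‖ ^ 2 ≤ 2 * ∫ τ in Ioc s t, ξ τ (z τ) := by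
  classical
  set T := t + 1
  have hT : 0 < T := by simp only [T]; linarith
  obtain ⟨k, hk, hkb⟩ := h.bound T hT
  -- The graph `Γ` with the norm of `H × W` serves as the normed space `X`, and `J` as its embedding
  -- into the pivot space. The bound `k` is replaced by a measurable representative and extended by
  -- zero to the whole line.
  set J : Γ →L[ℝ] H S := (ContinuousLinearMap.fst ℝ (H S) W).comp Γ.subtypeL
  set K : ℝ → ℝ := (Ioc 0 T).indicator fun τ => C * |hk.1.mk k τ|
  have hkm : Measurable fun τ => C * |hk.1.mk k τ| :=
    (continuous_abs.measurable.comp hk.1.stronglyMeasurable_mk.measurable).const_mul C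
  have hw : IsWeakDeriv J z (fun τ (p : Γ) => ξ τ p.1.1) K T :=
    { cont := hz.mono fun x hx => hx.1
      measurable := hkm.indicator measurableSet_Ioc
      memLp := by
        refine (memLp_indicator_iff_restrict measurableSet_Ioc).2 ?_
        exact ((hk.ae_eq hk.1.ae_eq_mk).abs).const_mul C
      linear := ae_Ioc_of_ae_Ioi hlin le_rfl T
      bound := by
        filter_upwards [hkb, hk.1.ae_eq_mk, ae_restrict_mem measurableSet_Ioc] with τ h1 h2 h3 p
        have e : K τ = C * |hk.1.mk k τ| := indicator_of_mem h3 _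
        rw [e, ← h2]
        calc |ξ τ p.1.1| ≤ k τ * nX p.1.1 := h1 _ (hΓ _ p.2)
          _ ≤ |k τ| * nX p.1.1 := mul_le_mul_of_nonneg_right (le_abs_self _) (hn _)
          _ ≤ |k τ| * (C * ‖p‖) := mul_le_mul_of_nonneg_left (hC _ p.2) (abs_nonneg _)
          _ = _ := by ring
      integrable := fun p => h.integrable T hT _ (hΓ _ p.2)
      eq := fun p s t h0 hst _ => h.eq _ (hΓ _ p.2) s t h0 hst }
  -- The value `0` is taken only at times when `z τ` is not in `X`, a null set.
  set u : ℝ → Γ := fun τ => if hm : z τ ∈ X then ⟨(z τ, G (z τ)), hG _ hm⟩ else 0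
  have hzX' := ae_Ioc_of_ae_Ioi hzX hs.le t
  have hut : ∀ τ, z τ ∈ X → (u τ).1 = (z τ, G (z τ)) := fun τ hτ => by simp [u, hτ]
  have hu : MemLp u 2 (volume.restrict (Ioc s t)) := by
    refine memLp_subtype_iff.2 ?_
    have hpair : MemLp (fun τ => (z τ, G (z τ))) 2 (volume.restrict (Ioc s t)) :=
      MemLp.of_fst_snd ⟨memLp_two_of_continuousOn hz hs.le,
        (hGz t (hs.trans hst)).mono_measure (Measure.restrict_mono
          (Ioc_subset_Ioc_left hs.le) le_rfl)⟩
    refine hpair.ae_eq ?_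
    filter_upwards [hzX'] with τ hτ
    exact (hut τ hτ).symm
  have huz : ∀ᵐ τ ∂(volume.restrict (Ioc s t)), J (u τ) = z τ := by
    filter_upwards [hzX'] with τ hτ
    change (u τ).1.1 = z τ
    rw [hut τ hτ]
  have hξ : (fun τ => ξ τ (u τ).1.1) =ᵐ[volume.restrict (Ioc s t)] fun τ => ξ τ (z τ) := by
    filter_upwards [hzX'] with τ hτ
    rw [hut τ hτ]
  have htT : t < T := by simp only [T]; linarith
  refine ⟨(hw.integrable_apply hs.le htT.le hu).congr hξ, ?_⟩
  rw [← integral_congr_ae hξ]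
  exact hw.norm_sq_sub_le hs hst htT hu huz

/-- The graph of the shifted Laplacian. -/
def graphA (hS : S.Admissible bc) : Submodule ℝ (H S × H S) where
  carrier := {p | IsShiftedLap S bc p.1 p.2}
  add_mem' h1 h2 := h1.add hS h2
  zero_mem' := by
    have := (isShiftedLap_opA (S := S) (bc := bc) (submoduleDA hS).zero_mem).smul hS 0
    simpa using this
  smul_mem' c _ h := h.smul hS c

/-- The graph of the weak gradient. -/
def graphGrad (S : Shape d) (bc : BC) : Submodule ℝ (H S × (Fin d → H S)) where
  carrier := {p | IsGrad S bc p.1 p.2}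
  add_mem' h1 h2 := h1.add h2
  zero_mem' := by
    have h : IsGrad S bc (0 : H S) (grad S bc 0) := isGrad_grad zero_mem_V
    simpa using h.smul 0
  smul_mem' c _ h := h.smul c

lemma pairF_isLinear (hS : S.Admissible bc) {f : ℝ → ℝ} {yr : ℝ → H S} {t : ℝ} {w : H S}
    (h : MemLp (nonlin S f yr t w) 2 (volume.restrict S.carrier)) :
    (∀ y ∈ DA S bc, ∀ y' ∈ DA S bc,
      pairF S bc f yr t w (y + y') = pairF S bc f yr t w y + pairF S bc f yr t w y') ∧
    ∀ c : ℝ, ∀ y ∈ DA S bc, pairF S bc f yr t w (c • y) = c * pairF S bc f yr t w y := by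
  have e : ∀ y, pairF S bc f yr t w y = ⟪h.toLp _, opA0 S bc y⟫ := fun y => by
    rw [inner_eq_integral, pairF]
    refine integral_congr_ae ?_
    filter_upwards [h.coeFn_toLp] with x hx
    rw [hx]
  refine ⟨fun y hy y' hy' => ?_, fun c y hy => ?_⟩
  · rw [e, e, e, opA0_add hS hy hy', inner_add_right]
  · rw [e, e, opA0_smul hS c hy, real_inner_smul_right]

lemma pairG_isLinear {g : ℝ → ℝ} {yr : ℝ → H S} {t : ℝ} {w : H S}
    (h : ∀ y ∈ DA S bc, IntegrableOn (fun x => nonlin S g yr t w x * y x) S.carrier) :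
    (∀ y ∈ DA S bc, ∀ y' ∈ DA S bc,
      pairG S g yr t w (y + y') = pairG S g yr t w y + pairG S g yr t w y') ∧
    ∀ c : ℝ, ∀ y ∈ DA S bc, pairG S g yr t w (c • y) = c * pairG S g yr t w y := by
  refine ⟨fun y hy y' hy' => ?_, fun c y _ => ?_⟩
  · unfold pairG
    rw [← integral_add (h y hy) (h y' hy')]
    refine integral_congr_ae ?_
    filter_upwards [Lp.coeFn_add y y'] with x hx
    rw [hx, Pi.add_apply, mul_add]
  · unfold pairG
    rw [← integral_const_mul]
    refine integral_congr_ae ?_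
    filter_upwards [Lp.coeFn_smul c y] with x hx
    rw [hx, Pi.smul_apply, smul_eq_mul]
    ring

namespace IsSolution

variable {a : ActuatorData d} {M : ℕ} {lam₁ lam₂ ν₀ ν₁ ν₂ : ℝ} {f g : ℝ → ℝ} {yr : ℝ → H S}
  {z₁ z₂ : ℝ → H S}

/-- The right-hand side has to be linear in the test function at almost every time. This is where
`N_f ∈ H` and the integrability of `N_g y` enter. -/
lemma energy₁ (h : IsSolution S bc a M lam₁ lam₂ ν₀ ν₁ ν₂ f g yr z₁ z₂) (hS : S.Admissible bc)
    {n : ℕ} {ζf ηf ζg ηg : Fin n → ℝ} {Cf Cg : ℝ}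
    (hN : GrowthBounds S bc f g yr ζf ηf ζg ηg Cf Cg) {s t : ℝ} (hs : 0 < s) (hst : s < t) :
    IntegrableOn (fun τ => -ν₂ * ⟪opA0 S bc (z₁ τ), opA0 S bc (z₁ τ)⟫
        - ν₁ * ν₀ * ⟪opA0 S bc (z₁ τ), z₁ τ⟫
        + ν₁ * formV0 S bc (z₂ τ) (z₁ τ) - pairF S bc f yr τ (z₁ τ) (z₁ τ)
        - pairG S g yr τ (z₁ τ) (z₁ τ) + ⟪feedback₁ S bc a M lam₁ (z₁ τ), z₁ τ⟫) (Ioc s t) ∧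
      ‖z₁ t‖ ^ 2 - ‖z₁ s‖ ^ 2 ≤ 2 * ∫ τ in Ioc s t,
        (-ν₂ * ⟪opA0 S bc (z₁ τ), opA0 S bc (z₁ τ)⟫ - ν₁ * ν₀ * ⟪opA0 S bc (z₁ τ), z₁ τ⟫
        + ν₁ * formV0 S bc (z₂ τ) (z₁ τ) - pairF S bc f yr τ (z₁ τ) (z₁ τ)
        - pairG S g yr τ (z₁ τ) (z₁ τ) + ⟪feedback₁ S bc a M lam₁ (z₁ τ), z₁ τ⟫) := by
  have hΓ : ∀ p ∈ graphA hS, p.1 ∈ DA S bc := fun p hp => ⟨p.2, hp⟩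
  refine h.eq₁.norm_sq_sub_le h.cont₁ h.mem₁ (graphA hS) (opA S bc)
    (fun w hw => isShiftedLap_opA hw) hΓ 1 (fun p hp => ?_) (fun w => norm_nonneg _)
    h.memLp₁ ?_ hs hst
  · have e : opA S bc p.1 = p.2 := IsShiftedLap.opA_eq hp
    rw [normDA, e, one_mul]
    exact norm_snd_le p
  · filter_upwards [hN, h.mem₁] with τ h1 hz
    obtain ⟨hf, hg, -, -⟩ := h1 _ hz
    have hF := pairF_isLinear hS hf
    have hG := pairG_isLinear hg
    constructor
    · rintro ⟨p, hp⟩ ⟨q, hq⟩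
      have hp' := hΓ p hp
      have hq' := hΓ q hq
      change _ * ⟪_, opA0 S bc (p.1 + q.1)⟫ - _ * ⟪_, p.1 + q.1⟫ + _ * formV0 S bc _ (p.1 + q.1)
        - pairF S bc f yr τ _ (p.1 + q.1) - pairG S g yr τ _ (p.1 + q.1) + ⟪_, p.1 + q.1⟫ = _
      rw [hF.1 _ hp' _ hq', hG.1 _ hp' _ hq', opA0_add hS hp' hq', inner_add_right,
        inner_add_right, inner_add_right, formV0_add_right hS _ (DA_subset_V hp') (DA_subset_V hq')]
      ring
    · rintro c ⟨p, hp⟩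
      have hp' := hΓ p hp
      change _ * ⟪_, opA0 S bc (c • p.1)⟫ - _ * ⟪_, c • p.1⟫ + _ * formV0 S bc _ (c • p.1)
        - pairF S bc f yr τ _ (c • p.1) - pairG S g yr τ _ (c • p.1) + ⟪_, c • p.1⟫ = _
      rw [hF.2 _ _ hp', hG.2 _ _ hp', opA0_smul hS c hp', real_inner_smul_right,
        real_inner_smul_right, real_inner_smul_right, formV0_smul_right hS _ c (DA_subset_V hp'),
        smul_eq_mul]
      ring

lemma energy₂ (h : IsSolution S bc a M lam₁ lam₂ ν₀ ν₁ ν₂ f g yr z₁ z₂) (hS : S.Admissible bc)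
    {s t : ℝ} (hs : 0 < s) (hst : s < t) :
    IntegrableOn (fun τ => -formV0 S bc (z₂ τ) (z₂ τ) + ν₀ * ⟪opA0 S bc (z₁ τ), z₂ τ⟫
        + ⟪feedback₂ S bc a M lam₂ (z₂ τ), z₂ τ⟫) (Ioc s t) ∧
      ‖z₂ t‖ ^ 2 - ‖z₂ s‖ ^ 2 ≤ 2 * ∫ τ in Ioc s t,
        (-formV0 S bc (z₂ τ) (z₂ τ) + ν₀ * ⟪opA0 S bc (z₁ τ), z₂ τ⟫
        + ⟪feedback₂ S bc a M lam₂ (z₂ τ), z₂ τ⟫) := by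
  have hΓ : ∀ p ∈ graphGrad S bc, p.1 ∈ V S bc := fun p hp => ⟨p.2, hp⟩
  -- The graph carries the maximum norm, which bounds the function and each of its `d` partial
  -- derivatives separately; hence the constant `√(d + 1)`.
  refine h.eq₂.norm_sq_sub_le h.cont₂ h.mem₂ (graphGrad S bc) (grad S bc)
    (fun w hw => isGrad_grad hw) hΓ (√(d + 1)) (fun p hp => ?_) normV_nonneg
    (fun T hT => MemLp.of_eval (h.memLp₂ T hT)) ?_ hs hst
  · have e : grad S bc p.1 = p.2 := IsGrad.grad_eq hS hp
    have h1 : normV S bc p.1 ^ 2 ≤ (d + 1) * ‖p‖ ^ 2 := by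
      rw [normV_sq, formV0_self, e]
      have : ∑ i, ‖p.2 i‖ ^ 2 ≤ ∑ _i : Fin d, ‖p‖ ^ 2 := Finset.sum_le_sum fun i _ =>
        pow_le_pow_left₀ (norm_nonneg _) ((norm_le_pi_norm p.2 i).trans (norm_snd_le p)) 2
      have h2 : ‖p.1‖ ^ 2 ≤ ‖p‖ ^ 2 := pow_le_pow_left₀ (norm_nonneg _) (norm_fst_le p) 2
      simp only [Finset.sum_const, Finset.card_univ, Fintype.card_fin, nsmul_eq_mul] at this
      linarith
    refine abs_le_of_sq_le_sq' ?_ (by positivity) |>.2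
    rw [mul_pow, Real.sq_sqrt (by positivity)]
    exact h1
  · refine ae_of_all _ fun τ => ⟨?_, ?_⟩
    · rintro ⟨p, hp⟩ ⟨q, hq⟩
      have hp' := hΓ p hp
      have hq' := hΓ q hq
      change -formV0 S bc _ (p.1 + q.1) + _ * ⟪_, p.1 + q.1⟫ + ⟪_, p.1 + q.1⟫ = _
      rw [inner_add_right, inner_add_right, formV0_add_right hS _ hp' hq']
      ring
    · rintro c ⟨p, hp⟩
      have hp' := hΓ p hp
      change -formV0 S bc _ (c • p.1) + _ * ⟪_, c • p.1⟫ + ⟪_, c • p.1⟫ = _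
      rw [real_inner_smul_right, real_inner_smul_right, formV0_smul_right hS _ c hp', smul_eq_mul]
      ring

end IsSolution

end

/-! ### Young's inequality and the constants of the energy estimate -/

section

/-- The constant in Young's inequality for `C h^ζ a^η`, see `mul_rpow_mul_rpow_le`. -/
def youngConst (ζ η C δ r : ℝ) : ℝ := C ^ (2 / (2 - η)) * δ ^ (η / (2 - η)) * r ^ (2 * ζ / (2 - η) - 2)

lemma youngConst_nonneg {ζ η C δ r : ℝ} (hC : 0 ≤ C) (hδ : 0 ≤ δ) (hr : 0 ≤ r) :
    0 ≤ youngConst ζ η C δ r := by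
  unfold youngConst; positivity

/-- The assumption `ζ + η ≥ 2` says exactly that the exponent of `r` in `youngConst` is nonnegative.
The constant is then nondecreasing in `r`, and a factor `h ^ 2` can be split off. -/
lemma two_le_exponent {ζ η : ℝ} (hη2 : η < 2) (h : 2 ≤ ζ + η) : 0 ≤ 2 * ζ / (2 - η) - 2 := by
  have h1 : 0 < 2 - η := by linarith
  rw [sub_nonneg, le_div_iff₀ h1]
  linarith

lemma youngConst_mono {ζ η C δ r C' δ' r' : ℝ} (hη : 0 ≤ η) (hη2 : η < 2) (h : 2 ≤ ζ + η)
    (hC : 0 ≤ C) (hδ : 0 ≤ δ) (hr : 0 ≤ r) (hCC : C ≤ C') (hδδ : δ ≤ δ') (hrr : r ≤ r') :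
    youngConst ζ η C δ r ≤ youngConst ζ η C' δ' r' := by
  have h1 : 0 < 2 - η := by linarith
  have h2 := two_le_exponent hη2 h
  have hC' := hC.trans hCC
  have hδ' := hδ.trans hδδ
  unfold youngConst
  gcongr

/-- Weighted arithmetic–geometric mean with weights `η / 2` and `(2 - η) / 2`. The second entry `Y`
is chosen such that the geometric mean of `ε a ^ 2` and `Y` is `C h ^ ζ a ^ η`. -/
lemma mul_rpow_mul_rpow_le {ζ η C ε r h a : ℝ} (hη : 0 ≤ η) (hη2 : η < 2) (hζη : 2 ≤ ζ + η)
    (hC : 0 ≤ C) (hε : 0 < ε) (hh : 0 ≤ h) (hhr : h ≤ r) (ha : 0 ≤ a) :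
    C * (h ^ ζ * a ^ η) ≤ ε * a ^ 2 + youngConst ζ η C ε⁻¹ r * h ^ 2 := by
  have h1 : 0 < 2 - η := by linarith
  have h2 := two_le_exponent hη2 hζη
  have hr := hh.trans hhr
  set Y := C ^ (2 / (2 - η)) * ε⁻¹ ^ (η / (2 - η)) * h ^ (2 * ζ / (2 - η)) with hY
  have hY0 : 0 ≤ Y := by positivity
  have hYle : Y ≤ youngConst ζ η C ε⁻¹ r * h ^ 2 := by
    have e : h ^ (2 * ζ / (2 - η)) = h ^ (2 * ζ / (2 - η) - 2) * h ^ 2 := by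
      have := Real.rpow_add_of_nonneg hh h2 zero_le_two
      rwa [sub_add_cancel, Real.rpow_two] at this
    rw [hY, e, youngConst, ← mul_assoc]
    gcongr
  have hyoung := Real.geom_mean_le_arith_mean2_weighted (w₁ := η / 2) (w₂ := (2 - η) / 2)
    (p₁ := ε * a ^ 2) (p₂ := Y) (by positivity) (by positivity) (by positivity) hY0 (by ring)
  have e1 : (ε * a ^ 2) ^ (η / 2) = ε ^ (η / 2) * a ^ η := by
    rw [Real.mul_rpow hε.le (by positivity), ← Real.rpow_natCast_mul ha]
    congr 2
    push_cast
    ring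
  have e2 : Y ^ ((2 - η) / 2) = C * (ε ^ (η / 2))⁻¹ * h ^ ζ := by
    rw [hY, Real.mul_rpow (by positivity) (by positivity), Real.mul_rpow (by positivity)
      (by positivity), ← Real.rpow_mul hC, ← Real.rpow_mul (by positivity), ← Real.rpow_mul hh,
      ← Real.inv_rpow hε.le]
    have a1 : 2 / (2 - η) * ((2 - η) / 2) = 1 := by field_simp
    have a2 : η / (2 - η) * ((2 - η) / 2) = η / 2 := by field_simp
    have a3 : 2 * ζ / (2 - η) * ((2 - η) / 2) = ζ := by field_simp
    rw [a1, a2, a3, Real.rpow_one]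
  have hε' : ε ^ (η / 2) ≠ 0 := (Real.rpow_pos_of_pos hε _).ne'
  have e3 : (ε * a ^ 2) ^ (η / 2) * Y ^ ((2 - η) / 2) = C * (h ^ ζ * a ^ η) := by
    rw [e1, e2]
    field_simp
  rw [e3] at hyoung
  have b1 : η / 2 * (ε * a ^ 2) ≤ ε * a ^ 2 :=
    mul_le_of_le_one_left (by positivity) (by linarith)
  have b2 : (2 - η) / 2 * Y ≤ Y := mul_le_of_le_one_left hY0 (by linarith)
  linarith

/-- The constant in the bound for the sum of terms `C h^ζ a^η` relative to `ν`, as a function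
of `C`, `ν⁻¹`, `R`. -/
def growthConst {n : ℕ} (ζ η : Fin n → ℝ) (C νi R : ℝ) : ℝ :=
  νi * ∑ i, youngConst (ζ i) (η i) C (16 * n * νi) (2 * R)

lemma growthConst_nonneg {n : ℕ} {ζ η : Fin n → ℝ} {C νi R : ℝ} (hC : 0 ≤ C) (hν : 0 ≤ νi)
    (hR : 0 ≤ R) : 0 ≤ growthConst ζ η C νi R :=
  mul_nonneg hν (Finset.sum_nonneg fun _ _ => youngConst_nonneg hC (by positivity) (by positivity))

lemma growthConst_mono {n : ℕ} {ζ η : Fin n → ℝ} (hη : ∀ i, 0 ≤ η i) (hη2 : ∀ i, η i < 2)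
    (h : ∀ i, 2 ≤ ζ i + η i) {C νi R C' νi' R' : ℝ} (hC : 0 ≤ C) (hν : 0 ≤ νi)
    (hR : 0 ≤ R) (hCC : C ≤ C') (hνν : νi ≤ νi') (hRR : R ≤ R') :
    growthConst ζ η C νi R ≤ growthConst ζ η C' νi' R' := by
  unfold growthConst
  refine mul_le_mul hνν (Finset.sum_le_sum fun i _ => ?_) (Finset.sum_nonneg fun _ _ =>
    youngConst_nonneg hC (by positivity) (by positivity)) (hν.trans hνν)
  exact youngConst_mono (hη i) (hη2 i) (h i) hC (by positivity) (by positivity) hCC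
    (by gcongr) (by gcongr)

/-- Young's inequality with `ε = ν / (16 n)` for each of the `n` terms. The radius `2 R` is the one
available during the bootstrap. -/
lemma growth_le {n : ℕ} (hn : 1 ≤ n) {ζ η : Fin n → ℝ} (hη : ∀ i, 0 ≤ η i) (hη2 : ∀ i, η i < 2)
    (h : ∀ i, 2 ≤ ζ i + η i) {C ν R x y : ℝ} (hC : 0 ≤ C) (hν : 0 < ν) (hx : 0 ≤ x)
    (hxR : x ≤ 2 * R) (hy : 0 ≤ y) :
    C * ∑ i, x ^ ζ i * y ^ η i ≤ ν / 16 * y ^ 2 + ν * growthConst ζ η C ν⁻¹ R * x ^ 2 := by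
  have hn0 : (0 : ℝ) < n := by exact_mod_cast hn
  have key : ∀ i, C * (x ^ ζ i * y ^ η i) ≤ ν / (16 * n) * y ^ 2
      + youngConst (ζ i) (η i) C (16 * n * ν⁻¹) (2 * R) * x ^ 2 := fun i => by
    have := mul_rpow_mul_rpow_le (hη i) (hη2 i) (h i) hC (ε := ν / (16 * n)) (by positivity)
      hx hxR hy
    rwa [inv_div, div_eq_mul_inv (16 * (n : ℝ))] at this
  rw [Finset.mul_sum]
  refine (Finset.sum_le_sum fun i _ => key i).trans (le_of_eq ?_)
  rw [Finset.sum_add_distrib, growthConst, mul_inv_cancel_left₀ hν.ne', Finset.sum_mul]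
  congr 1
  simp only [Finset.sum_const, Finset.card_univ, Fintype.card_fin, nsmul_eq_mul]
  field_simp

/-- The constant in front of `‖z₁‖²` in the energy estimate, relative to `ν₂`. -/
def energyConst {n : ℕ} (ζf ηf ζg ηg : Fin n → ℝ) (Cf Cg n₀ n₁ νi R : ℝ) : ℝ :=
  7 + 4 * (n₀ * n₁) ^ 2 * νi ^ 2 + 16 * (n₀ + n₁) ^ 4 * νi ^ 2
    + growthConst ζf ηf Cf νi R + growthConst ζg ηg Cg νi R

lemma energyConst_nonneg {n : ℕ} {ζf ηf ζg ηg : Fin n → ℝ} {Cf Cg n₀ n₁ νi R : ℝ}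
    (hCf : 0 ≤ Cf) (hCg : 0 ≤ Cg) (hν : 0 ≤ νi) (hR : 0 ≤ R) :
    0 ≤ energyConst ζf ηf ζg ηg Cf Cg n₀ n₁ νi R := by
  have h1 := growthConst_nonneg (ζ := ζf) (η := ηf) hCf hν hR
  have h2 := growthConst_nonneg (ζ := ζg) (η := ηg) hCg hν hR
  unfold energyConst
  positivity

lemma energyConst_mono {n : ℕ} {ζf ηf ζg ηg : Fin n → ℝ} (hηf : ∀ i, 0 ≤ ηf i)
    (hηg : ∀ i, 0 ≤ ηg i) (hηf2 : ∀ i, ηf i < 2) (hηg2 : ∀ i, ηg i < 2)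
    (hf2 : ∀ i, 2 ≤ ζf i + ηf i) (hg2 : ∀ i, 2 ≤ ζg i + ηg i)
    {Cf Cg n₀ n₁ νi R Cf' Cg' n₀' n₁' νi' R' : ℝ} (hCf : 0 ≤ Cf) (hCg : 0 ≤ Cg) (h0 : 0 ≤ n₀)
    (h1 : 0 ≤ n₁) (hν : 0 ≤ νi) (hR : 0 ≤ R) (hCf' : Cf ≤ Cf') (hCg' : Cg ≤ Cg') (h0' : n₀ ≤ n₀')
    (h1' : n₁ ≤ n₁') (hν' : νi ≤ νi') (hR' : R ≤ R') :
    energyConst ζf ηf ζg ηg Cf Cg n₀ n₁ νi R ≤ energyConst ζf ηf ζg ηg Cf' Cg' n₀' n₁' νi' R' := by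
  have k1 := growthConst_mono hηf hηf2 hf2 hCf hν hR hCf' hν' hR'
  have k2 := growthConst_mono hηg hηg2 hg2 hCg hν hR hCg' hν' hR'
  have h0n := h0.trans h0'
  unfold energyConst
  gcongr

/-- The algebraic part of the energy estimate. -/
lemma energy_algebra {x y v p n₀ n₁ ν : ℝ} (hν : 0 < ν)
    (hp : p ^ 2 ≤ y * x) (hn₀ : 0 ≤ n₀) (hn₁ : 0 ≤ n₁) :
    -ν * (y ^ 2 - 2 * p ^ 2 + x ^ 2) + n₀ * n₁ * p ^ 2 + (n₀ + n₁) * (v * p)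
      ≤ -(3 / 4) * ν * y ^ 2 + 1 / 8 * v ^ 2
        + ν * (7 + 4 * (n₀ * n₁) ^ 2 * ν⁻¹ ^ 2 + 16 * (n₀ + n₁) ^ 4 * ν⁻¹ ^ 2) * x ^ 2 := by
  set m := n₀ * n₁
  set N := n₀ + n₁
  have hm : 0 ≤ m := by positivity
  have e1 : ν * (7 + 4 * m ^ 2 * ν⁻¹ ^ 2 + 16 * N ^ 4 * ν⁻¹ ^ 2) * x ^ 2
      = 7 * ν * x ^ 2 + 4 * m ^ 2 * ν⁻¹ * x ^ 2 + 16 * N ^ 4 * ν⁻¹ * x ^ 2 := by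
    field_simp
  -- From `2 p² ≤ 2 y x ≤ y² / 8 + 8 x²`, whence the constant 7. The next two steps spend `ν / 16`
  -- each on `y²`, which leaves `7/8 - 1/8 = 3/4`; the coupling also spends `v² / 8`.
  have b1 : -ν * (y ^ 2 - 2 * p ^ 2 + x ^ 2) ≤ -ν * (7 / 8 * y ^ 2 - 7 * x ^ 2) := by
    have : 7 / 8 * y ^ 2 - 7 * x ^ 2 ≤ y ^ 2 - 2 * p ^ 2 + x ^ 2 := by
      nlinarith [sq_nonneg (y - 8 * x)]
    nlinarith
  have b2 : m * p ^ 2 ≤ ν / 16 * y ^ 2 + 4 * m ^ 2 * ν⁻¹ * x ^ 2 := by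
    have h1 : m * p ^ 2 ≤ m * (y * x) := mul_le_mul_of_nonneg_left hp hm
    have h2 : ν / 16 * y ^ 2 + 4 * m ^ 2 * ν⁻¹ * x ^ 2 - m * (y * x)
        = ν * (y / 4 - 2 * m * ν⁻¹ * x) ^ 2 := by
      field_simp
      ring
    have h3 : 0 ≤ ν * (y / 4 - 2 * m * ν⁻¹ * x) ^ 2 := by positivity
    linarith
  have b3 : N * (v * p) ≤ 1 / 8 * v ^ 2 + (ν / 16 * y ^ 2 + 16 * N ^ 4 * ν⁻¹ * x ^ 2) := by
    have h0 : N * (v * p) ≤ 1 / 8 * v ^ 2 + 2 * N ^ 2 * p ^ 2 := by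
      nlinarith [sq_nonneg (v - 4 * N * p)]
    have h1 : 2 * N ^ 2 * p ^ 2 ≤ 2 * N ^ 2 * (y * x) := mul_le_mul_of_nonneg_left hp (by positivity)
    have h2 : ν / 16 * y ^ 2 + 16 * N ^ 4 * ν⁻¹ * x ^ 2 - 2 * N ^ 2 * (y * x)
        = ν * (y / 4 - 4 * N ^ 2 * ν⁻¹ * x) ^ 2 := by
      field_simp
      ring
    have h3 : 0 ≤ ν * (y / 4 - 4 * N ^ 2 * ν⁻¹ * x) ^ 2 := by positivity
    linarith
  rw [e1]
  linarith

end

/-! ### Energy estimate, bootstrap and exponential decay -/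

section

variable {d : ℕ} {S : Shape d} {bc : BC}

/-- Both coupling terms equal a multiple of `(∇w₂, ∇w₁)`. Balance for `ν₂ ‖w₁‖²` in `D(A)`: `-3/4`
from the linear part, `+1/16` from each nonlinearity, `+1/4` granted to the feedback; the sum
`-3/8`, doubled, is below `-1/2`. Balance for `‖w₂‖_V²`: `-1 + 1/8 + 5/8 = -1/4`, doubled `-1/2`.
The `1` in `1 + μ` pays for the difference between `‖∇w₂‖²` and `‖w₂‖_V²`. -/
lemma energy_pointwise {n : ℕ} (hn : 1 ≤ n) {ζf ηf ζg ηg : Fin n → ℝ}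
    (hηf : ∀ i, 0 ≤ ηf i) (hηg : ∀ i, 0 ≤ ηg i) (hηf2 : ∀ i, ηf i < 2) (hηg2 : ∀ i, ηg i < 2)
    (hf2 : ∀ i, 2 ≤ ζf i + ηf i) (hg2 : ∀ i, 2 ≤ ζg i + ηg i)
    {μ R Cf Cg ν₀ ν₁ ν₂ : ℝ} (hCf : 0 ≤ Cf) (hCg : 0 ≤ Cg)
    (hν : 0 < ν₂) {K : ℝ}
    (hK : K = ν₂ * energyConst ζf ηf ζg ηg Cf Cg |ν₀| |ν₁| ν₂⁻¹ R) {w₁ w₂ : H S}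
    (hw₁ : w₁ ∈ DA S bc) (hw₁R : ‖w₁‖ ≤ 2 * R) {F G φ₁ φ₂ : ℝ}
    (hF : -F ≤ Cf * ∑ i, ‖w₁‖ ^ ζf i * normDA S bc w₁ ^ ηf i)
    (hG : -G ≤ Cg * ∑ i, ‖w₁‖ ^ ζg i * normDA S bc w₁ ^ ηg i)
    (hφ₁ : (K + μ) * ‖w₁‖ ^ 2 ≤ ν₂ / 4 * normDA S bc w₁ ^ 2 - φ₁)
    (hφ₂ : (1 + μ) * ‖w₂‖ ^ 2 ≤ 5 / 8 * normV S bc w₂ ^ 2 - φ₂) (hw₂ : w₂ ∈ V S bc) :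
    2 * ((-ν₂ * ⟪opA0 S bc w₁, opA0 S bc w₁⟫ - ν₁ * ν₀ * ⟪opA0 S bc w₁, w₁⟫
        + ν₁ * formV0 S bc w₂ w₁ - F - G + φ₁)
      + (-formV0 S bc w₂ w₂ + ν₀ * ⟪opA0 S bc w₁, w₂⟫ + φ₂))
      ≤ -(ν₂ / 2 * normDA S bc w₁ ^ 2 + 1 / 2 * normV S bc w₂ ^ 2
        + 2 * μ * (‖w₁‖ ^ 2 + ‖w₂‖ ^ 2)) := by
  have hV := DA_subset_V hw₁
  have g1 := growth_le hn hηf hηf2 hf2 hCf hν (norm_nonneg w₁) hw₁R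
    (norm_nonneg (opA S bc w₁))
  have g2 := growth_le hn hηg hηg2 hg2 hCg hν (norm_nonneg w₁) hw₁R
    (norm_nonneg (opA S bc w₁))
  have alg := energy_algebra (v := normV S bc w₂) hν (normV_sq_le hw₁) (abs_nonneg ν₀)
    (abs_nonneg ν₁)
  have e1 : ⟪opA0 S bc w₁, opA0 S bc w₁⟫
      = normDA S bc w₁ ^ 2 - 2 * normV S bc w₁ ^ 2 + ‖w₁‖ ^ 2 := by
    rw [real_inner_self_eq_norm_sq, norm_opA0_sq hw₁]
  have e2 : -(ν₁ * ν₀ * ⟪opA0 S bc w₁, w₁⟫) ≤ |ν₀| * |ν₁| * normV S bc w₁ ^ 2 := by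
    rw [inner_opA0 hw₁ hV]
    have h1 : formV0 S bc w₁ w₁ ≤ normV S bc w₁ ^ 2 := by
      rw [normV_sq]; linarith [sq_nonneg ‖w₁‖]
    calc -(ν₁ * ν₀ * formV0 S bc w₁ w₁) = -(ν₁ * ν₀) * formV0 S bc w₁ w₁ := by ring
      _ ≤ |ν₁ * ν₀| * formV0 S bc w₁ w₁ :=
        mul_le_mul_of_nonneg_right (neg_le_abs _) (formV0_self_nonneg _)
      _ ≤ |ν₁ * ν₀| * normV S bc w₁ ^ 2 := mul_le_mul_of_nonneg_left h1 (abs_nonneg _)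
      _ = _ := by rw [abs_mul]; ring
  have e3 : ∀ c x : ℝ, |x| ≤ normV S bc w₂ * normV S bc w₁ →
      c * x ≤ |c| * (normV S bc w₂ * normV S bc w₁) := fun c x hx =>
    (le_abs_self _).trans (by rw [abs_mul]; exact mul_le_mul_of_nonneg_left hx (abs_nonneg _))
  have e4 := e3 ν₁ _ (abs_formV0_le w₂ w₁)
  have e5 := e3 ν₀ (formV0 S bc w₂ w₁) (abs_formV0_le w₂ w₁)
  have e6 : ⟪opA0 S bc w₁, w₂⟫ = formV0 S bc w₂ w₁ := by
    rw [inner_opA0 hw₁ hw₂, formV0_comm]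
  have e7 : formV0 S bc w₂ w₂ = normV S bc w₂ ^ 2 - ‖w₂‖ ^ 2 := by rw [normV_sq]; ring
  have hKx : K * ‖w₁‖ ^ 2 = ν₂ * (7 + 4 * (|ν₀| * |ν₁|) ^ 2 * ν₂⁻¹ ^ 2
        + 16 * (|ν₀| + |ν₁|) ^ 4 * ν₂⁻¹ ^ 2) * ‖w₁‖ ^ 2
      + ν₂ * growthConst ζf ηf Cf ν₂⁻¹ R * ‖w₁‖ ^ 2
      + ν₂ * growthConst ζg ηg Cg ν₂⁻¹ R * ‖w₁‖ ^ 2 := by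
    rw [hK, energyConst]; ring
  rw [e1, e6, e7]
  unfold normDA at *
  have : 0 ≤ ν₂ * ‖opA S bc w₁‖ ^ 2 := by positivity
  linarith

namespace IsSolution

variable {a : ActuatorData d} {M : ℕ} {lam₁ lam₂ ν₀ ν₁ ν₂ : ℝ} {f g : ℝ → ℝ} {yr : ℝ → H S}
  {z₁ z₂ : ℝ → H S}

lemma integrableOn_normDA (h : IsSolution S bc a M lam₁ lam₂ ν₀ ν₁ ν₂ f g yr z₁ z₂) {s : ℝ}
    (hs : 0 ≤ s) (t : ℝ) : IntegrableOn (fun τ => normDA S bc (z₁ τ) ^ 2) (Ioc s t) := by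
  have h1 := (h.memLp₁ (max t 1) (by positivity)).norm.integrable_sq
  exact IntegrableOn.mono_set h1 (Ioc_subset_Ioc hs (le_max_left _ _))

lemma integrableOn_sqNorm (h : IsSolution S bc a M lam₁ lam₂ ν₀ ν₁ ν₂ f g yr z₁ z₂) {s : ℝ}
    (hs : 0 ≤ s) (t : ℝ) : IntegrableOn (sqNorm z₁ z₂) (Ioc s t) :=
  (memLp_two_of_continuousOn h.cont₁ hs).norm.integrable_sq.add
    (memLp_two_of_continuousOn h.cont₂ hs).norm.integrable_sq

lemma integrableOn_normV (h : IsSolution S bc a M lam₁ lam₂ ν₀ ν₁ ν₂ f g yr z₁ z₂) {s : ℝ}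
    (hs : 0 ≤ s) (t : ℝ) : IntegrableOn (fun τ => normV S bc (z₂ τ) ^ 2) (Ioc s t) := by
  have h1 : IntegrableOn (fun τ => ∑ i, ‖grad S bc (z₂ τ) i‖ ^ 2) (Ioc s t) :=
    integrable_finsetSum _ fun i _ => IntegrableOn.mono_set
      (h.memLp₂ (max t 1) (by positivity) i).norm.integrable_sq
      (Ioc_subset_Ioc hs (le_max_left _ _))
  have h2 := (memLp_two_of_continuousOn (t := t) h.cont₂ hs).norm.integrable_sq
  refine (h1.add h2).congr (ae_of_all _ fun τ => ?_)
  simp only [Pi.add_apply]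
  rw [normV_sq, formV0_self]

lemma energy_le (h : IsSolution S bc a M lam₁ lam₂ ν₀ ν₁ ν₂ f g yr z₁ z₂) (hS : S.Admissible bc)
    {n : ℕ} (hn : 1 ≤ n) {ζf ηf ζg ηg : Fin n → ℝ}
    (hηf : ∀ i, 0 ≤ ηf i) (hηg : ∀ i, 0 ≤ ηg i) (hηf2 : ∀ i, ηf i < 2) (hηg2 : ∀ i, ηg i < 2)
    (hf2 : ∀ i, 2 ≤ ζf i + ηf i) (hg2 : ∀ i, 2 ≤ ζg i + ηg i)
    {μ R Cf Cg : ℝ} (hR : 0 < R) (hCf : 0 ≤ Cf) (hCg : 0 ≤ Cg) (hν : 0 < ν₂)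
    (hN : GrowthBounds S bc f g yr ζf ηf ζg ηg Cf Cg) {K : ℝ}
    (hK : K = ν₂ * energyConst ζf ηf ζg ηg Cf Cg |ν₀| |ν₁| ν₂⁻¹ R)
    (hφ₁ : ∀ w ∈ DA S bc, (K + μ) * ‖w‖ ^ 2
      ≤ ν₂ / 4 * normDA S bc w ^ 2 - ⟪feedback₁ S bc a M lam₁ w, w⟫)
    (hφ₂ : ∀ w ∈ V S bc, (1 + μ) * ‖w‖ ^ 2
      ≤ 5 / 8 * normV S bc w ^ 2 - ⟪feedback₂ S bc a M lam₂ w, w⟫)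
    {s t : ℝ} (hs : 0 < s) (hst : s < t)
    (hE : ∀ τ ∈ Icc s t, sqNorm z₁ z₂ τ ≤ 4 * R ^ 2) :
    sqNorm z₁ z₂ t + ∫ τ in s..t, (ν₂ / 2 * normDA S bc (z₁ τ) ^ 2
      + 1 / 2 * normV S bc (z₂ τ) ^ 2 + 2 * μ * sqNorm z₁ z₂ τ) ≤ sqNorm z₁ z₂ s := by
  obtain ⟨i₁, b₁⟩ := h.energy₁ hS hN hs hst
  obtain ⟨i₂, b₂⟩ := h.energy₂ hS hs hst
  have hD : IntegrableOn (fun τ => ν₂ / 2 * normDA S bc (z₁ τ) ^ 2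
      + 1 / 2 * normV S bc (z₂ τ) ^ 2 + 2 * μ * sqNorm z₁ z₂ τ) (Ioc s t) :=
    (((h.integrableOn_normDA hs.le t).const_mul _).add
      ((h.integrableOn_normV hs.le t).const_mul _)).add ((h.integrableOn_sqNorm hs.le t).const_mul _)
  have key := integral_mono_ae ((i₁.add i₂).const_mul 2) hD.neg ?_
  · rw [integral_const_mul, integral_add' i₁ i₂] at key
    simp only [Pi.neg_apply] at key
    rw [integral_neg] at key
    rw [intervalIntegral.integral_of_le hst.le]
    unfold sqNorm at *
    linarith
  · filter_upwards [ae_Ioc_of_ae_Ioi hN hs.le t, ae_Ioc_of_ae_Ioi h.mem₁ hs.le t,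
      ae_Ioc_of_ae_Ioi h.mem₂ hs.le t, ae_restrict_mem measurableSet_Ioc] with τ h1 h2 h3 h4
    obtain ⟨-, -, hF, hG⟩ := h1 _ h2
    have hw : ‖z₁ τ‖ ≤ 2 * R := by
      have := hE τ ⟨h4.1.le, h4.2⟩
      refine abs_le_of_sq_le_sq' ?_ (by positivity) |>.2
      unfold sqNorm at this
      nlinarith [sq_nonneg ‖z₂ τ‖]
    exact energy_pointwise hn hηf hηg hηf2 hηg2 hf2 hg2 hCf hCg hν hK h2 hw hF hG
      (hφ₁ _ h2) (hφ₂ _ h3) h3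

end IsSolution

/-- A continuous function which satisfies an energy inequality as long as it stays below `4 R²`
satisfies it for all times if it is at most `R²` initially. -/
lemma energy_le_of_bootstrap {E D : ℝ → ℝ} {R : ℝ} (hR : 0 < R) (hE : ContinuousOn E (Ici 0))
    (hD : ∀ s t, 0 ≤ s → IntegrableOn D (Ioc s t)) (hD0 : ∀ τ, 0 ≤ D τ)
    (h : ∀ s t, 0 < s → s < t → (∀ τ ∈ Icc s t, E τ ≤ 4 * R ^ 2) →
      E t + ∫ τ in s..t, D τ ≤ E s) (h0 : E 0 ≤ R ^ 2) {s t : ℝ} (hs : 0 ≤ s) (hst : s ≤ t) :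
    E t + ∫ τ in s..t, D τ ≤ E s := by
  have hint : ∀ s t, 0 ≤ s → s ≤ t → IntervalIntegrable D volume s t := fun s t hs hst =>
    (intervalIntegrable_iff_integrableOn_Ioc_of_le hst).2 (hD s t hs)
  have hR2 : 0 < R ^ 2 := by positivity
  have step : ∀ s t, 0 ≤ s → s ≤ t → (∀ τ ∈ Icc s t, E τ ≤ 4 * R ^ 2) →
      E t + ∫ τ in s..t, D τ ≤ E s := by
    intro s t hs hst hb
    rcases hst.eq_or_lt with rfl | hst
    · simp
    -- The inequality is given for positive initial times only, since backward difference quotients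
    -- look behind `s`. Continuity in the initial time adds `s = 0`.
    have hc : ContinuousOn (fun x => ∫ τ in x..t, D τ) (Icc s t) := by
      have h1 : ContinuousOn (fun x => ∫ τ in t..x, D τ) (uIcc t s) := by
        refine intervalIntegral.continuousOn_primitive_interval ?_
        rw [uIcc_of_ge hst.le, integrableOn_Icc_iff_integrableOn_Ioc]
        exact hD s t hs
      rw [uIcc_of_ge hst.le] at h1
      exact h1.neg.congr fun x _ => intervalIntegral.integral_symm _ _
    have hEc : ContinuousOn E (Icc s t) := hE.mono fun x hx => hs.trans hx.1
    have hcl : closure (Ioo s t) = Icc s t := closure_Ioo hst.ne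
    have hle : ∀ x ∈ closure (Ioo s t), E t + ∫ τ in x..t, D τ ≤ E x := fun x hx =>
      le_on_closure (f := fun x => E t + ∫ τ in x..t, D τ) (g := E)
        (fun y hy => h y t (hs.trans_lt hy.1) hy.2 fun τ hτ => hb τ ⟨hy.1.le.trans hτ.1, hτ.2⟩)
        (by rw [hcl]; exact continuousOn_const.add hc) (by rw [hcl]; exact hEc) hx
    exact hle s (by rw [hcl]; exact left_mem_Icc.2 hst.le)
  have hdec : ∀ s t, 0 ≤ s → s ≤ t → (∀ τ ∈ Icc s t, E τ ≤ 4 * R ^ 2) → E t ≤ E s :=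
    fun s t hs hst hb => by
      have := intervalIntegral.integral_nonneg (μ := volume) hst fun τ _ => hD0 τ
      linarith [step s t hs hst hb]
  -- Continuous induction: the condition `E ≤ R²` is closed, and where it holds, `E` stays below `4
  -- R²` for a short time. During that time `E` does not increase, so `E ≤ R²` persists.
  have hbd : ∀ T, 0 ≤ T → ∀ τ ∈ Icc 0 T, E τ ≤ R ^ 2 := by
    intro T hT
    have hcont : ContinuousOn E (Icc 0 T) := hE.mono fun x hx => hx.1
    have hsub : Icc 0 T ⊆ {τ | E τ ≤ R ^ 2} := by
      refine IsClosed.Icc_subset_of_forall_exists_gt ?_ h0 ?_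
      · rw [inter_comm]
        exact hcont.preimage_isClosed_of_isClosed isClosed_Icc isClosed_Iic
      · intro x hx y hy
        have hx0 : 0 ≤ x := hx.2.1
        have hxE : E x ≤ R ^ 2 := hx.1
        have hev : ∀ᶠ τ in nhdsWithin x (Ici 0), E τ < 4 * R ^ 2 :=
          (hE x hx0).eventually_lt_const (by linarith)
        rw [eventually_nhdsWithin_iff, Metric.eventually_nhds_iff] at hev
        obtain ⟨δ, hδ, hb⟩ := hev
        refine ⟨min y (x + δ / 2), ?_, lt_min hy (by linarith), min_le_left _ _⟩
        refine (hdec x _ hx0 (le_min (le_of_lt hy) (by linarith)) fun τ hτ => ?_).trans hxE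
        have h2 := hτ.2.trans (min_le_right _ _)
        refine (hb ?_ (hx0.trans hτ.1)).le
        rw [Real.dist_eq, abs_of_nonneg (by linarith [hτ.1])]
        linarith
    exact fun τ hτ => hsub hτ
  exact step s t hs hst fun τ hτ =>
    (hbd t (hs.trans hst) τ ⟨hs.trans hτ.1, hτ.2⟩).trans (by linarith)

/-- Exponential decay from an integral inequality. -/
lemma exp_decay_of_integral_le {E : ℝ → ℝ} {c : ℝ} (hc : 0 < c) (hE0 : ∀ t, 0 ≤ E t)
    (hE : ∀ s t, 0 ≤ s → IntegrableOn E (Ioc s t))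
    (h : ∀ s t, 0 ≤ s → s ≤ t → E t + c * ∫ τ in s..t, E τ ≤ E s) {s t : ℝ} (hs : 0 ≤ s)
    (hst : s ≤ t) : E t ≤ Real.exp (-c * (t - s)) * E s := by
  have hdec : ∀ s t, 0 ≤ s → s ≤ t → E t ≤ E s := fun s t hs hst => by
    have := intervalIntegral.integral_nonneg (μ := volume) hst fun τ _ => hE0 τ
    nlinarith [h s t hs hst]
  -- `E` is nonincreasing, so its integral is at least `(t - s) E t`. This is an implicit Euler
  -- step; dividing `[s, t]` into `k` such steps and letting `k → ∞` gives the exponential.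
  have hstep : ∀ s t, 0 ≤ s → s ≤ t → E t * (1 + c * (t - s)) ≤ E s := fun s t hs hst => by
    have h1 : ∫ _τ in s..t, E t ≤ ∫ τ in s..t, E τ :=
      intervalIntegral.integral_mono_on hst (by simp)
        ((intervalIntegrable_iff_integrableOn_Ioc_of_le hst).2 (hE s t hs))
        fun τ hτ => hdec τ t (hs.trans hτ.1) hτ.2
    rw [intervalIntegral.integral_const, smul_eq_mul] at h1
    nlinarith [h s t hs hst, mul_le_mul_of_nonneg_left h1 hc.le]
  have hpow : ∀ (δ : ℝ), 0 ≤ δ → ∀ k : ℕ, E (s + k * δ) * (1 + c * δ) ^ k ≤ E s := by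
    intro δ hδ k
    induction k with
    | zero => simp
    | succ k ih =>
      have h1 := hstep (s + k * δ) (s + (k + 1 : ℕ) * δ) (by positivity)
        (by push_cast; linarith)
      have e : s + (k + 1 : ℕ) * δ - (s + k * δ) = δ := by push_cast; ring
      rw [e] at h1
      have h2 := mul_le_mul_of_nonneg_right h1 (by positivity : 0 ≤ (1 + c * δ) ^ k)
      calc E (s + (k + 1 : ℕ) * δ) * (1 + c * δ) ^ (k + 1)
          = E (s + (k + 1 : ℕ) * δ) * (1 + c * δ) * (1 + c * δ) ^ k := by ring
        _ ≤ _ := h2.trans ih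
  have hlim : Filter.Tendsto (fun k : ℕ => E t * (1 + c * (t - s) / k) ^ k) Filter.atTop
      (nhds (E t * Real.exp (c * (t - s)))) :=
    (Real.tendsto_one_add_div_pow_exp _).const_mul _
  have hle : E t * Real.exp (c * (t - s)) ≤ E s := by
    refine le_of_tendsto hlim ?_
    filter_upwards [Filter.eventually_ge_atTop 1] with k hk
    have hk0 : (0 : ℝ) < k := by exact_mod_cast hk
    have := hpow ((t - s) / k) (div_nonneg (by linarith) hk0.le) k
    rwa [mul_div_cancel₀ _ hk0.ne', add_sub_cancel, ← mul_div_assoc] at this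
  rw [neg_mul, Real.exp_neg, inv_mul_eq_div, le_div_iff₀ (Real.exp_pos _)]
  exact hle

/-- A nonnegative function with uniformly bounded integrals over bounded intervals. -/
lemma integrableOn_Ioi_of_integral_le {D : ℝ → ℝ} {s B : ℝ} (hD0 : ∀ τ, 0 ≤ D τ)
    (hD : ∀ t, IntegrableOn D (Ioc s t)) (h : ∀ t, s ≤ t → ∫ τ in s..t, D τ ≤ B) :
    IntegrableOn D (Ioi s) := by
  refine integrableOn_Ioi_of_intervalIntegral_norm_bounded B s (b := id) (l := Filter.atTop)
    (fun t => hD t) Filter.tendsto_id ?_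
  filter_upwards [Filter.eventually_ge_atTop s] with t ht
  simpa only [id, Real.norm_of_nonneg (hD0 _)] using h t ht

end

/-! ### Conclusions from the energy inequality -/

section

variable {d : ℕ} {S : Shape d} {bc : BC}

/-- Decay and the integral bounds, from the energy inequality. -/
lemma IsSolution.stable {a : ActuatorData d} {M : ℕ} {lam₁ lam₂ ν₀ ν₁ ν₂ : ℝ} {f g : ℝ → ℝ}
    {yr : ℝ → H S} {z₁ z₂ : ℝ → H S} (h : IsSolution S bc a M lam₁ lam₂ ν₀ ν₁ ν₂ f g yr z₁ z₂)
    {μ : ℝ} (hμ : 0 < μ) (hν : 0 < ν₂)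
    (hE : ∀ s t, 0 ≤ s → s ≤ t → sqNorm z₁ z₂ t + ∫ τ in s..t, (ν₂ / 2 * normDA S bc (z₁ τ) ^ 2
      + 1 / 2 * normV S bc (z₂ τ) ^ 2 + 2 * μ * sqNorm z₁ z₂ τ) ≤ sqNorm z₁ z₂ s) :
    (∀ s t, 0 ≤ s → s ≤ t →
      sqNorm z₁ z₂ t ≤ Real.exp (-2 * μ * (t - s)) * sqNorm z₁ z₂ s) ∧
    (∀ s t, 0 ≤ s → s ≤ t →
      sqNorm z₁ z₂ t + ν₂ / 2 * (∫ τ in s..t, normDA S bc (z₁ τ) ^ 2)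
        + 1 / 2 * (∫ τ in s..t, normV S bc (z₂ τ) ^ 2)
        + 2 * μ * (∫ τ in s..t, sqNorm z₁ z₂ τ) ≤ sqNorm z₁ z₂ s) ∧
    (∀ s, 0 ≤ s →
      IntegrableOn (fun τ => normDA S bc (z₁ τ) ^ 2) (Ioi s) ∧
      IntegrableOn (fun τ => normV S bc (z₂ τ) ^ 2) (Ioi s) ∧
      IntegrableOn (fun τ => sqNorm z₁ z₂ τ) (Ioi s) ∧
      ν₂ / 2 * (∫ τ in Ioi s, normDA S bc (z₁ τ) ^ 2)
        + 1 / 2 * (∫ τ in Ioi s, normV S bc (z₂ τ) ^ 2)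
        + 2 * μ * (∫ τ in Ioi s, sqNorm z₁ z₂ τ) ≤ sqNorm z₁ z₂ s) := by
  have hE0 : ∀ t, 0 ≤ sqNorm z₁ z₂ t := fun t => by unfold sqNorm; positivity
  have hsplit : ∀ s t, 0 ≤ s → s ≤ t →
      sqNorm z₁ z₂ t + ν₂ / 2 * (∫ τ in s..t, normDA S bc (z₁ τ) ^ 2)
        + 1 / 2 * (∫ τ in s..t, normV S bc (z₂ τ) ^ 2)
        + 2 * μ * (∫ τ in s..t, sqNorm z₁ z₂ τ) ≤ sqNorm z₁ z₂ s := fun s t hs hst => by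
    have i₁ := (intervalIntegrable_iff_integrableOn_Ioc_of_le hst).2 (h.integrableOn_normDA hs t)
    have i₂ := (intervalIntegrable_iff_integrableOn_Ioc_of_le hst).2 (h.integrableOn_normV hs t)
    have i₃ := (intervalIntegrable_iff_integrableOn_Ioc_of_le hst).2 (h.integrableOn_sqNorm hs t)
    have := hE s t hs hst
    rw [intervalIntegral.integral_add ((i₁.const_mul _).add (i₂.const_mul _)) (i₃.const_mul _),
      intervalIntegral.integral_add (i₁.const_mul _) (i₂.const_mul _),
      intervalIntegral.integral_const_mul, intervalIntegral.integral_const_mul,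
      intervalIntegral.integral_const_mul] at this
    linarith
  have hnn : ∀ s t, s ≤ t → 0 ≤ ν₂ / 2 * ∫ τ in s..t, normDA S bc (z₁ τ) ^ 2 := fun s t hst =>
    mul_nonneg (by positivity) (intervalIntegral.integral_nonneg hst fun _ _ => by positivity)
  have hnn₂ : ∀ s t, s ≤ t → 0 ≤ ∫ τ in s..t, normV S bc (z₂ τ) ^ 2 := fun s t hst =>
    intervalIntegral.integral_nonneg hst fun _ _ => by positivity
  have hnn₃ : ∀ s t, s ≤ t → 0 ≤ 2 * μ * ∫ τ in s..t, sqNorm z₁ z₂ τ := fun s t hst =>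
    mul_nonneg (by positivity) (intervalIntegral.integral_nonneg hst fun _ _ => hE0 _)
  refine ⟨fun s t hs hst => ?_, hsplit, fun s hs => ?_⟩
  · have := exp_decay_of_integral_le (c := 2 * μ) (by positivity) hE0
      (fun s t hs => h.integrableOn_sqNorm hs t) (fun s t hs hst => by
        linarith [hsplit s t hs hst, hnn s t hst, hnn₂ s t hst]) hs hst
    rwa [← neg_mul] at this
  · have I₁ : IntegrableOn (fun τ => normDA S bc (z₁ τ) ^ 2) (Ioi s) := by
      refine integrableOn_Ioi_of_integral_le (B := sqNorm z₁ z₂ s / (ν₂ / 2))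
        (fun _ => by positivity) (h.integrableOn_normDA hs) fun t hst => ?_
      rw [le_div_iff₀' (by positivity)]
      linarith [hsplit s t hs hst, hnn₂ s t hst, hnn₃ s t hst, hE0 t]
    have I₂ : IntegrableOn (fun τ => normV S bc (z₂ τ) ^ 2) (Ioi s) := by
      refine integrableOn_Ioi_of_integral_le (B := 2 * sqNorm z₁ z₂ s)
        (fun _ => by positivity) (h.integrableOn_normV hs) fun t hst => ?_
      linarith [hsplit s t hs hst, hnn s t hst, hnn₃ s t hst, hE0 t]
    have I₃ : IntegrableOn (fun τ => sqNorm z₁ z₂ τ) (Ioi s) := by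
      refine integrableOn_Ioi_of_integral_le (B := sqNorm z₁ z₂ s / (2 * μ))
        hE0 (h.integrableOn_sqNorm hs) fun t hst => ?_
      rw [le_div_iff₀' (by positivity)]
      linarith [hsplit s t hs hst, hnn s t hst, hnn₂ s t hst, hE0 t]
    refine ⟨I₁, I₂, I₃, ?_⟩
    have l₁ := intervalIntegral_tendsto_integral_Ioi s I₁ Filter.tendsto_id
    have l₂ := intervalIntegral_tendsto_integral_Ioi s I₂ Filter.tendsto_id
    have l₃ := intervalIntegral_tendsto_integral_Ioi s I₃ Filter.tendsto_id
    refine le_of_tendsto (((l₁.const_mul (ν₂ / 2)).add (l₂.const_mul (1 / 2))).add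
      (l₃.const_mul (2 * μ))) ?_
    filter_upwards [Filter.eventually_ge_atTop s] with t hst
    simp only [id]
    linarith [hsplit s t hs hst, hE0 t]

/-- Absorbing a multiple of `‖w‖²` by the coercivity of the feedback. -/
lemma absorb_of_coercive {C M k c x y s lam : ℝ} (hM : 0 < M) (hk : 0 ≤ k) (hs : 0 ≤ s)
    (hx : x ≤ C / M * (y + s) + 2 * s) (hy : 0 ≤ y) (hCM : k * C ≤ c * M)
    (hlam : c + 2 * k ≤ lam) : k * x ≤ c * y - -lam * s := by
  -- The threshold `c + 2 k` for the gain pays for `c s`, left by the term with `C / M`, and for `2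
  -- k s`.
  have h1 : k * (C / M) ≤ c := by
    rw [← mul_div_assoc, div_le_iff₀ hM]
    exact hCM
  have h2 := mul_le_mul_of_nonneg_left hx hk
  have h3 : k * (C / M) * (y + s) ≤ c * (y + s) :=
    mul_le_mul_of_nonneg_right h1 (by positivity)
  have h4 := mul_le_mul_of_nonneg_right hlam hs
  linarith

end

end CahnHilliard

end

theorem theorem3p2 {d : ℕ} (hd : 1 ≤ d) (hd3 : d ≤ 3)
    (S : CahnHilliard.Shape d) (bc : CahnHilliard.BC) (hS : S.Admissible bc)
    (a : CahnHilliard.ActuatorData d) (ha : a.Admissible S)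
    (n : ℕ) (hn : 1 ≤ n) (ζf ηf ζg ηg : Fin n → ℝ)
    (hζf : ∀ i, 0 ≤ ζf i) (hηf : ∀ i, 0 ≤ ηf i) (hζg : ∀ i, 0 ≤ ζg i) (hηg : ∀ i, 0 ≤ ηg i)
    (hηf2 : ∀ i, ηf i < 2) (hηg2 : ∀ i, ηg i < 2)
    (hf2 : ∀ i, 2 ≤ ζf i + ηf i) (hg2 : ∀ i, 2 ≤ ζg i + ηg i) :
    ∃ (Mbar : (Fin 7 → ℝ) → ℕ) (lambar₁ : (Fin 8 → ℝ) → ℝ) (lambar₂ : ℝ → ℝ),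
      (∀ p, 1 ≤ Mbar p) ∧ (∀ p, 0 ≤ lambar₁ p) ∧ (∀ p, 0 ≤ lambar₂ p) ∧
      MonotoneOn Mbar (Set.Ici 0) ∧ MonotoneOn lambar₁ (Set.Ici 0) ∧
      MonotoneOn lambar₂ (Set.Ici 0) ∧
      ∀ μ R Cf Cg ν₀ ν₁ ν₂ : ℝ, 0 < μ → 0 < R → 0 ≤ Cf → 0 ≤ Cg → 0 < ν₂ →
      ∀ (f g : ℝ → ℝ) (yr : ℝ → CahnHilliard.H S),
        CahnHilliard.GrowthBounds S bc f g yr ζf ηf ζg ηg Cf Cg →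
      ∀ (M : ℕ) (lam₁ lam₂ : ℝ),
        Mbar ![μ, Cf, Cg, |ν₀|, |ν₁|, ν₂⁻¹, R] ≤ M →
        lambar₁ ![μ, Cf, Cg, |ν₀|, |ν₁|, ν₂, ν₂⁻¹, R] ≤ lam₁ →
        lambar₂ μ ≤ lam₂ →
      ∀ z₁ z₂ : ℝ → CahnHilliard.H S,
        CahnHilliard.IsSolution S bc a M lam₁ lam₂ ν₀ ν₁ ν₂ f g yr z₁ z₂ →
        √(CahnHilliard.sqNorm z₁ z₂ 0) ≤ R →
        (∀ s t, 0 ≤ s → s ≤ t →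
          CahnHilliard.sqNorm z₁ z₂ t
            ≤ Real.exp (-2 * μ * (t - s)) * CahnHilliard.sqNorm z₁ z₂ s) ∧
        (∀ s t, 0 ≤ s → s ≤ t →
          CahnHilliard.sqNorm z₁ z₂ t
            + ν₂ / 2 * (∫ τ in s..t, CahnHilliard.normDA S bc (z₁ τ) ^ 2)
            + 1 / 2 * (∫ τ in s..t, CahnHilliard.normV S bc (z₂ τ) ^ 2)
            + 2 * μ * (∫ τ in s..t, CahnHilliard.sqNorm z₁ z₂ τ)
            ≤ CahnHilliard.sqNorm z₁ z₂ s) ∧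
        (∀ s, 0 ≤ s →
          MeasureTheory.IntegrableOn (fun τ => CahnHilliard.normDA S bc (z₁ τ) ^ 2) (Set.Ioi s) ∧
          MeasureTheory.IntegrableOn (fun τ => CahnHilliard.normV S bc (z₂ τ) ^ 2) (Set.Ioi s) ∧
          MeasureTheory.IntegrableOn (fun τ => CahnHilliard.sqNorm z₁ z₂ τ) (Set.Ioi s) ∧
          ν₂ / 2 * (∫ τ in Set.Ioi s, CahnHilliard.normDA S bc (z₁ τ) ^ 2)
            + 1 / 2 * (∫ τ in Set.Ioi s, CahnHilliard.normV S bc (z₂ τ) ^ 2)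
            + 2 * μ * (∫ τ in Set.Ioi s, CahnHilliard.sqNorm z₁ z₂ τ)
            ≤ CahnHilliard.sqNorm z₁ z₂ s) := by
  obtain ⟨C₁, hC₁, hcoer₁⟩ := CahnHilliard.exists_coercive_feedback₁ hS ha
  obtain ⟨C₂, hC₂, hcoer₂⟩ := CahnHilliard.exists_coercive_feedback₂ hS ha
  have hnn : ∀ {m : ℕ} {p : Fin m → ℝ}, p ∈ Set.Ici 0 → ∀ i, 0 ≤ p i := fun hp i => hp i
  have hκmono : ∀ {Cf Cg n₀ n₁ νi R Cf' Cg' n₀' n₁' νi' R' : ℝ}, 0 ≤ Cf → 0 ≤ Cg → 0 ≤ n₀ →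
      0 ≤ n₁ → 0 ≤ νi → 0 ≤ R → Cf ≤ Cf' → Cg ≤ Cg' → n₀ ≤ n₀' → n₁ ≤ n₁' → νi ≤ νi' → R ≤ R' →
      CahnHilliard.energyConst ζf ηf ζg ηg Cf Cg n₀ n₁ νi R
        ≤ CahnHilliard.energyConst ζf ηf ζg ηg Cf' Cg' n₀' n₁' νi' R' :=
    CahnHilliard.energyConst_mono hηf hηg hηf2 hηg2 hf2 hg2
  -- With `k = ν₂ κ + μ` and `c = ν₂ / 4` for the first feedback, and `k = 1 + μ`, `c = 5 / 8` for
  -- the second, absorption requires `k C ≤ c M` and `c + 2 k ≤ λ`. Division by `ν₂ / 4` leaves only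
  -- `ν₂⁻¹` in the condition on `M`; both conditions on `M` are met by their sum. The absolute
  -- values ensure nonnegativity outside the cone of nonnegative arguments. In `lambar₁` the entry
  -- `p 5` is `ν₂`, which shifts `ν₂⁻¹` and `R` by one place.
  refine ⟨fun p => ⌈4 * C₁ * (CahnHilliard.energyConst ζf ηf ζg ηg (p 1) (p 2) (p 3) (p 4) (p 5)
      (p 6) + p 0 * p 5) + 8 / 5 * C₂ * (1 + p 0)⌉₊ + 1,
    fun p => |p 5 / 4 + 2 * (p 5 * CahnHilliard.energyConst ζf ηf ζg ηg (p 1) (p 2) (p 3) (p 4)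
      (p 6) (p 7) + p 0)|, fun x => |5 / 8 + 2 * (1 + x)|, fun p => Nat.le_add_left 1 _,
    fun p => abs_nonneg _, fun p => abs_nonneg _, ?_, ?_, ?_, ?_⟩
  · intro p hp q hq hpq
    have h0 := hnn hp
    have hκ := hκmono (h0 1) (h0 2) (h0 3) (h0 4) (h0 5) (h0 6) (hpq 1) (hpq 2) (hpq 3) (hpq 4)
      (hpq 5) (hpq 6)
    have h05 : p 0 * p 5 ≤ q 0 * q 5 := mul_le_mul (hpq 0) (hpq 5) (h0 5) (hnn hq 0)
    have h0' := hpq 0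
    dsimp only
    gcongr
  · intro p hp q hq hpq
    have h0 := hnn hp
    have hκ := hκmono (h0 1) (h0 2) (h0 3) (h0 4) (h0 6) (h0 7) (hpq 1) (hpq 2) (hpq 3) (hpq 4)
      (hpq 6) (hpq 7)
    have hκ0 := CahnHilliard.energyConst_nonneg (ζf := ζf) (ηf := ηf) (ζg := ζg) (ηg := ηg)
      (n₀ := p 3) (n₁ := p 4) (h0 1) (h0 2) (h0 6) (h0 7)
    have h5 := mul_le_mul (hpq 5) hκ hκ0 (hnn hq 5)
    have h5' := mul_nonneg (h0 5) hκ0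
    have h6 := hpq 5
    have h7 := hpq 0
    exact abs_le_abs_of_nonneg (by linarith [h0 5, h0 0]) (by linarith)
  · intro x hx y _ hxy
    have hx' : 0 ≤ x := hx
    exact abs_le_abs_of_nonneg (by linarith) (by linarith)
  · intro μ R Cf Cg ν₀ ν₁ ν₂ hμ hR hCf hCg hν f g yr hN M lam₁ lam₂ hM hlam₁ hlam₂ z₁ z₂ hz hz0
    set κ := CahnHilliard.energyConst ζf ηf ζg ηg Cf Cg |ν₀| |ν₁| ν₂⁻¹ R with hκ
    have hκ0 : 0 ≤ κ := CahnHilliard.energyConst_nonneg hCf hCg (inv_pos.2 hν).le hR.le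
    change ⌈4 * C₁ * (κ + μ * ν₂⁻¹) + 8 / 5 * C₂ * (1 + μ)⌉₊ + 1 ≤ M at hM
    change |ν₂ / 4 + 2 * (ν₂ * κ + μ)| ≤ lam₁ at hlam₁
    change |5 / 8 + 2 * (1 + μ)| ≤ lam₂ at hlam₂
    have hM1 : 1 ≤ M := (Nat.le_add_left 1 _).trans hM
    have hMr : 4 * C₁ * (κ + μ * ν₂⁻¹) + 8 / 5 * C₂ * (1 + μ) ≤ M :=
      (Nat.le_ceil _).trans (by exact_mod_cast (Nat.le_succ _).trans hM)
    have hM0 : (0 : ℝ) < M := by exact_mod_cast hM1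
    have hA₁ : 0 ≤ 4 * C₁ * (κ + μ * ν₂⁻¹) := by positivity
    have hA₂ : 0 ≤ 8 / 5 * C₂ * (1 + μ) := by positivity
    have hCM₁ : (ν₂ * κ + μ) * C₁ ≤ ν₂ / 4 * M := by
      have h1 : 4 * C₁ * (κ + μ * ν₂⁻¹) ≤ M := by linarith
      have h2 := mul_le_mul_of_nonneg_left h1 (by positivity : 0 ≤ ν₂ / 4)
      refine le_trans (le_of_eq ?_) h2
      field_simp
    have hCM₂ : (1 + μ) * C₂ ≤ 5 / 8 * M := by linarith
    -- `energy_le` holds while the energy is at most `4 R²`; the bootstrap removes this proviso. The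
    -- two remaining goals are the absorption inequalities for the feedback operators.
    refine hz.stable hμ hν fun s t hs hst => CahnHilliard.energy_le_of_bootstrap hR
      ((hz.cont₁.norm.pow 2).add (hz.cont₂.norm.pow 2))
      (fun s t hs => (((hz.integrableOn_normDA hs t).const_mul _).add
        ((hz.integrableOn_normV hs t).const_mul _)).add ((hz.integrableOn_sqNorm hs t).const_mul _))
      (fun τ => by simp only [Pi.add_apply, CahnHilliard.sqNorm]; positivity) (fun s t hs hst hE =>
        hz.energy_le (K := ν₂ * κ) hS hn hηf hηg hηf2 hηg2 hf2 hg2 hR hCf hCg hν hN rfl (fun w hw => ?_)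
          (fun w hw => ?_) hs hst hE) (Real.sqrt_le_left hR.le |>.1 hz0) hs hst
    · obtain ⟨σ, hσ, hfb, hle⟩ := hcoer₁ M hM1 w hw
      rw [hfb]
      exact CahnHilliard.absorb_of_coercive hM0 (by positivity) hσ hle (by positivity) hCM₁
        ((le_abs_self _).trans hlam₁)
    · obtain ⟨σ, hσ, hfb, hle⟩ := hcoer₂ M hM1 w hw
      rw [hfb]
      exact CahnHilliard.absorb_of_coercive hM0 (by positivity) hσ hle (by positivity) hCM₂
        ((le_abs_self _).trans hlam₂)
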